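/- Let $i,j,k,\ell,m$ be positive integers with $i+j=k+\ell=m$ and $j=\min\{i,j,k,\ell\}$. For integers $n,r,c\ge 0$ put $$U(n,r,c)=2c+r-3-2\left\lfloor\frac{mc+kr+i-n-1}{j}\right\rfloor,\qquad L(n,r,c)=2c+r-3-2\left\lfloor\frac{mc+\ell r+i-n-1}{j}\right\rfloor .$$ The Gale–Robinson pinecone $P(n)=P(n;i,j,k,\ell)$ is the following finite subgraph of the square lattice $\mathbb Z^2$. - Its horizontal edges are the unit edges of the segments from $(r,r+1)$ to $(U(n,r,0),r+1)$, for all $r\ge 0$ with $U(n,r,0)>r$, and from $(r,-r)$ to $(L(n,r,0),-r)$, for all $r\ge0$ with $L(n,r,0)>r$. - Its vertices are the endpoints of its horizontal edges. - Its vertical edges are all edges $\{(a,b),(a,b+1)\}$ with $a+b$ even that join two vertices, together with the edges joining $(U(n,r,c),r)$ to $(U(n,r,c),r+1)$ for $r,c\ge 0$ with $U(n,r,c)>r$, and the edges joining $(L(n,r,c),-r)$ to $(L(n,r,c),-r+1)$ for $r,c\ge0$ with $L(n,r,c)>r$. (The empty graph has exactly one perfect matching, the empty one.) A *black square* of $P(n)$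 is a unit cell with lower-left corner $(a,b)$, $a+b$ even, whose four sides are all edges of $P(n)$; it lies in row $b$ and is said to lie weakly to the right of abscissa $x$ if $a\ge x$. A horizontal edge with leftmost vertex $(x,y)$ is *ordinary* if there is a black square in rows $y-1$ and $y$ weakly to the right of $x$ and the closest such square lies in row $y-1$ (when $x+y$ is even), respectively in row $y$ (when $x+y$ is odd). All other horizontal edges are *special*. Let $q(n)=q(n;u,v)$ be the sum, over all perfect matchings of $P(n)$, of $u^{s}v^{t}$, where $s$ is the number of special horizontal edges and $t$ the number of vertical edges in the matching. **Theorem.** One has $q(n)=1$ for $0\le n<m$, and for all $n\ge m$ $$q(n)\,q(n-m)=u^2\,q(n-i)\,q(n-j)+v^2\,q(n-k)\,q(n-\ell).$$ Consequently, let $p(n)=p(n;w,z)$ be the unique sequence of rational functions in two indeterminates $w,z$ such that $p(n)=1$ for $0\le n<m$ and $p(n)p(n-m)=w\,p(n-i)p(n-j)+z\,p(n-k)p(n-\ell)$ for $n\ge m$ (such a sequence exists and is unique). Then every $p(n)$ is a polynomial in $w$ and $z$ with nonnegative integer coefficients, and $q(n;u,v)=p(n;u^2,v^2)$ for all $n\ge0$.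 -/

import Mathlib

/-- The square lattice on `ℤ × ℤ`: two points are adjacent when they are at distance one in the
horizontal or in the vertical direction. -/
def squareGrid : SimpleGraph (ℤ × ℤ) where
  Adj p q := (p.2 = q.2 ∧ (q.1 = p.1 + 1 ∨ p.1 = q.1 + 1)) ∨
    (p.1 = q.1 ∧ (q.2 = p.2 + 1 ∨ p.2 = q.2 + 1))
  symm := ⟨by rintro p q (⟨h, h'⟩ | ⟨h, h'⟩) <;> simp [h, h'.symm]⟩
  loopless := ⟨by rintro p (⟨_, h⟩ | ⟨_, h⟩) <;> omega⟩

namespace GaleRobinson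

/-- `U(n,r,c) = 2c + r - 3 - 2⌊((i+j)c + kr + i - n - 1)/j⌋`. (For `j > 0`, integer division by `j`
is division rounded down.) The lower function `L(n,r,c)` is the same expression with `ℓ` instead
of `k`, that is, `oddAbscissa i j l n r c`. -/
def oddAbscissa (i j k n r c : ℕ) : ℤ :=
  2 * (c : ℤ) + r - 3 - 2 * ((((i : ℤ) + j) * c + k * r + i - n - 1) / (j : ℤ))

/-- `a` is the left end of a horizontal edge `{a, a + (1,0)}` of `P(n;i,j,k,l)`. For each `r ≥ 0`
there is a horizontal segment from `(r, r+1)` to `(U(n,r,0), r+1)` if `r < U(n,r,0)`, and one from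
`(r,-r)` to `(L(n,r,0), -r)` if `r < L(n,r,0)`; there is no other horizontal edge. -/
def IsHorizontalEdge (i j k l n : ℕ) (a : ℤ × ℤ) : Prop :=
  ∃ r : ℕ, (r : ℤ) ≤ a.1 ∧
    ((a.2 = (r : ℤ) + 1 ∧ a.1 + 1 ≤ oddAbscissa i j k n r 0) ∨
      (a.2 = -(r : ℤ) ∧ a.1 + 1 ≤ oddAbscissa i j l n r 0))

/-- The vertices of `P(n;i,j,k,l)` are the points incident to a horizontal edge. -/
def IsVertex (i j k l n : ℕ) (a : ℤ × ℤ) : Prop :=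
  IsHorizontalEdge i j k l n a ∨ IsHorizontalEdge i j k l n (a.1 - 1, a.2)

/-- `a` is the lower end of an odd vertical edge `{a, a + (0,1)}`: these edges are placed in row
`r ≥ 0` at the abscissas `U(n,r,c) > r`, and in row `-r ≤ 0` at the abscissas `L(n,r,c) > r`. -/
def IsOddVerticalEdge (i j k l n : ℕ) (a : ℤ × ℤ) : Prop :=
  ∃ r c : ℕ, (r : ℤ) < a.1 ∧
    ((a.2 = (r : ℤ) ∧ a.1 = oddAbscissa i j k n r c) ∨
      (a.2 = -(r : ℤ) ∧ a.1 = oddAbscissa i j l n r c))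

/-- `a` is the lower end of a vertical edge `{a, a + (0,1)}` of `P(n;i,j,k,l)`. All even vertical
edges of the lattice that join two vertices are present; an odd one is present exactly when
it is prescribed by `U` or `L`. -/
def IsVerticalEdge (i j k l n : ℕ) (a : ℤ × ℤ) : Prop :=
  IsVertex i j k l n a ∧ IsVertex i j k l n (a.1, a.2 + 1) ∧
    (Even (a.1 + a.2) ∨ IsOddVerticalEdge i j k l n a)

/-- The Gale–Robinson pinecone `P(n;i,j,k,l)`. -/
def pinecone (i j k l n : ℕ) : squareGrid.Subgraph where
  verts := {a | IsVertex i j k l n a}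
  Adj p q := (q = (p.1 + 1, p.2) ∧ IsHorizontalEdge i j k l n p) ∨
    (p = (q.1 + 1, q.2) ∧ IsHorizontalEdge i j k l n q) ∨
    (q = (p.1, p.2 + 1) ∧ IsVerticalEdge i j k l n p) ∨
    (p = (q.1, q.2 + 1) ∧ IsVerticalEdge i j k l n q)
  adj_sub := by
    rintro p q (⟨rfl, -⟩ | ⟨rfl, -⟩ | ⟨rfl, -⟩ | ⟨rfl, -⟩) <;> simp [squareGrid]
  edge_vert := by
    rintro p q (⟨rfl, h⟩ | ⟨rfl, h⟩ | ⟨rfl, h⟩ | ⟨rfl, h⟩)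
    · exact Or.inl h
    · exact Or.inr (by simpa using h)
    · exact h.1
    · exact h.2.1
  symm := ⟨by rintro p q (h | h | h | h) <;> simp [h]⟩

/-- `b` is the lower-left corner of a black square of `P`: a cell of the same colour as the cell
with lower-left corner `(0,0)`, in the chessboard colouring, whose four sides are edges of `P`. -/
def IsBlackSquare (P : squareGrid.Subgraph) (b : ℤ × ℤ) : Prop :=
  Even (b.1 + b.2) ∧ P.Adj b (b.1 + 1, b.2) ∧ P.Adj (b.1, b.2 + 1) (b.1 + 1, b.2 + 1) ∧
    P.Adj b (b.1, b.2 + 1) ∧ P.Adj (b.1 + 1, b.2) (b.1 + 1, b.2 + 1)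

/-- Among the black squares in rows `s` and `t` weakly to the right of abscissa `x`, there is a
closest one, and it lies in row `s`. (Row `s` consists of the cells between ordinates `s` and
`s + 1`.) -/
def ClosestBlackSquareInRow (P : squareGrid.Subgraph) (x s t : ℤ) : Prop :=
  ∃ c, x ≤ c ∧ IsBlackSquare P (c, s) ∧ ∀ c', x ≤ c' → IsBlackSquare P (c', t) → c < c'

/-- The horizontal edge with left end `a = (x,y)` is ordinary: either `x + y` is even and the
closest black square of rows `y - 1` and `y` weakly to its right lies in row `y - 1`, or `x + y` is
odd and that square lies in row `y`. -/
def IsOrdinary (P : squareGrid.Subgraph) (a : ℤ × ℤ) : Prop :=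
  (Even (a.1 + a.2) ∧ ClosestBlackSquareInRow P a.1 (a.2 - 1) a.2) ∨
    (Odd (a.1 + a.2) ∧ ClosestBlackSquareInRow P a.1 a.2 (a.2 - 1))

/-- The perfect matchings of `P`, as spanning subgraphs of `P` that are matchings. -/
def perfectMatchings (P : squareGrid.Subgraph) : Set squareGrid.Subgraph :=
  {M | M ≤ P ∧ M.verts = P.verts ∧ M.IsMatching}

/-- The number of special (that is, not ordinary) horizontal edges of `P` used in `M`; a
horizontal edge is represented by its left end. -/
noncomputable def specialCount (P M : squareGrid.Subgraph) : ℕ :=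
  {a : ℤ × ℤ | M.Adj a (a.1 + 1, a.2) ∧ ¬ IsOrdinary P a}.ncard

/-- The number of vertical edges used in `M`; a vertical edge is represented by its lower end. -/
noncomputable def verticalCount (M : squareGrid.Subgraph) : ℕ :=
  {a : ℤ × ℤ | M.Adj a (a.1, a.2 + 1)}.ncard

/-- The polynomial in `u = X 0` and `v = X 1` that counts the perfect matchings of
`P(n;i,j,k,l)` by the number of special horizontal edges (the exponent of `u`) and the number of
vertical edges (the exponent of `v`). -/
noncomputable def q (i j k l n : ℕ) : MvPolynomial (Fin 2) ℕ :=
  ∑ᶠ M ∈ perfectMatchings (pinecone i j k l n),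
    MvPolynomial.X 0 ^ specialCount (pinecone i j k l n) M * MvPolynomial.X 1 ^ verticalCount M

/-- The three-term Gale–Robinson recurrence with weights `w` and `z` and with initial values `1`. -/
def IsGaleRobinsonSequence {R : Type*} [CommSemiring R] (i j k l m : ℕ) (w z : R) (p : ℕ → R) :
    Prop :=
  (∀ n, n < m → p n = 1) ∧
    ∀ n, m ≤ n →
      p n * p (n - m) = w * (p (n - i) * p (n - j)) + z * (p (n - k) * p (n - l))

/-- The field of rational functions in two indeterminates `w` and `z`. -/
abbrev RationalFunctions : Type := FractionRing (MvPolynomial (Fin 2) ℤ)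

theorem oddAbscissa_bounds {i j k n r : ℕ} (hj : 0 < j) (hjk : j ≤ k)
    (h : (r : ℤ) < oddAbscissa i j k n r 0) : (r : ℤ) ≤ n ∧ oddAbscissa i j k n r 0 ≤ 3 * n := by
  have hj' : (0 : ℤ) < j := by exact_mod_cast hj
  have hjk' : (j : ℤ) ≤ k := by exact_mod_cast hjk
  have hrk : (r : ℤ) ≤ k * r := by nlinarith [Int.natCast_nonneg r]
  unfold oddAbscissa at *
  simp only [Nat.cast_zero, mul_zero, zero_add] at *
  set N : ℤ := (k : ℤ) * r + i - n - 1 with hN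
  have h1 : N < (j : ℤ) * (N / j) + j := by
    have := Int.lt_mul_ediv_self_add (x := N) hj'
    simpa using this
  have h2 : N / j ≤ -2 := by omega
  have h3 : (j : ℤ) * (N / j) ≤ (N / j) := by nlinarith
  have h4 : (j : ℤ) * (N / j) ≤ j * (-2) := by gcongr
  have hrn : (r : ℤ) ≤ n := by omega
  refine ⟨hrn, ?_⟩
  -- `-n - 1 ≤ N / j`
  have h5 : -(n : ℤ) - 1 ≤ N / j := by
    rw [Int.le_ediv_iff_mul_le hj']
    have : (0 : ℤ) ≤ n := Int.natCast_nonneg n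
    nlinarith [Int.natCast_nonneg i]
  omega

/-- The pinecones are finite graphs (so the sum that defines `q` is a finite one). -/
theorem pinecone_verts_finite {i j k l : ℕ} (n : ℕ) (hj : 0 < j) (hjk : j ≤ k) (hjl : j ≤ l) :
    (pinecone i j k l n).verts.Finite := by
  have key : ∀ a, IsHorizontalEdge i j k l n a →
      0 ≤ a.1 ∧ a.1 ≤ 3 * n ∧ -(n : ℤ) ≤ a.2 ∧ a.2 ≤ n + 1 := by
    rintro a ⟨r, hr, ⟨h1, h2⟩ | ⟨h1, h2⟩⟩
    · have := oddAbscissa_bounds hj hjk (by omega : (r : ℤ) < oddAbscissa i j k n r 0)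
      omega
    · have := oddAbscissa_bounds hj hjl (by omega : (r : ℤ) < oddAbscissa i j l n r 0)
      omega
  refine Set.Finite.subset (Set.finite_Icc ((0 : ℤ), -(n : ℤ)) ((3 * n + 1 : ℤ), (n + 1 : ℤ))) ?_
  rintro a (h | h)
  · have := key _ h
    simp only [Set.mem_Icc, Prod.le_def]
    omega
  · have := key _ h
    simp only [Set.mem_Icc, Prod.le_def] at this ⊢
    omega

theorem perfectMatchings_finite {P : squareGrid.Subgraph} (h : P.verts.Finite) :
    (perfectMatchings P).Finite := by
  have hfin : (𝒫 (P.verts ×ˢ P.verts)).Finite := (h.prod h).finite_subsets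
  refine Set.Finite.of_finite_image (f := fun M => {x : (ℤ × ℤ) × (ℤ × ℤ) | M.Adj x.1 x.2})
    (hfin.subset ?_) ?_
  · rintro _ ⟨M, hM, rfl⟩ x hx
    have := hM.1.2 hx
    exact ⟨P.edge_vert this, P.edge_vert this.symm⟩
  · intro M hM M' hM' hMM
    refine SimpleGraph.Subgraph.ext (hM.2.1.trans hM'.2.1.symm) ?_
    funext x y
    exact congrArg (fun s => (x, y) ∈ s) hMM

end GaleRobinson

/-! Read a perfect matching from left to right as a history of particles on the rows $y\in\mathbb
Z$, at most one per row. After column $x$ the row $y$ is occupied iff the horizontal edge with left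
end $(x,y)$ is used (when $x+y$ is even), or is not used (when $x+y$ is odd). The condition that
each vertex is covered once becomes conservation: a used even vertical edge moves a particle one row
up, a used odd one moves a particle one row down. Perfect matchings of the pinecone are the
histories from the vacuum (all rows $y\le 0$ filled) to itself with jumps along its vertical edges.

Jumps join neighbouring rows, so weighted sums over histories are minors of one matrix
(`exists_amplitude_eq_det`). The Desnanot–Jacobi identity then relates the vacua filled up to $s-1$,
$s$, $s+1$ and the excited state. Adjoining a first possible jump $a$ and a last possible jump $b$
in row $s$ turns it into $Z_s(V\cup\{a,b\})Z_s(V)=Z_s(V\cup a)Z_s(V\cup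
b)+\omega_a\omega_bZ_{s+1}(V)Z_{s-1}(V)$ (`amplitude_condensation`).

A jump far from row $s$ needs earlier and later jumps closer to $s$. With the interlacing of the odd
edges this confines vacuum histories to a cone determined by the extreme admissible jumps of row $s$
(`IsHistory.subset_cone`). All six factors are therefore sums over cones in one doubly infinite
pattern, and these cones are translates of the pinecones of $n$, $n-m$, $n-i$, $n-j$, $n-k$, $n-l$.

The number of special edges is that of the jump-free matching plus a contribution of each jump
(`IsPinecone.specialCount_eq`). The jump weights are the same in all six sums; two additive
identities for the jump-free counts produce $u^2$ and cancel the $u$-weights of $a$ and $b$, whose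
vertical edges leave $v^2$.

Finally, by induction $q(n)F(u^2,v^2)=G(u^2,v^2)$ with $F\ne0$, which forces $q(n)$ to be even in
each variable. Halving its exponents gives $p(n)$, with natural coefficients because $q(n)$ has
them; uniqueness follows by cancelling nonzero terms. -/

namespace GaleRobinson

/-! ### Dodgson condensation -/

section Determinants

variable {K : Type*} [Field K]

/-- The bordered minor of a block matrix obtained by keeping one of the last rows and one of the
last columns. -/
def borderedMatrix {ι κ R : Type*} (A : Matrix ι ι R) (B : Matrix ι κ R) (C : Matrix κ ι R)
    (D : Matrix κ κ R) (x y : κ) : Matrix (ι ⊕ Unit) (ι ⊕ Unit) R :=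
  Matrix.fromBlocks A (Matrix.of fun a _ => B a y) (Matrix.of fun _ b => C x b)
    (Matrix.of fun _ _ => D x y)

/-- Each bordered minor is $\det A$ times an entry of the Schur complement, so the identity is the
formula for a $2\times2$ determinant. -/
theorem desnanot_jacobi_of_ne_zero {ι : Type*} [Fintype ι] [DecidableEq ι]
    (A : Matrix ι ι K) (B : Matrix ι (Fin 2) K) (C : Matrix (Fin 2) ι K)
    (D : Matrix (Fin 2) (Fin 2) K) (hA : A.det ≠ 0) :
    (Matrix.fromBlocks A B C D).det * A.det =
      (borderedMatrix A B C D 0 0).det * (borderedMatrix A B C D 1 1).det -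
        (borderedMatrix A B C D 0 1).det * (borderedMatrix A B C D 1 0).det := by
  have : Invertible A := A.invertibleOfIsUnitDet (isUnit_iff_ne_zero.mpr hA)
  have key : ∀ x y, (borderedMatrix A B C D x y).det = A.det * (D - C * ⅟A * B) x y := by
    intro x y
    rw [borderedMatrix, Matrix.det_fromBlocks₁₁, Matrix.det_unique (n := Unit)]
    congr 1
  rw [Matrix.det_fromBlocks₁₁, Matrix.det_fin_two, key, key, key, key]
  ring

theorem borderedMatrix_map {ι κ R S : Type*} (A : Matrix ι ι R) (B : Matrix ι κ R)
    (C : Matrix κ ι R) (D : Matrix κ κ R) (x y : κ) (f : R → S) :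
    borderedMatrix (A.map f) (B.map f) (C.map f) (D.map f) x y =
      (borderedMatrix A B C D x y).map f := by
  ext (a | a) (b | b) <;> rfl

/-- The Desnanot–Jacobi identity (Dodgson condensation). -/
theorem desnanot_jacobi {ι : Type*} [Fintype ι] [DecidableEq ι]
    (A : Matrix ι ι K) (B : Matrix ι (Fin 2) K) (C : Matrix (Fin 2) ι K)
    (D : Matrix (Fin 2) (Fin 2) K) :
    (Matrix.fromBlocks A B C D).det * A.det =
      (borderedMatrix A B C D 0 0).det * (borderedMatrix A B C D 1 1).det -
        (borderedMatrix A B C D 0 1).det * (borderedMatrix A B C D 1 0).det := by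
  let f : Polynomial K →+* FractionRing (Polynomial K) := algebraMap _ _
  have hf : Function.Injective f := IsFractionRing.injective _ _
  let g : Polynomial K →+* K := Polynomial.evalRingHom 0
  -- The matrix $X\cdot 1+A$ has monic, hence nonzero, determinant and specializes to $A$ at $X=0$;
  -- this removes the hypothesis $\det A\ne0$.
  let A' : Matrix ι ι (Polynomial K) := (-A).charmatrix
  let B' : Matrix ι (Fin 2) (Polynomial K) := B.map Polynomial.C
  let C' : Matrix (Fin 2) ι (Polynomial K) := C.map Polynomial.C
  let D' : Matrix (Fin 2) (Fin 2) (Polynomial K) := D.map Polynomial.C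
  have hA' : A'.map g = A := by
    ext a b
    by_cases h : a = b
    · subst h
      simp [A', g]
    · simp [A', g, Matrix.charmatrix_apply_ne _ _ _ h]
  have hB' : B'.map g = B := by ext a b; simp [B', g]
  have hC' : C'.map g = C := by ext a b; simp [C', g]
  have hD' : D'.map g = D := by ext a b; simp [D', g]
  have hdet : (A'.map f).det ≠ 0 := by
    rw [← RingHom.mapMatrix_apply, ← RingHom.map_det]
    have : A'.det ≠ 0 := (Matrix.charpoly_monic (-A)).ne_zero
    exact fun h => this (hf (by rw [h, map_zero]))
  have h1 := desnanot_jacobi_of_ne_zero (A'.map f) (B'.map f) (C'.map f) (D'.map f) hdet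
  simp only [borderedMatrix_map, ← Matrix.fromBlocks_map] at h1
  simp only [← RingHom.mapMatrix_apply, ← RingHom.map_det, ← map_mul, ← map_sub] at h1
  have h2 := congrArg g (hf h1)
  simp only [map_mul, map_sub, RingHom.map_det, RingHom.mapMatrix_apply] at h2
  simp only [← borderedMatrix_map, Matrix.fromBlocks_map, hA', hB', hC', hD'] at h2
  exact h2

/-- Dodgson condensation for the minors of a doubly infinite matrix with consecutive rows and
columns. -/
theorem desnanot_jacobi_consecutive (A : ℤ → ℤ → K) (lo : ℤ) (p : ℕ) :
    (Matrix.of fun a b : Fin (p + 2) => A (lo + a) (lo + b)).det *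
        (Matrix.of fun a b : Fin p => A (lo + a) (lo + b)).det =
      (Matrix.of fun a b : Fin (p + 1) => A (lo + a) (lo + b)).det *
        (Matrix.of fun a b : Fin (p + 1) => A (if (a : ℕ) < p then lo + a else lo + p + 1)
          (if (b : ℕ) < p then lo + b else lo + p + 1)).det -
      (Matrix.of fun a b : Fin (p + 1) => A (lo + a)
          (if (b : ℕ) < p then lo + b else lo + p + 1)).det *
        (Matrix.of fun a b : Fin (p + 1) => A (if (a : ℕ) < p then lo + a else lo + p + 1)
          (lo + b)).det := by
  have h := desnanot_jacobi (Matrix.of fun a b : Fin p => A (lo + a) (lo + b))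
    (Matrix.of fun (a : Fin p) (b : Fin 2) => A (lo + a) (lo + p + b))
    (Matrix.of fun (a : Fin 2) (b : Fin p) => A (lo + p + a) (lo + b))
    (Matrix.of fun (a : Fin 2) (b : Fin 2) => A (lo + p + a) (lo + p + b))
  let e : Fin p ⊕ Unit ≃ Fin (p + 1) :=
    (Equiv.sumCongr (Equiv.refl _) (Equiv.ofUnique Unit (Fin 1))).trans finSumFinEquiv
  have he1 : ∀ a, ((e (Sum.inl a) : Fin (p + 1)) : ℕ) = a := fun a => rfl
  have he2 : ∀ a, ((e (Sum.inr a) : Fin (p + 1)) : ℕ) = p := fun a => by simp [e]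
  have key : ∀ (x y : Fin 2) (I J : ℕ → ℤ), (∀ a, a < p → I a = lo + a) → I p = lo + p + x →
      (∀ a, a < p → J a = lo + a) → J p = lo + p + y →
      (Matrix.of fun a b : Fin (p + 1) => A (I a) (J b)).det =
        (borderedMatrix (Matrix.of fun a b : Fin p => A (lo + a) (lo + b))
          (Matrix.of fun (a : Fin p) (b : Fin 2) => A (lo + a) (lo + p + b))
          (Matrix.of fun (a : Fin 2) (b : Fin p) => A (lo + p + a) (lo + b))
          (Matrix.of fun (a : Fin 2) (b : Fin 2) => A (lo + p + a) (lo + p + b)) x y).det := by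
    intro x y I J hI hIp hJ hJp
    rw [← Matrix.det_submatrix_equiv_self e]
    congr 1
    ext (a | a) (b | b) <;> simp [borderedMatrix, he1, he2, hI, hIp, hJ, hJp]
  have hI : ∀ a : ℕ, a < p → (if a < p then lo + a else lo + p + 1 : ℤ) = lo + a :=
    fun a h => if_pos h
  have hIp : (if p < p then lo + p else lo + p + 1 : ℤ) = lo + p + (1 : Fin 2) := by simp
  rw [key 0 0 (fun a => lo + a) (fun a => lo + a) (fun _ _ => rfl) (by simp) (fun _ _ => rfl)
      (by simp),
    key 1 1 (fun a => if a < p then lo + a else lo + p + 1)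
      (fun a => if a < p then lo + a else lo + p + 1) hI hIp hI hIp,
    key 0 1 (fun a => lo + a) (fun a => if a < p then lo + a else lo + p + 1) (fun _ _ => rfl)
      (by simp) hI hIp,
    key 1 0 (fun a => if a < p then lo + a else lo + p + 1) (fun a => lo + a) hI hIp
      (fun _ _ => rfl) (by simp), ← h, ← Matrix.det_submatrix_equiv_self finSumFinEquiv]
  congr 2
  ext (a | a) (b | b) <;> simp [add_assoc]

end Determinants

/-! ### Particle histories and their determinants -/

section Particles

/-- The sign of a lattice point: `1` if the sum of its coordinates is even, `-1` otherwise. -/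
def siteSign (t : ℤ × ℤ) : ℤ := if Even (t.1 + t.2) then 1 else -1

/-- The change in the occupation of row `y` caused by a jump along the vertical edge with lower end
`t`: upwards if `t` is even, downwards if `t` is odd. -/
def jump (t : ℤ × ℤ) (y : ℤ) : ℤ :=
  siteSign t * ((if y = t.2 + 1 then 1 else 0) - (if y = t.2 then 1 else 0))

/-- The number of particles in row `y` after column `x`, if the initial occupation is `f` and the
vertical edges of `T` are used for jumps. -/
def occupation (T : Finset (ℤ × ℤ)) (f : ℤ → ℤ) (x y : ℤ) : ℤ :=
  f y + ∑ t ∈ T with t.1 ≤ x, jump t y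

/-- The jumps along `T` lead from the occupation `f` to the occupation `g`, and each row always
contains at most one particle. -/
def IsHistory (T : Finset (ℤ × ℤ)) (f g : ℤ → ℤ) : Prop :=
  (∀ x y, 0 ≤ occupation T f x y ∧ occupation T f x y ≤ 1) ∧ ∀ y, g y = f y + ∑ t ∈ T, jump t y

/-- The row from which a particle jumps along the vertical edge with lower end `t`. -/
def jumpSource (t : ℤ × ℤ) : ℤ := if Even (t.1 + t.2) then t.2 else t.2 + 1

/-- The row to which a particle jumps along the vertical edge with lower end `t`. -/
def jumpTarget (t : ℤ × ℤ) : ℤ := if Even (t.1 + t.2) then t.2 + 1 else t.2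

theorem jump_eq (t : ℤ × ℤ) (y : ℤ) :
    jump t y = (if y = jumpTarget t then 1 else 0) - (if y = jumpSource t then 1 else 0) := by
  unfold jump jumpTarget jumpSource siteSign
  split_ifs <;> omega

theorem jump_nonpos {t : ℤ × ℤ} {y : ℤ} (h : Even (t.1 + y)) : jump t y ≤ 0 := by
  unfold jump siteSign
  split_ifs with h1 h2 h3 h2 h3 <;> first | omega | (exfalso; subst_vars; grind)

theorem jump_nonneg {t : ℤ × ℤ} {y : ℤ} (h : Odd (t.1 + y)) : 0 ≤ jump t y := by
  unfold jump siteSign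
  split_ifs with h1 h2 h3 h2 h3 <;> first | omega | (exfalso; subst_vars; grind)

theorem even_add_jumpSource (t : ℤ × ℤ) : Even (t.1 + jumpSource t) := by
  unfold jumpSource; split_ifs <;> grind

theorem odd_add_jumpTarget (t : ℤ × ℤ) : Odd (t.1 + jumpTarget t) := by
  unfold jumpTarget; split_ifs <;> grind

theorem jumpTarget_ne_jumpSource (t : ℤ × ℤ) : jumpTarget t ≠ jumpSource t := by
  unfold jumpTarget jumpSource; split_ifs <;> omega

/-- In column $x$ every jump leaves a row with $x+y$ even and enters a row with $x+y$ odd. Hence the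
order of the jumps within a column is irrelevant and it suffices to bound the occupation after whole
columns. -/
theorem occupation_mono_of_odd {T : Finset (ℤ × ℤ)} {f : ℤ → ℤ} {x y : ℤ} (h : Odd (x + y)) :
    occupation T f (x - 1) y ≤ occupation T f x y := by
  unfold occupation
  refine (add_le_add_iff_left _).mpr ?_
  refine Finset.sum_le_sum_of_subset_of_nonneg ?_ ?_
  · intro t ht
    simp only [Finset.mem_filter] at ht ⊢
    exact ⟨ht.1, by omega⟩
  · intro t ht ht'
    simp only [Finset.mem_filter, not_and] at ht ht'
    have := ht' ht.1
    exact jump_nonneg (by rwa [show t.1 = x by omega])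

theorem occupation_anti_of_even {T : Finset (ℤ × ℤ)} {f : ℤ → ℤ} {x y : ℤ} (h : Even (x + y)) :
    occupation T f x y ≤ occupation T f (x - 1) y := by
  unfold occupation
  refine (add_le_add_iff_left _).mpr ?_
  rw [← neg_le_neg_iff, ← Finset.sum_neg_distrib, ← Finset.sum_neg_distrib]
  refine Finset.sum_le_sum_of_subset_of_nonneg ?_ ?_
  · intro t ht
    simp only [Finset.mem_filter] at ht ⊢
    exact ⟨ht.1, by omega⟩
  · intro t ht ht'
    simp only [Finset.mem_filter, not_and] at ht ht'
    have := ht' ht.1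
    have := jump_nonpos (t := t) (y := y) (by rwa [show t.1 = x by omega])
    omega

theorem occupation_insert {T : Finset (ℤ × ℤ)} {t : ℤ × ℤ} (ht : t ∉ T) (f : ℤ → ℤ) (x y : ℤ) :
    occupation (insert t T) f x y =
      occupation T f x y + if t.1 ≤ x then jump t y else 0 := by
  unfold occupation
  rw [Finset.filter_insert]
  split_ifs with h
  · rw [Finset.sum_insert (by simp [ht])]; ring
  · ring

theorem occupation_of_forall_le {T : Finset (ℤ × ℤ)} (f : ℤ → ℤ) {x : ℤ} (y : ℤ)
    (h : ∀ t ∈ T, t.1 ≤ x) : occupation T f x y = f y + ∑ t ∈ T, jump t y := by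
  rw [occupation, Finset.filter_true_of_mem h]

theorem occupation_of_forall_lt {T : Finset (ℤ × ℤ)} (f : ℤ → ℤ) {x : ℤ} (y : ℤ)
    (h : ∀ t ∈ T, x < t.1) : occupation T f x y = f y := by
  rw [occupation, Finset.filter_false_of_mem (fun t ht => not_le.mpr (h t ht))]; simp

theorem exists_forall_le (T : Finset (ℤ × ℤ)) : ∃ x : ℤ, ∀ t ∈ T, t.1 ≤ x := by
  obtain ⟨x, hx⟩ := (T.image Prod.fst).bddAbove
  exact ⟨x, fun t ht => hx (Finset.mem_coe.mpr (Finset.mem_image_of_mem Prod.fst ht))⟩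

theorem IsHistory.final_mem {T : Finset (ℤ × ℤ)} {f g : ℤ → ℤ} (h : IsHistory T f g) (y : ℤ) :
    0 ≤ g y ∧ g y ≤ 1 := by
  obtain ⟨x, hx⟩ := exists_forall_le T
  simpa [occupation_of_forall_le f y hx, ← h.2 y] using h.1 x y

/-- When the jump is deleted, only the occupations of its source and target rows need a new bound.
One bound comes from the final state, the other from monotonicity within the column and the bound
one column earlier. -/
theorem isHistory_insert_last {T : Finset (ℤ × ℤ)} {t : ℤ × ℤ} (ht : t ∉ T)
    (hmax : ∀ s ∈ T, s.1 ≤ t.1) {f g : ℤ → ℤ} (hg : ∀ y, 0 ≤ g y ∧ g y ≤ 1) :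
    IsHistory (insert t T) f g ↔ IsHistory T f (fun y => g y - jump t y) := by
  have hlate : ∀ x y, t.1 ≤ x → occupation T f x y = f y + ∑ t ∈ T, jump t y := fun x y hx =>
    occupation_of_forall_le f y fun s hs => (hmax s hs).trans hx
  constructor
  · rintro ⟨h1, h2⟩
    have h2' : ∀ y, g y - jump t y = f y + ∑ t ∈ T, jump t y := by
      intro y
      have := h2 y
      rw [Finset.sum_insert ht] at this
      omega
    refine ⟨fun x y => ?_, h2'⟩
    rcases lt_or_ge x t.1 with hx | hx
    · simpa [occupation_insert ht, not_le.mpr hx] using h1 x y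
    rw [hlate x y hx, ← h2' y]
    have h3 := hg y
    have h4 : 0 ≤ occupation T f (t.1 - 1) y ∧ occupation T f (t.1 - 1) y ≤ 1 := by
      simpa [occupation_insert ht] using h1 (t.1 - 1) y
    have h5 := hlate t.1 y le_rfl
    rw [← h2' y] at h5
    have h6 := jump_eq t y
    by_cases hy : y = jumpSource t
    · have := occupation_anti_of_even (T := T) (f := f) (hy ▸ even_add_jumpSource t)
      have := jumpTarget_ne_jumpSource t
      rw [if_neg (by omega), if_pos hy] at h6
      omega
    by_cases hy' : y = jumpTarget t
    · have := occupation_mono_of_odd (T := T) (f := f) (hy' ▸ odd_add_jumpTarget t)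
      rw [if_pos (by omega), if_neg hy] at h6
      omega
    · rw [if_neg hy, if_neg hy'] at h6
      omega
  · rintro ⟨h1, h2⟩
    have h2' : ∀ y, g y = f y + ∑ t ∈ insert t T, jump t y := by
      intro y
      have h3 : g y - jump t y = f y + ∑ t ∈ T, jump t y := h2 y
      rw [Finset.sum_insert ht]
      omega
    refine ⟨fun x y => ?_, h2'⟩
    rw [occupation_insert ht]
    split_ifs with hx
    · rw [hlate x y hx, ← h2 y]
      simpa using hg y
    · simpa using h1 x y

theorem isHistory_insert_first {T : Finset (ℤ × ℤ)} {t : ℤ × ℤ} (ht : t ∉ T)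
    (hmin : ∀ s ∈ T, t.1 ≤ s.1) {f g : ℤ → ℤ} (hf : ∀ y, 0 ≤ f y ∧ f y ≤ 1) :
    IsHistory (insert t T) f g ↔ IsHistory T (fun y => f y + jump t y) g := by
  have hearly : ∀ (f : ℤ → ℤ) x y, x < t.1 → occupation T f x y = f y := fun f x y hx =>
    occupation_of_forall_lt f y fun s hs => hx.trans_le (hmin s hs)
  have hshift : ∀ x y, occupation T (fun y => f y + jump t y) x y =
      occupation T f x y + jump t y := by intro x y; simp only [occupation]; ring
  have hsum : (∀ y, g y = f y + ∑ t ∈ insert t T, jump t y) ↔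
      ∀ y, g y = f y + jump t y + ∑ t ∈ T, jump t y := by
    refine forall_congr' fun y => ?_
    rw [Finset.sum_insert ht, add_assoc]
  refine and_congr ⟨fun h1 x y => ?_, fun h1 x y => ?_⟩ hsum
  · rw [hshift]
    rcases le_or_gt t.1 x with hx | hx
    · simpa [occupation_insert ht, hx] using h1 x y
    rw [hearly f x y hx]
    have h3 := hf y
    have h4 := h1 t.1 y
    rw [occupation_insert ht, if_pos le_rfl] at h4
    have h5 := hearly f (t.1 - 1) y (by omega)
    have h6 := jump_eq t y
    by_cases hy : y = jumpSource t
    · have := occupation_anti_of_even (T := T) (f := f) (hy ▸ even_add_jumpSource t)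
      have := jumpTarget_ne_jumpSource t
      rw [if_neg (by omega), if_pos hy] at h6
      omega
    by_cases hy' : y = jumpTarget t
    · have := occupation_mono_of_odd (T := T) (f := f) (hy' ▸ odd_add_jumpTarget t)
      rw [if_pos (by omega), if_neg hy] at h6
      omega
    · rw [if_neg hy, if_neg hy'] at h6
      omega
  · rw [occupation_insert ht]
    split_ifs with hx
    · rw [← hshift]; exact h1 x y
    · simpa [hearly f x y (by omega)] using hf y

variable {K : Type*} [Field K]

open Classical in
/-- The sum over all histories with jumps along edges of `V` of the product of the weights of the
jumps. -/
noncomputable def amplitude (ω : ℤ × ℤ → K) (V : Finset (ℤ × ℤ)) (f g : ℤ → ℤ) : K :=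
  ∑ T ∈ V.powerset with IsHistory T f g, ∏ t ∈ T, ω t

theorem amplitude_eq_sum_ite (ω : ℤ × ℤ → K) (V : Finset (ℤ × ℤ)) (f g : ℤ → ℤ)
    [∀ T, Decidable (IsHistory T f g)] :
    amplitude ω V f g = ∑ T ∈ V.powerset, if IsHistory T f g then ∏ t ∈ T, ω t else 0 := by
  rw [amplitude, Finset.sum_filter]
  refine Finset.sum_congr rfl fun T _ => ?_
  congr

theorem amplitude_eq_zero_of_final (ω : ℤ × ℤ → K) (V : Finset (ℤ × ℤ)) (f g : ℤ → ℤ) (y : ℤ)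
    (h : g y < 0 ∨ 1 < g y) : amplitude ω V f g = 0 := by
  classical
  rw [amplitude, Finset.filter_false_of_mem, Finset.sum_empty]
  intro T _ hT
  have := hT.final_mem y
  omega

theorem amplitude_insert_last (ω : ℤ × ℤ → K) {V : Finset (ℤ × ℤ)} {t : ℤ × ℤ} (ht : t ∉ V)
    (hmax : ∀ s ∈ V, s.1 ≤ t.1) {f g : ℤ → ℤ} (hg : ∀ y, 0 ≤ g y ∧ g y ≤ 1) :
    amplitude ω (insert t V) f g =
      amplitude ω V f g + ω t * amplitude ω V f (fun y => g y - jump t y) := by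
  classical
  simp only [amplitude_eq_sum_ite]
  rw [Finset.sum_powerset_insert ht, Finset.mul_sum]
  congr 1
  refine Finset.sum_congr rfl fun T hT => ?_
  rw [Finset.mem_powerset] at hT
  rw [isHistory_insert_last (fun h => ht (hT h)) (fun s hs => hmax s (hT hs)) hg,
    Finset.prod_insert (fun h => ht (hT h)), mul_ite, mul_zero]

theorem amplitude_insert_first (ω : ℤ × ℤ → K) {V : Finset (ℤ × ℤ)} {t : ℤ × ℤ} (ht : t ∉ V)
    (hmin : ∀ s ∈ V, t.1 ≤ s.1) {f g : ℤ → ℤ} (hf : ∀ y, 0 ≤ f y ∧ f y ≤ 1) :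
    amplitude ω (insert t V) f g =
      amplitude ω V f g + ω t * amplitude ω V (fun y => f y + jump t y) g := by
  classical
  simp only [amplitude_eq_sum_ite]
  rw [Finset.sum_powerset_insert ht, Finset.mul_sum]
  congr 1
  refine Finset.sum_congr rfl fun T hT => ?_
  rw [Finset.mem_powerset] at hT
  rw [isHistory_insert_first (fun h => ht (hT h)) (fun s hs => hmin s (hT hs)) hf,
    Finset.prod_insert (fun h => ht (hT h)), mul_ite, mul_zero]

open Classical in
/-- The indicator function of the range of `I`. -/
noncomputable def rangeIndicator {p : ℕ} (I : Fin p → ℤ) (y : ℤ) : ℤ :=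
  if y ∈ Set.range I then 1 else 0

theorem rangeIndicator_mem {p : ℕ} (I : Fin p → ℤ) (y : ℤ) :
    0 ≤ rangeIndicator I y ∧ rangeIndicator I y ≤ 1 := by
  unfold rangeIndicator; split_ifs <;> simp

theorem rangeIndicator_of_mem {p : ℕ} {I : Fin p → ℤ} {y : ℤ} (h : y ∈ Set.range I) :
    rangeIndicator I y = 1 := if_pos h

theorem rangeIndicator_of_notMem {p : ℕ} {I : Fin p → ℤ} {y : ℤ} (h : y ∉ Set.range I) :
    rangeIndicator I y = 0 := if_neg h

theorem strictMono_update {p : ℕ} {J : Fin p → ℤ} (hJ : StrictMono J) (b : Fin p) {z : ℤ}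
    (hz : z = J b + 1 ∨ z = J b - 1) (h : z ∉ Set.range J) :
    StrictMono (Function.update J b z) := by
  intro c d hcd
  have hc : J c ≠ z := fun e => h ⟨c, e⟩
  have hd : J d ≠ z := fun e => h ⟨d, e⟩
  have := hJ hcd
  by_cases h1 : c = b
  · subst h1
    rw [Function.update_self, Function.update_of_ne hcd.ne']
    omega
  · rw [Function.update_of_ne h1]
    by_cases h2 : d = b
    · subst h2
      rw [Function.update_self]
      omega
    · rwa [Function.update_of_ne h2]

/-- Amplitudes between finite configurations are minors of one matrix (Lindström–Gessel–Viennot for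
particles that jump to neighbouring rows). -/
theorem exists_amplitude_eq_det (ω : ℤ × ℤ → K) (V : Finset (ℤ × ℤ)) :
    ∃ A : ℤ → ℤ → K, ∀ (p : ℕ) (I J : Fin p → ℤ), StrictMono I → StrictMono J →
      amplitude ω V (rangeIndicator I) (rangeIndicator J) =
        (Matrix.of fun a b => A (I a) (J b)).det := by
  classical
  induction V using Finset.induction_on_max_value (fun t : ℤ × ℤ => t.1) with
  | empty =>
    refine ⟨fun r c => if r = c then 1 else 0, fun p I J hI hJ => ?_⟩
    have h0 : IsHistory ∅ (rangeIndicator I) (rangeIndicator J) ↔ I = J := by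
      constructor
      · rintro ⟨-, h⟩
        simp only [Finset.sum_empty, add_zero] at h
        refine (hI.range_inj hJ).mp ?_
        ext y
        have := h y
        unfold rangeIndicator at this
        split_ifs at this <;> simp_all
      · rintro rfl
        exact ⟨by simpa [occupation] using rangeIndicator_mem I, by simp⟩
    rw [amplitude_eq_sum_ite, Finset.powerset_empty, Finset.sum_singleton, Finset.prod_empty]
    by_cases hIJ : I = J
    · subst hIJ
      rw [if_pos (h0.mpr rfl)]
      convert (Matrix.det_one (n := Fin p) (R := K)).symm using 2
      ext a b
      simp [Matrix.one_apply, hI.injective.eq_iff]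
    · rw [if_neg (fun h => hIJ (h0.mp h))]
      -- Both configurations have $p$ particles, so if they differ, some row of `I` is missing from
      -- `J` and the matrix has a zero row.
      have : ∃ a, I a ∉ Set.range J := by
        by_contra hcon
        push Not at hcon
        refine hIJ ((hI.range_inj hJ).mp ?_)
        have hsub : Finset.univ.image I ⊆ Finset.univ.image J := by
          intro y hy
          simp only [Finset.mem_image, Finset.mem_univ, true_and] at hy ⊢
          obtain ⟨a, rfl⟩ := hy
          exact hcon a
        have := Finset.eq_of_subset_of_card_le hsub (by
          rw [Finset.card_image_of_injective _ hI.injective,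
            Finset.card_image_of_injective _ hJ.injective])
        have := congrArg (fun s : Finset ℤ => (s : Set ℤ)) this
        simpa using this
      obtain ⟨a, ha⟩ := this
      refine (Matrix.det_eq_zero_of_row_eq_zero a fun b => ?_).symm
      simp only [Matrix.of_apply]
      rw [if_neg]
      exact fun e => ha ⟨b, e.symm⟩
  | insert t V ht hmax ih =>
    obtain ⟨A, hA⟩ := ih
    -- A last jump is a column operation: $\omega_t$ times the source column is added to the target
    -- column.
    refine ⟨fun r c => A r c + if c = jumpTarget t then ω t * A r (jumpSource t) else 0,
      fun p I J hI hJ => ?_⟩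
    rw [amplitude_insert_last ω ht hmax (rangeIndicator_mem J), hA p I J hI hJ]
    by_cases hT : jumpTarget t ∈ Set.range J
    · obtain ⟨b, hb⟩ := hT
      have hM : (Matrix.of fun a c => A (I a) (J c) +
          if J c = jumpTarget t then ω t * A (I a) (jumpSource t) else 0) =
          (Matrix.of fun a c => A (I a) (J c)).updateCol b
            ((fun a => A (I a) (J b)) + ω t • fun a => A (I a) (jumpSource t)) := by
        ext a c
        by_cases hc : c = b
        · subst hc; simp [hb]
        · have : J c ≠ jumpTarget t := fun e => hc (hJ.injective (e.trans hb.symm))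
          simp [hc, this]
      rw [hM, Matrix.det_updateCol_add, Matrix.det_updateCol_smul]
      congr 1
      · congr 1
        ext a c
        by_cases hc : c = b
        · subst hc; simp
        · simp [hc]
      · congr 1
        by_cases hS : jumpSource t ∈ Set.range J
        -- The state before the jump would have two particles in the source row; correspondingly,
        -- the determinant has two equal columns.
        · rw [amplitude_eq_zero_of_final _ _ _ _ (jumpSource t)]
          · obtain ⟨c, hc⟩ := hS
            have hcb : c ≠ b := by
              rintro rfl
              exact jumpTarget_ne_jumpSource t (hb.symm.trans hc)
            refine (Matrix.det_zero_of_column_eq hcb fun a => ?_).symm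
            simp [hcb, hc]
          · right
            have := jumpTarget_ne_jumpSource t
            rw [rangeIndicator_of_mem hS, jump_eq, if_neg (by omega), if_pos rfl]
            norm_num
        -- Source and target are neighbours, so moving the particle back keeps the rows in
        -- increasing order and no sign appears.
        · have hz : jumpSource t = J b + 1 ∨ jumpSource t = J b - 1 := by
            rw [hb]
            unfold jumpSource jumpTarget
            split_ifs <;> omega
          have hmono := strictMono_update hJ b hz hS
          have hind : (fun y => rangeIndicator J y - jump t y) =
              rangeIndicator (Function.update J b (jumpSource t)) := by
            funext y
            have hmem : y ∈ Set.range (Function.update J b (jumpSource t)) ↔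
                y = jumpSource t ∨ (y ∈ Set.range J ∧ y ≠ jumpTarget t) := by
              constructor
              · rintro ⟨c, rfl⟩
                by_cases hc : c = b
                · subst hc; simp
                · rw [Function.update_of_ne hc]
                  exact Or.inr ⟨⟨c, rfl⟩, fun e => hc (hJ.injective (e.trans hb.symm))⟩
              · rintro (rfl | ⟨⟨c, rfl⟩, hc⟩)
                · exact ⟨b, by simp⟩
                · exact ⟨c, by rw [Function.update_of_ne]; rintro rfl; exact hc hb⟩
            have hb' : jumpTarget t ∈ Set.range J := ⟨b, hb⟩
            have := jumpTarget_ne_jumpSource t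
            rw [jump_eq]
            unfold rangeIndicator
            by_cases h1 : y = jumpSource t
            · subst h1
              simp [hmem, hS, this.symm]
            · by_cases h2 : y = jumpTarget t
              · subst h2
                simp [hmem, h1, hb']
              · simp [hmem, h1, h2]
          rw [hind, hA p I _ hI hmono]
          congr 1
          ext a c
          by_cases hc : c = b
          · subst hc; simp
          · simp [hc]
    · rw [amplitude_eq_zero_of_final _ _ _ _ (jumpTarget t), mul_zero, add_zero]
      · congr 1
        ext a c
        have : J c ≠ jumpTarget t := fun e => hT ⟨c, e⟩
        simp [this]
      · left
        have := jumpTarget_ne_jumpSource t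
        rw [rangeIndicator_of_notMem hT, jump_eq, if_pos rfl, if_neg (by omega)]
        norm_num

end Particles

/-! ### Condensation for vacuum amplitudes -/

section Condensation

/-- The configuration with a particle in each row `y ≤ s`. -/
def vacuum (s y : ℤ) : ℤ := if y ≤ s then 1 else 0

/-- The configuration obtained from `vacuum s` by moving the highest particle one row up. -/
def excited (s y : ℤ) : ℤ := if y ≤ s - 1 ∨ y = s + 1 then 1 else 0

theorem vacuum_mem (s y : ℤ) : 0 ≤ vacuum s y ∧ vacuum s y ≤ 1 := by
  unfold vacuum; split_ifs <;> simp

variable {K : Type*} [Field K]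

/-- Rows below all jumps stay filled forever, so they can be emptied; this reduces the infinite
vacua to finite configurations, to which the determinant formula applies. -/
theorem isHistory_cut {T : Finset (ℤ × ℤ)} {lo : ℤ} (hT : ∀ t ∈ T, lo ≤ t.2) {f g : ℤ → ℤ}
    (hf : ∀ y < lo, f y = 1) (hg : ∀ y < lo, g y = 1) :
    IsHistory T f g ↔
      IsHistory T (fun y => if y < lo then 0 else f y) (fun y => if y < lo then 0 else g y) := by
  have hj : ∀ y < lo, ∀ t ∈ T, jump t y = 0 := by
    intro y hy t ht
    have := hT t ht
    unfold jump
    rw [if_neg (by omega), if_neg (by omega)]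
    simp
  unfold IsHistory occupation
  refine and_congr (forall_congr' fun x => forall_congr' fun y => ?_) (forall_congr' fun y => ?_)
  · dsimp only
    split_ifs with hy
    · rw [Finset.sum_eq_zero (fun t ht => hj y hy t (Finset.mem_of_mem_filter t ht)), hf y hy]
      simp
    · rfl
  · dsimp only
    split_ifs with hy
    · rw [Finset.sum_eq_zero (hj y hy), hf y hy, hg y hy]
      simp
    · rfl

theorem amplitude_cut (ω : ℤ × ℤ → K) {V : Finset (ℤ × ℤ)} {lo : ℤ} (hV : ∀ t ∈ V, lo ≤ t.2)
    {f g : ℤ → ℤ} (hf : ∀ y < lo, f y = 1) (hg : ∀ y < lo, g y = 1) :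
    amplitude ω V f g =
      amplitude ω V (fun y => if y < lo then 0 else f y) (fun y => if y < lo then 0 else g y) := by
  classical
  unfold amplitude
  refine Finset.sum_congr (Finset.filter_congr fun T hT => ?_) fun _ _ => rfl
  rw [Finset.mem_powerset] at hT
  exact isHistory_cut (fun t ht => hV t (hT ht)) hf hg

/-- Cut at `lo = s - p`: the vacua $s-1$, $s$, $s+1$ become the first $p$, $p+1$, $p+2$ rows, and
the excited state becomes the first $p$ rows together with row $s+1$. These are exactly the index
sets of Desnanot–Jacobi. -/
theorem amplitude_vacuum_excited (ω : ℤ × ℤ → K) (V : Finset (ℤ × ℤ)) (s : ℤ) :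
    amplitude ω V (vacuum (s + 1)) (vacuum (s + 1)) *
        amplitude ω V (vacuum (s - 1)) (vacuum (s - 1)) =
      amplitude ω V (vacuum s) (vacuum s) * amplitude ω V (excited s) (excited s) -
        amplitude ω V (vacuum s) (excited s) * amplitude ω V (excited s) (vacuum s) := by
  obtain ⟨lo, hlo, hV⟩ : ∃ lo : ℤ, lo ≤ s - 1 ∧ ∀ t ∈ V, lo ≤ t.2 := by
    obtain ⟨x, hx⟩ := (V.image Prod.snd).bddBelow
    exact ⟨min x (s - 1), min_le_right _ _, fun t ht => (min_le_left _ _).trans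
      (hx (Finset.mem_coe.mpr (Finset.mem_image_of_mem Prod.snd ht)))⟩
  obtain ⟨p, hp⟩ := Int.eq_ofNat_of_zero_le (show 0 ≤ s - lo by omega)
  obtain ⟨A, hA⟩ := exists_amplitude_eq_det ω V
  have hmono : ∀ r : ℕ, StrictMono (fun a : Fin r => lo + (a : ℤ)) := by
    intro r a b hab
    have : (a : ℕ) < b := hab
    dsimp only
    omega
  have hmono' : StrictMono
      (fun a : Fin (p + 1) => if (a : ℕ) < p then lo + (a : ℤ) else lo + p + 1) := by
    intro a b hab
    have : (a : ℕ) < b := hab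
    dsimp only
    split_ifs <;> omega
  have hvac : ∀ (r : ℕ) (z : ℤ), lo + r = z + 1 → (fun y => if y < lo then 0 else vacuum z y) =
      rangeIndicator (fun a : Fin r => lo + (a : ℤ)) := by
    intro r z hz
    funext y
    have : y ∈ Set.range (fun a : Fin r => lo + (a : ℤ)) ↔ lo ≤ y ∧ y ≤ z := by
      constructor
      · rintro ⟨a, rfl⟩
        have := a.2
        dsimp only
        omega
      · rintro ⟨h1, h2⟩
        exact ⟨⟨(y - lo).toNat, by omega⟩, by dsimp only; omega⟩
    unfold rangeIndicator vacuum
    rw [if_congr this rfl rfl]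
    split_ifs <;> omega
  have hexc : (fun y => if y < lo then 0 else excited s y) =
      rangeIndicator
        (fun a : Fin (p + 1) => if (a : ℕ) < p then lo + (a : ℤ) else lo + p + 1) := by
    funext y
    have : y ∈ Set.range
        (fun a : Fin (p + 1) => if (a : ℕ) < p then lo + (a : ℤ) else lo + p + 1) ↔
        (lo ≤ y ∧ y ≤ s - 1) ∨ y = s + 1 := by
      constructor
      · rintro ⟨a, rfl⟩
        have := a.2
        dsimp only
        split_ifs <;> omega
      · rintro (⟨h1, h2⟩ | h1)
        · exact ⟨⟨(y - lo).toNat, by omega⟩, by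
            dsimp only; rw [if_pos (by omega)]; omega⟩
        · exact ⟨⟨p, by omega⟩, by dsimp only; rw [if_neg (by omega)]; omega⟩
    unfold rangeIndicator excited
    rw [if_congr this rfl rfl]
    split_ifs <;> omega
  have hv : ∀ z, s - 1 ≤ z → ∀ y < lo, vacuum z y = 1 := fun z hz y hy => if_pos (by omega)
  have he : ∀ y < lo, excited s y = 1 := fun y hy => if_pos (by omega)
  rw [amplitude_cut ω hV (hv (s + 1) (by omega)) (hv (s + 1) (by omega)),
    amplitude_cut ω hV (hv (s - 1) (by omega)) (hv (s - 1) (by omega)),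
    amplitude_cut ω hV (hv s (by omega)) (hv s (by omega)), amplitude_cut ω hV he he,
    amplitude_cut ω hV (hv s (by omega)) he, amplitude_cut ω hV he (hv s (by omega)),
    hvac (p + 2) (s + 1) (by push_cast; omega), hvac p (s - 1) (by omega),
    hvac (p + 1) s (by push_cast; omega), hexc, hA _ _ _ (hmono _) (hmono _),
    hA _ _ _ (hmono _) (hmono _), hA _ _ _ (hmono _) (hmono _), hA _ _ _ hmono' hmono',
    hA _ _ _ (hmono _) hmono', hA _ _ _ hmono' (hmono _)]
  exact desnanot_jacobi_consecutive A lo p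

/-- Using $a$ first turns the vacuum into the excited state, and using $b$ last turns it back.
Expanding all factors in $V_{vv},V_{ev},V_{ve},V_{ee}$ leaves
$\omega_a\omega_b(V_{vv}V_{ee}-V_{ve}V_{ev})$, which `amplitude_vacuum_excited` evaluates. -/
theorem amplitude_condensation (ω : ℤ × ℤ → K) {V : Finset (ℤ × ℤ)} {a b s : ℤ}
    (ha : Even (a + s)) (hb : Odd (b + s)) (hab : a ≤ b)
    (haV : (a, s) ∉ V) (hbV : (b, s) ∉ V) (hmin : ∀ t ∈ V, a ≤ t.1) (hmax : ∀ t ∈ V, t.1 ≤ b) :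
    amplitude ω (insert (b, s) (insert (a, s) V)) (vacuum s) (vacuum s) *
        amplitude ω V (vacuum s) (vacuum s) =
      amplitude ω (insert (a, s) V) (vacuum s) (vacuum s) *
          amplitude ω (insert (b, s) V) (vacuum s) (vacuum s) +
        ω (a, s) * ω (b, s) * (amplitude ω V (vacuum (s + 1)) (vacuum (s + 1)) *
          amplitude ω V (vacuum (s - 1)) (vacuum (s - 1))) := by
  have hne : b ≠ a := by rintro rfl; exact (Int.not_even_iff_odd.mpr hb) ha
  have h1 : (fun y => vacuum s y - jump (b, s) y) = excited s := by
    funext y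
    have : ¬ Even (b + s) := Int.not_even_iff_odd.mpr hb
    simp only [jump, siteSign, this, vacuum, excited, if_false]
    split_ifs <;> omega
  have h2 : (fun y => vacuum s y + jump (a, s) y) = excited s := by
    funext y
    simp only [jump, siteSign, ha, vacuum, excited, if_true]
    split_ifs <;> omega
  have hbV' : (b, s) ∉ insert (a, s) V := by simp [hne, hbV]
  have hmax' : ∀ t ∈ insert (a, s) V, t.1 ≤ b := by
    intro t ht
    rcases Finset.mem_insert.mp ht with rfl | ht
    · exact hab
    · exact hmax t ht
  rw [amplitude_insert_last ω hbV' hmax' (vacuum_mem s), h1,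
    amplitude_insert_last ω hbV hmax (vacuum_mem s), h1,
    amplitude_insert_first ω haV hmin (vacuum_mem s), h2,
    amplitude_insert_first ω haV hmin (vacuum_mem s), h2, amplitude_vacuum_excited]
  ring

end Condensation

/-! ### Flux between neighbouring rows -/

section Flux

/-- The net number of upward jumps between the rows `b` and `b + 1` in the columns up to `x`. -/
def flux (T : Finset (ℤ × ℤ)) (b x : ℤ) : ℤ := ∑ t ∈ T with t.2 = b ∧ t.1 ≤ x, siteSign t

theorem sum_jump_eq_flux (T : Finset (ℤ × ℤ)) (x y : ℤ) :
    ∑ t ∈ T with t.1 ≤ x, jump t y = flux T (y - 1) x - flux T y x := by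
  unfold flux
  simp only [Finset.sum_filter, ← Finset.sum_sub_distrib]
  refine Finset.sum_congr rfl fun t _ => ?_
  unfold jump
  split_ifs <;> omega

theorem flux_sub_one_of_mem {T : Finset (ℤ × ℤ)} {t : ℤ × ℤ} (ht : t ∈ T) :
    flux T t.2 t.1 = flux T t.2 (t.1 - 1) + siteSign t := by
  unfold flux
  have : Finset.filter (fun s : ℤ × ℤ => s.2 = t.2 ∧ s.1 ≤ t.1) T =
      insert t (Finset.filter (fun s : ℤ × ℤ => s.2 = t.2 ∧ s.1 ≤ t.1 - 1) T) := by
    ext s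
    simp only [Finset.mem_filter, Finset.mem_insert]
    constructor
    · rintro ⟨h1, h2, h3⟩
      by_cases h : s.1 = t.1
      · exact Or.inl (Prod.ext h h2)
      · exact Or.inr ⟨h1, h2, by omega⟩
    · rintro (rfl | ⟨h1, h2, h3⟩)
      · exact ⟨ht, rfl, le_rfl⟩
      · exact ⟨h1, h2, by omega⟩
  rw [this, Finset.sum_insert (by simp), add_comm]

theorem exists_even_of_flux_pos {T : Finset (ℤ × ℤ)} {b x : ℤ} (h : 0 < flux T b x) :
    ∃ t ∈ T, t.2 = b ∧ t.1 ≤ x ∧ Even (t.1 + t.2) := by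
  by_contra hcon
  push Not at hcon
  refine absurd (Finset.sum_nonpos ?_) (not_le.mpr h)
  intro t ht
  rw [Finset.mem_filter] at ht
  have := hcon t ht.1 ht.2.1 ht.2.2
  simp [siteSign, this]

theorem exists_odd_of_flux_pos {T : Finset (ℤ × ℤ)} {b x X : ℤ} (h : 0 < flux T b x)
    (hX : ∀ x', X ≤ x' → flux T b x' = 0) : ∃ t ∈ T, t.2 = b ∧ x < t.1 ∧ Odd (t.1 + t.2) := by
  by_contra hcon
  push Not at hcon
  have h0 : flux T b (max x X) = 0 := hX _ (le_max_right _ _)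
  have : flux T b x ≤ flux T b (max x X) := by
    unfold flux
    refine Finset.sum_le_sum_of_subset_of_nonneg ?_ ?_
    · intro t ht
      simp only [Finset.mem_filter] at ht ⊢
      exact ⟨ht.1, ht.2.1, ht.2.2.trans (le_max_left _ _)⟩
    · intro t ht ht'
      simp only [Finset.mem_filter, not_and] at ht ht'
      have h1 := hcon t ht.1 ht.2.1 (by have := ht' ht.1 ht.2.1; omega)
      have h2 : Even (t.1 + t.2) := by simpa using h1
      simp [siteSign, h2]
  omega

/-- The occupation of the initially empty row $b+1$ is the flux entering from below minus the flux
leaving above, and it is nonnegative. For filled rows the bound $1$ plays this role. -/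
theorem IsHistory.flux_succ_le {T : Finset (ℤ × ℤ)} {s : ℤ}
    (h : IsHistory T (vacuum s) (vacuum s)) {b : ℤ} (hb : s ≤ b) (x : ℤ) :
    flux T (b + 1) x ≤ flux T b x := by
  have := (h.1 x (b + 1)).1
  rw [occupation, sum_jump_eq_flux, vacuum, if_neg (by omega), add_sub_cancel_right] at this
  omega

theorem IsHistory.flux_pred_le {T : Finset (ℤ × ℤ)} {s : ℤ}
    (h : IsHistory T (vacuum s) (vacuum s)) {b : ℤ} (hb : b ≤ s) (x : ℤ) :
    flux T (b - 1) x ≤ flux T b x := by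
  have := (h.1 x b).2
  rw [occupation, sum_jump_eq_flux, vacuum, if_pos hb] at this
  omega

theorem exists_flux_eq_zero (T : Finset (ℤ × ℤ)) :
    ∃ B : ℤ, ∀ b x, B < |b| → flux T b x = 0 := by
  obtain ⟨B, hB⟩ := (T.image fun t => |t.2|).bddAbove
  refine ⟨B, fun b x hb => ?_⟩
  unfold flux
  rw [Finset.filter_false_of_mem, Finset.sum_empty]
  rintro t ht ⟨rfl, -⟩
  have := hB (Finset.mem_coe.mpr (Finset.mem_image_of_mem (fun t : ℤ × ℤ => |t.2|) ht))
  exact absurd this (not_le.mpr hb)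

/-- The flux can only decrease away from row $s$, and it vanishes beyond the finitely many rows with
jumps. -/
theorem IsHistory.flux_nonneg {T : Finset (ℤ × ℤ)} {s : ℤ}
    (h : IsHistory T (vacuum s) (vacuum s)) (b x : ℤ) : 0 ≤ flux T b x := by
  obtain ⟨B, hB⟩ := exists_flux_eq_zero T
  have hup : ∀ k : ℕ, s ≤ b → flux T (b + k) x ≤ flux T b x := by
    intro k hb
    induction k with
    | zero => simp
    | succ k ih =>
      refine le_trans ?_ ih
      have := h.flux_succ_le (b := b + k) (by omega) x
      push_cast
      rwa [← add_assoc]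
  have hdown : ∀ k : ℕ, b ≤ s → flux T (b - k) x ≤ flux T b x := by
    intro k hb
    induction k with
    | zero => simp
    | succ k ih =>
      refine le_trans ?_ ih
      have := h.flux_pred_le (b := b - k) (by omega) x
      push_cast
      rwa [← sub_sub]
  have hlarge : B < |b + ((|b| + |B| + 1).toNat : ℤ)| ∧ B < |b - ((|b| + |B| + 1).toNat : ℤ)| := by
    constructor <;> grind
  rcases le_total s b with hb | hb
  · have := hup (|b| + |B| + 1).toNat hb
    rwa [hB _ x hlarge.1] at this
  · have := hdown (|b| + |B| + 1).toNat hb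
    rwa [hB _ x hlarge.2] at this

/-- Since the final state equals the initial one, the total flux is the same through all rows, and
it is zero far away. -/
theorem IsHistory.exists_flux_eq_zero {T : Finset (ℤ × ℤ)} {s : ℤ}
    (h : IsHistory T (vacuum s) (vacuum s)) : ∃ X : ℤ, ∀ b x, X ≤ x → flux T b x = 0 := by
  obtain ⟨X, hX⟩ := exists_forall_le T
  refine ⟨X, fun b x hx => ?_⟩
  obtain ⟨B, hB⟩ := GaleRobinson.exists_flux_eq_zero T
  have hstep : ∀ y, flux T (y - 1) x = flux T y x := by
    intro y
    have h1 := h.2 y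
    have h2 := sum_jump_eq_flux T x y
    rw [Finset.filter_true_of_mem fun t ht => (hX t ht).trans hx] at h2
    omega
  have hall : ∀ k : ℕ, flux T (b + k) x = flux T b x := by
    intro k
    induction k with
    | zero => simp
    | succ k ih =>
      rw [← ih, ← hstep (b + (k + 1 : ℕ))]
      congr 1
      push_cast
      ring
  rw [← hall (|b| + |B| + 1).toNat]
  exact hB _ x (by grind)

theorem IsHistory.exists_odd_after {T : Finset (ℤ × ℤ)} {s : ℤ}
    (h : IsHistory T (vacuum s) (vacuum s)) {t : ℤ × ℤ} (ht : t ∈ T) (he : Even (t.1 + t.2)) :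
    ∃ t' ∈ T, t'.2 = t.2 ∧ t.1 < t'.1 ∧ Odd (t'.1 + t'.2) := by
  obtain ⟨X, hX⟩ := h.exists_flux_eq_zero
  have h1 := flux_sub_one_of_mem ht
  have h2 := h.flux_nonneg t.2 (t.1 - 1)
  rw [siteSign, if_pos he] at h1
  exact exists_odd_of_flux_pos (by omega) (hX t.2)

theorem IsHistory.exists_even_before {T : Finset (ℤ × ℤ)} {s : ℤ}
    (h : IsHistory T (vacuum s) (vacuum s)) {t : ℤ × ℤ} (ht : t ∈ T) (ho : Odd (t.1 + t.2)) :
    ∃ t' ∈ T, t'.2 = t.2 ∧ t'.1 < t.1 ∧ Even (t'.1 + t'.2) := by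
  have h1 := flux_sub_one_of_mem ht
  have h2 := h.flux_nonneg t.2 t.1
  rw [siteSign, if_neg (Int.not_even_iff_odd.mpr ho)] at h1
  obtain ⟨t', h3, h4, h5, h6⟩ := exists_even_of_flux_pos (T := T) (b := t.2) (x := t.1 - 1)
    (by omega)
  exact ⟨t', h3, h4, by omega, h6⟩

/-- A jump away from the row `s` is only possible after a jump one row closer to `s`, and has to be
followed by a reverse jump there. -/
theorem IsHistory.exists_adjacent {T : Finset (ℤ × ℤ)} {s : ℤ}
    (h : IsHistory T (vacuum s) (vacuum s)) {t : ℤ × ℤ} (ht : t ∈ T) {b : ℤ}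
    (hb : (s < t.2 ∧ b = t.2 - 1) ∨ (t.2 < s ∧ b = t.2 + 1)) :
    (∃ t' ∈ T, t'.2 = b ∧ t'.1 < t.1 ∧ Even (t'.1 + t'.2)) ∧
      ∃ t' ∈ T, t'.2 = b ∧ t.1 < t'.1 ∧ Odd (t'.1 + t'.2) := by
  obtain ⟨X, hX⟩ := h.exists_flux_eq_zero
  have hle : ∀ x, flux T t.2 x ≤ flux T b x := by
    intro x
    rcases hb with ⟨h1, rfl⟩ | ⟨h1, rfl⟩
    · simpa using h.flux_succ_le (b := t.2 - 1) (by omega) x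
    · simpa using h.flux_pred_le (b := t.2 + 1) (by omega) x
  have h1 := flux_sub_one_of_mem ht
  have h2 := h.flux_nonneg t.2 (t.1 - 1)
  have h3 := h.flux_nonneg t.2 t.1
  by_cases he : Even (t.1 + t.2)
  · rw [siteSign, if_pos he] at h1
    have hpos : 0 < flux T b t.1 := by have := hle t.1; omega
    obtain ⟨t', h4, h5, h6, h7⟩ := exists_even_of_flux_pos hpos
    -- Even sites of neighbouring rows lie in columns of opposite parity, so the inequality is
    -- strict.
    refine ⟨⟨t', h4, h5, lt_of_le_of_ne h6 ?_, h7⟩, exists_odd_of_flux_pos hpos (hX b)⟩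
    rintro h8
    grind
  · rw [siteSign, if_neg he] at h1
    have hpos : 0 < flux T b (t.1 - 1) := by have := hle (t.1 - 1); omega
    obtain ⟨t', h4, h5, h6, h7⟩ := exists_even_of_flux_pos hpos
    obtain ⟨t'', h8, h9, h10, h11⟩ := exists_odd_of_flux_pos hpos (hX b)
    refine ⟨⟨t', h4, h5, by omega, h7⟩, t'', h8, h9, lt_of_le_of_ne (by omega) ?_, h11⟩
    intro h12
    grind

end Flux

/-! ### Confinement to cones -/

section Pattern

/-- The abscissas `U b c` of the odd vertical edges of a doubly infinite pattern: those of two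
consecutive rows `b` and `b + 1` are interlaced. -/
structure IsPattern (U : ℤ → ℤ → ℤ) : Prop where
  odd : ∀ b c, Odd (U b c + b)
  succ_lt : ∀ b c, U (b + 1) c < U b c
  lt_succ : ∀ b c, U b (c + 1) < U (b + 1) c

variable {U : ℤ → ℤ → ℤ}

theorem IsPattern.strictAnti (hU : IsPattern U) (b : ℤ) : StrictAnti (U b) :=
  strictAnti_int_of_succ_lt fun c => (hU.lt_succ b c).trans (hU.succ_lt b c)

/-- Even lattice points, and the odd ones that belong to the pattern `U`. -/
def IsPatternSite (U : ℤ → ℤ → ℤ) (t : ℤ × ℤ) : Prop := Even (t.1 + t.2) ∨ ∃ c, t.1 = U t.2 c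

/-- The sites in the cone with apex `(x, s)` that extends to the right up to the `c`-th odd vertical
edge of row `s`. -/
def cone (U : ℤ → ℤ → ℤ) (s x c : ℤ) : Set (ℤ × ℤ) :=
  {t | x + |t.2 - s| ≤ t.1 ∧ t.1 ≤ U t.2 (c + max 0 (s - t.2)) ∧ IsPatternSite U t}

/-- Induction on the distance from row $s$: `exists_adjacent` pushes even jumps at least one column
further right, and odd jumps strictly to the left of an admissible odd edge one row closer to $s$.
By interlacing the bounding index stays $c$ going up and grows by one per row going down, whence
`max 0 (s - t.2)`. -/
theorem IsHistory.subset_cone (hU : IsPattern U) {T : Finset (ℤ × ℤ)} {s x c : ℤ}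
    (h : IsHistory T (vacuum s) (vacuum s)) (hT : ∀ t ∈ T, IsPatternSite U t)
    (hl : ∀ t ∈ T, t.2 = s → Even (t.1 + t.2) → x ≤ t.1)
    (hr : ∀ t ∈ T, t.2 = s → Odd (t.1 + t.2) → t.1 ≤ U s c) : (T : Set (ℤ × ℤ)) ⊆ cone U s x c := by
  have key : ∀ k : ℕ, ∀ t ∈ T, |t.2 - s| = k → (Even (t.1 + t.2) → x + k ≤ t.1) ∧
      (Odd (t.1 + t.2) → t.1 ≤ U t.2 (c + max 0 (s - t.2))) := by
    intro k
    induction k with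
    | zero =>
      intro t ht hk
      have hts : t.2 = s := by grind
      refine ⟨fun he => by simpa using hl t ht hts he, fun ho => ?_⟩
      have := hr t ht hts ho
      rw [hts]
      simpa using this
    | succ k ih =>
      intro t ht hk
      obtain ⟨b, hb⟩ : ∃ b, (s < t.2 ∧ b = t.2 - 1) ∨ (t.2 < s ∧ b = t.2 + 1) := by
        rcases lt_or_ge s t.2 with h1 | h1
        · exact ⟨_, Or.inl ⟨h1, rfl⟩⟩
        · exact ⟨_, Or.inr ⟨by grind, rfl⟩⟩
      have hbk : |b - s| = k := by push_cast at hk; grind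
      obtain ⟨⟨t', h1, h2, h3, h4⟩, t'', h5, h6, h7, h8⟩ := h.exists_adjacent ht hb
      refine ⟨fun he => ?_, fun ho => ?_⟩
      · have := (ih t' h1 (by rw [h2, hbk])).1 h4
        push_cast
        omega
      · have h9 := (ih t'' h5 (by rw [h6, hbk])).2 h8
        obtain ⟨d, hd⟩ := (hT t ht).resolve_left (Int.not_even_iff_odd.mpr ho)
        rw [h6] at h9
        have h10 : U t.2 d < U t.2 (c + max 0 (s - t.2) - 1) := by
          rcases hb with ⟨hs, rfl⟩ | ⟨hs, rfl⟩
          · rw [max_eq_left (by omega)] at h9 ⊢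
            have h11 := hU.lt_succ (t.2 - 1) (c + 0 - 1)
            simp only [sub_add_cancel] at h11
            omega
          · rw [max_eq_right (by omega)] at h9 ⊢
            have h11 := hU.succ_lt t.2 (c + (s - t.2) - 1)
            rw [show c + (s - (t.2 + 1)) = c + (s - t.2) - 1 by ring] at h9
            omega
        have h12 := (hU.strictAnti t.2).lt_iff_gt.mp h10
        rw [hd]
        exact (hU.strictAnti t.2).antitone (by omega)
  intro t ht
  have hk : |t.2 - s| = (t.2 - s).natAbs := Int.abs_eq_natAbs _
  refine ⟨?_, ?_, hT t ht⟩
  -- The left bound passes from even jumps to odd ones, since an odd jump has an even one before it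
  -- in its row; the right bound passes the other way.
  · by_cases he : Even (t.1 + t.2)
    · rw [hk]; exact (key _ t ht hk).1 he
    · obtain ⟨t', h1, h2, h3, h4⟩ := h.exists_even_before ht (Int.not_even_iff_odd.mp he)
      have := (key _ t' h1 (by rw [h2]; exact hk)).1 h4
      omega
  · by_cases he : Even (t.1 + t.2)
    · obtain ⟨t', h1, h2, h3, h4⟩ := h.exists_odd_after ht he
      have := (key _ t' h1 (by rw [h2]; exact hk)).2 h4
      rw [h2] at this
      omega
    · exact (key _ t ht hk).2 (Int.not_even_iff_odd.mp he)

end Pattern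

/-! ### Condensation for cones and translation -/

section ConeAmplitude

variable {U : ℤ → ℤ → ℤ}

/-- Interlacing costs at least one column for each row away from $s$; this makes cones finite. -/
theorem IsPattern.add_abs_le (hU : IsPattern U) (s c b : ℤ) :
    U b (c + max 0 (s - b)) + |b - s| ≤ U s c := by
  have hup : ∀ k : ℕ, U (s + k) c + k ≤ U s c := by
    intro k
    induction k with
    | zero => simp
    | succ k ih =>
      have := hU.succ_lt (s + k) c
      push_cast
      rw [show s + ((k : ℤ) + 1) = s + k + 1 by ring]
      omega
  have hdown : ∀ k : ℕ, U (s - k) (c + k) + k ≤ U s c := by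
    intro k
    induction k with
    | zero => simp
    | succ k ih =>
      have := hU.lt_succ (s - k - 1) (c + k)
      rw [sub_add_cancel] at this
      push_cast
      rw [show s - ((k : ℤ) + 1) = s - k - 1 by ring, show c + ((k : ℤ) + 1) = c + k + 1 by ring]
      omega
  rcases le_total s b with h | h
  · have := hup (b - s).toNat
    rw [Int.toNat_of_nonneg (by omega), add_sub_cancel] at this
    rw [max_eq_left (by omega), abs_of_nonneg (by omega), add_zero]
    omega
  · have := hdown (s - b).toNat
    rw [Int.toNat_of_nonneg (by omega), sub_sub_cancel] at this
    rw [max_eq_right (by omega), abs_of_nonpos (by omega)]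
    omega

theorem IsPattern.cone_finite (hU : IsPattern U) (s x c : ℤ) : (cone U s x c).Finite := by
  refine Set.Finite.subset (Set.finite_Icc (x, s - (|U s c| + |x|)) (U s c, s + (|U s c| + |x|))) ?_
  rintro t ⟨h1, h2, -⟩
  have := hU.add_abs_le s c t.2
  simp only [Set.mem_Icc, Prod.le_def]
  grind

theorem IsPattern.cone_subset (hU : IsPattern U) {s x c : ℤ} (hx : |s| ≤ x) (hc : 0 ≤ c)
    (hcs : 0 ≤ c + s) : cone U s x c ⊆ cone U 0 0 0 := by
  rintro t ⟨h1, h2, h3⟩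
  refine ⟨?_, h2.trans ((hU.strictAnti t.2).antitone (by omega)), h3⟩
  have := abs_sub_abs_le_abs_sub t.2 s
  rw [zero_add, sub_zero]
  omega

variable {K : Type*} [Field K]

open Classical in
/-- The amplitude from the vacuum to the vacuum for the jumps in a cone of a pattern. -/
noncomputable def coneAmplitude (ω : ℤ × ℤ → K) (U : ℤ → ℤ → ℤ) (s x c : ℤ) : K :=
  if h : (cone U s x c).Finite then amplitude ω h.toFinset (vacuum s) (vacuum s) else 0

/-- By confinement, sites of `V` outside the cone are never used. Only the extreme sites of row $s$
matter, so different sets `V` give the same amplitude. -/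
theorem amplitude_eq_coneAmplitude (hU : IsPattern U) (ω : ℤ × ℤ → K) {V : Finset (ℤ × ℤ)}
    {s x c : ℤ} (hV : ∀ t ∈ V, IsPatternSite U t) (hsub : cone U s x c ⊆ V)
    (hl : ∀ t ∈ V, t.2 = s → Even (t.1 + t.2) → x ≤ t.1)
    (hr : ∀ t ∈ V, t.2 = s → Odd (t.1 + t.2) → t.1 ≤ U s c) :
    amplitude ω V (vacuum s) (vacuum s) = coneAmplitude ω U s x c := by
  classical
  rw [coneAmplitude, dif_pos (hU.cone_finite s x c)]
  unfold amplitude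
  refine Finset.sum_congr ?_ fun _ _ => rfl
  ext T
  simp only [Finset.mem_filter, Finset.mem_powerset, Set.Finite.subset_toFinset]
  refine and_congr_left fun h => ⟨fun hT => ?_, fun hT => ?_⟩
  · exact h.subset_cone hU (fun t ht => hV t (hT ht)) (fun t ht => hl t (hT ht))
      (fun t ht => hr t (hT ht))
  · exact Finset.coe_subset.mp (hT.trans hsub)

/-- Take for `V` the large cone without its apex $(0,0)$ and its tip $(U_{0,0},0)$. Removing the
apex moves the first even site of row $0$ to column $2$, and removing the tip moves the last odd
site to $U_{0,1}$. For the vacua $\pm1$ neither removed site is reachable, and the cones start in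
column $1$. -/
theorem coneAmplitude_condensation (hU : IsPattern U) (hpos : 0 < U 0 0) (ω : ℤ × ℤ → K) :
    coneAmplitude ω U 0 0 0 * coneAmplitude ω U 0 2 1 =
      coneAmplitude ω U 0 0 1 * coneAmplitude ω U 0 2 0 +
        ω (0, 0) * ω (U 0 0, 0) * (coneAmplitude ω U 1 1 0 * coneAmplitude ω U (-1) 1 1) := by
  classical
  set e := U 0 0 with he
  have hodd : Odd (e + 0) := hU.odd 0 0
  set E := (hU.cone_finite 0 0 0).toFinset with hE
  have hmemE : ∀ t, t ∈ E ↔ t ∈ cone U 0 0 0 := fun t => by rw [hE, Set.Finite.mem_toFinset]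
  set V := (E.erase (0, 0)).erase (e, 0) with hVdef
  have hXE : (0, 0) ∈ E := by
    rw [hmemE]
    refine ⟨by simp, ?_, Or.inl (by simp)⟩
    simpa [← he] using hpos.le
  have hYE : (e, 0) ∈ E := by
    rw [hmemE]
    refine ⟨by simpa using hpos.le, by simp [he], Or.inr ⟨0, rfl⟩⟩
  have hne : ((e, 0) : ℤ × ℤ) ≠ (0, 0) := by simp [hpos.ne']
  have hmemV : ∀ t, t ∈ V ↔ t ≠ (e, 0) ∧ t ≠ (0, 0) ∧ t ∈ cone U 0 0 0 := fun t => by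
    rw [hVdef, Finset.mem_erase, Finset.mem_erase, hmemE]
  have hYV : insert (e, 0) V = E.erase (0, 0) := by
    rw [hVdef, Finset.insert_erase (Finset.mem_erase.mpr ⟨hne, hYE⟩)]
  have hXV : insert (0, 0) V = E.erase (e, 0) := by
    rw [hVdef, Finset.erase_right_comm,
      Finset.insert_erase (Finset.mem_erase.mpr ⟨hne.symm, hXE⟩)]
  have hXYV : insert (e, 0) (insert (0, 0) V) = E := by
    rw [hXV, Finset.insert_erase hYE]
  have hcone : ∀ t ∈ cone U 0 0 0, 0 ≤ t.1 ∧ t.1 ≤ e ∧ IsPatternSite U t := by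
    rintro t ⟨h1, h2, h3⟩
    have := hU.add_abs_le 0 0 t.2
    refine ⟨?_, ?_, h3⟩ <;> grind
  have hX : ∀ t ∈ cone U 0 0 0, t ≠ (0, 0) → t.2 = 0 → Even (t.1 + t.2) → 2 ≤ t.1 := by
    intro t ht h1 h2 h3
    have := (hcone t ht).1
    rw [h2, add_zero] at h3
    have : t.1 ≠ 0 := fun h => h1 (Prod.ext h h2)
    grind
  have hY : ∀ t ∈ cone U 0 0 0, t ≠ (e, 0) → t.2 = 0 → Odd (t.1 + t.2) → t.1 ≤ U 0 1 := by
    intro t ht h1 h2 h3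
    obtain ⟨c, hc⟩ := (hcone t ht).2.2.resolve_left (Int.not_even_iff_odd.mpr h3)
    rw [h2] at hc
    have h4 := (hcone t ht).2.1
    have h5 : U 0 c ≠ U 0 0 := fun h => h1 (Prod.ext (hc.trans h) h2)
    have h6 : U 0 c < U 0 0 := lt_of_le_of_ne (hc ▸ h4) h5
    have h7 := (hU.strictAnti 0).lt_iff_gt.mp h6
    rw [hc]
    exact (hU.strictAnti 0).antitone (by omega)
  have hY' : ∀ t ∈ cone U 0 0 0, t.2 = 0 → Odd (t.1 + t.2) → t.1 ≤ U 0 0 :=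
    fun t ht _ _ => (hcone t ht).2.1
  have hsub : ∀ x c, 0 ≤ x → 0 ≤ c → cone U 0 x c ⊆ cone U 0 0 0 :=
    fun x c hx hc => hU.cone_subset (by simpa using hx) hc (by simpa using hc)
  have hx2 : ∀ c, ∀ t ∈ cone U 0 2 c, t ≠ (0, 0) := by
    rintro c t ⟨h1, -⟩ rfl
    simp at h1
  have hU01 : U 0 1 < e := hU.strictAnti 0 (by norm_num)
  have hc1 : ∀ x, ∀ t ∈ cone U 0 x 1, t ≠ (e, 0) := by
    rintro x t ⟨-, h1, -⟩ rfl
    simp at h1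
    omega
  have hmain := amplitude_condensation ω (V := V) (a := 0) (b := e) (s := 0) (by simp) hodd hpos.le
    (by simp [hmemV]) (by simp [hmemV]) (fun t ht => (hcone t ((hmemV t).mp ht).2.2).1)
    (fun t ht => (hcone t ((hmemV t).mp ht).2.2).2.1)
  rw [hXYV, hYV, hXV] at hmain
  have e1 : amplitude ω E (vacuum 0) (vacuum 0) = coneAmplitude ω U 0 0 0 :=
    amplitude_eq_coneAmplitude hU ω (fun t ht => (hcone t ((hmemE t).mp ht)).2.2)
      (fun t ht => (hmemE t).mpr ht) (fun t ht _ _ => (hcone t ((hmemE t).mp ht)).1)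
      (fun t ht => hY' t ((hmemE t).mp ht))
  have e2 : amplitude ω V (vacuum 0) (vacuum 0) = coneAmplitude ω U 0 2 1 :=
    amplitude_eq_coneAmplitude hU ω (fun t ht => (hcone t ((hmemV t).mp ht).2.2).2.2)
      (fun t ht => (hmemV t).mpr ⟨hc1 2 t ht, hx2 1 t ht, hsub 2 1 (by simp) (by simp) ht⟩)
      (fun t ht => hX t ((hmemV t).mp ht).2.2 ((hmemV t).mp ht).2.1)
      (fun t ht => hY t ((hmemV t).mp ht).2.2 ((hmemV t).mp ht).1)
  have e3 : amplitude ω (E.erase (e, 0)) (vacuum 0) (vacuum 0) = coneAmplitude ω U 0 0 1 := by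
    have hm : ∀ t, t ∈ E.erase (e, 0) ↔ t ≠ (e, 0) ∧ t ∈ cone U 0 0 0 := fun t => by
      rw [Finset.mem_erase, hmemE]
    exact amplitude_eq_coneAmplitude hU ω (fun t ht => (hcone t ((hm t).mp ht).2).2.2)
      (fun t ht => (hm t).mpr ⟨hc1 0 t ht, hsub 0 1 (by simp) (by simp) ht⟩)
      (fun t ht _ _ => (hcone t ((hm t).mp ht).2).1)
      (fun t ht => hY t ((hm t).mp ht).2 ((hm t).mp ht).1)
  have e4 : amplitude ω (E.erase (0, 0)) (vacuum 0) (vacuum 0) = coneAmplitude ω U 0 2 0 := by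
    have hm : ∀ t, t ∈ E.erase (0, 0) ↔ t ≠ (0, 0) ∧ t ∈ cone U 0 0 0 := fun t => by
      rw [Finset.mem_erase, hmemE]
    exact amplitude_eq_coneAmplitude hU ω (fun t ht => (hcone t ((hm t).mp ht).2).2.2)
      (fun t ht => (hm t).mpr ⟨hx2 0 t ht, hsub 2 0 (by simp) (by simp) ht⟩)
      (fun t ht => hX t ((hm t).mp ht).2 ((hm t).mp ht).1)
      (fun t ht => hY' t ((hm t).mp ht).2)
  have hV0 : ∀ t ∈ V, t ∈ cone U 0 0 0 := fun t ht => ((hmemV t).mp ht).2.2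
  have e5 : amplitude ω V (vacuum 1) (vacuum 1) = coneAmplitude ω U 1 1 0 := by
    refine amplitude_eq_coneAmplitude hU ω (fun t ht => (hcone t (hV0 t ht)).2.2) ?_ ?_ ?_
    · intro t ht
      refine (hmemV t).mpr ⟨?_, ?_, hU.cone_subset (by simp) (by simp) (by simp) ht⟩
      · rintro rfl
        have h2 := ht.2.1
        norm_num at h2
        omega
      · rintro rfl
        have h1 := ht.1
        norm_num at h1
    · intro t ht h1 h2
      have := (hV0 t ht).1
      rw [h1] at this
      simpa using this
    · intro t ht h1 h2
      have := (hV0 t ht).2.1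
      rw [h1] at this
      simpa using this
  have e6 : amplitude ω V (vacuum (-1)) (vacuum (-1)) = coneAmplitude ω U (-1) 1 1 := by
    refine amplitude_eq_coneAmplitude hU ω (fun t ht => (hcone t (hV0 t ht)).2.2) ?_ ?_ ?_
    · intro t ht
      refine (hmemV t).mpr ⟨?_, ?_, hU.cone_subset (by simp) (by simp) (by simp) ht⟩
      · rintro rfl
        have h2 := ht.2.1
        norm_num at h2
        omega
      · rintro rfl
        have h1 := ht.1
        norm_num at h1
    · intro t ht h1 h2
      have := (hV0 t ht).1
      rw [h1] at this
      simpa using this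
    · intro t ht h1 h2
      have := (hV0 t ht).2.1
      rw [h1] at this
      simpa using this
  rw [e1, e2, e3, e4, zero_add, zero_sub, e5, e6] at hmain
  exact hmain

/-- The pattern `U` seen from the apex `(x, s)`, without the first `c` odd edges of each row. -/
def shiftPattern (U : ℤ → ℤ → ℤ) (s x c : ℤ) (b d : ℤ) : ℤ := U (b + s) (d + c) - x

theorem IsPattern.shift (hU : IsPattern U) {s x : ℤ} (hx : Even (x + s)) (c : ℤ) :
    IsPattern (shiftPattern U s x c) where
  odd b d := by
    have := hU.odd (b + s) (d + c)
    unfold shiftPattern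
    grind
  succ_lt b d := by
    have := hU.succ_lt (b + s) (d + c)
    unfold shiftPattern
    rw [show b + 1 + s = b + s + 1 by ring]
    omega
  lt_succ b d := by
    have := hU.lt_succ (b + s) (d + c)
    unfold shiftPattern
    rw [show b + 1 + s = b + s + 1 by ring, show d + 1 + c = d + c + 1 by ring]
    omega

theorem jump_add {x s : ℤ} (hx : Even (x + s)) (t : ℤ × ℤ) (y : ℤ) :
    jump (t + (x, s)) (y + s) = jump t y := by
  have h : Even (t.1 + x + (t.2 + s)) ↔ Even (t.1 + t.2) := by grind
  simp only [jump, siteSign, Prod.fst_add, Prod.snd_add, h]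
  congr 2
  · exact if_congr (by omega) rfl rfl
  · exact if_congr (by omega) rfl rfl

theorem isHistory_map_add {x s : ℤ} (hx : Even (x + s)) (T : Finset (ℤ × ℤ)) (r : ℤ) :
    IsHistory (T.map (addRightEmbedding (x, s))) (vacuum (r + s)) (vacuum (r + s)) ↔
      IsHistory T (vacuum r) (vacuum r) := by
  have hv : ∀ y, vacuum (r + s) (y + s) = vacuum r y := fun y => if_congr (by omega) rfl rfl
  have hocc : ∀ z y, occupation (T.map (addRightEmbedding (x, s))) (vacuum (r + s)) (z + x)
      (y + s) = occupation T (vacuum r) z y := by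
    intro z y
    unfold occupation
    rw [hv, Finset.filter_map, Finset.sum_map]
    simp [jump_add hx]
  unfold IsHistory
  refine and_congr ⟨fun h z y => ?_, fun h z y => ?_⟩ ⟨fun h y => ?_, fun h y => ?_⟩
  · rw [← hocc]; exact h _ _
  · have := h (z - x) (y - s)
    rwa [← hocc, sub_add_cancel, sub_add_cancel] at this
  · have := h (y + s)
    rw [hv, Finset.sum_map] at this
    simpa [jump_add hx] using this
  · have h1 := h (y - s)
    have h2 := hv (y - s)
    rw [sub_add_cancel] at h2
    have h3 := fun t : ℤ × ℤ => jump_add hx t (y - s)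
    simp only [sub_add_cancel] at h3
    rw [h2, Finset.sum_map]
    simpa [h3] using h1

/-- A translation by a vector with even coordinate sum preserves the chessboard colouring, hence the
directions of the jumps. -/
theorem coneAmplitude_shift (hU : IsPattern U) {s x : ℤ} (hx : Even (x + s)) (c : ℤ)
    (ω : ℤ × ℤ → K) :
    coneAmplitude (fun t => ω (t + (x, s))) (shiftPattern U s x c) 0 0 0 =
      coneAmplitude ω U s x c := by
  classical
  have hmem : ∀ t, t + (x, s) ∈ cone U s x c ↔ t ∈ cone (shiftPattern U s x c) 0 0 0 := by
    intro t
    unfold cone IsPatternSite shiftPattern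
    simp only [Set.mem_ofPred_eq, Prod.fst_add, Prod.snd_add]
    refine and_congr ?_ (and_congr ?_ (or_congr ?_ ?_))
    · rw [add_sub_cancel_right, sub_zero]; constructor <;> intro h <;> omega
    · rw [show c + max 0 (s - (t.2 + s)) = 0 + max 0 (0 - t.2) + c by
        rw [show s - (t.2 + s) = 0 - t.2 by ring]; ring]
      constructor <;> intro h <;> omega
    · grind
    · constructor
      · rintro ⟨d, hd⟩
        exact ⟨d - c, by rw [sub_add_cancel]; omega⟩
      · rintro ⟨d, hd⟩
        exact ⟨d + c, by omega⟩
  rw [coneAmplitude, coneAmplitude, dif_pos ((hU.shift hx c).cone_finite 0 0 0),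
    dif_pos (hU.cone_finite s x c)]
  unfold amplitude
  refine Finset.sum_bij' (fun T _ => T.map (addRightEmbedding (x, s)))
    (fun T _ => T.map (addRightEmbedding (-(x, s)))) ?_ ?_ ?_ ?_ ?_
  · intro T hT
    simp only [Finset.mem_filter, Finset.mem_powerset, Set.Finite.subset_toFinset] at hT ⊢
    refine ⟨?_, ?_⟩
    · intro t ht
      simp only [Finset.coe_map, Set.mem_image, Finset.mem_coe, addRightEmbedding_apply] at ht
      obtain ⟨t, ht, rfl⟩ := ht
      exact (hmem t).mpr (hT.1 ht)
    · have := (isHistory_map_add hx T 0).mpr hT.2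
      rwa [zero_add] at this
  · intro T hT
    simp only [Finset.mem_filter, Finset.mem_powerset, Set.Finite.subset_toFinset] at hT ⊢
    refine ⟨?_, ?_⟩
    · intro t ht
      simp only [Finset.coe_map, Set.mem_image, Finset.mem_coe, addRightEmbedding_apply] at ht
      obtain ⟨t, ht, rfl⟩ := ht
      rw [← hmem, neg_add_cancel_right]
      exact hT.1 ht
    · have := (isHistory_map_add (x := -x) (s := -s) (by grind) T s).mpr hT.2
      rwa [add_neg_cancel] at this
  · intro T _
    simp [Finset.map_eq_image, Finset.image_image, Function.comp_def, -Prod.neg_mk]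
  · intro T _
    simp [Finset.map_eq_image, Finset.image_image, Function.comp_def, -Prod.neg_mk]
  · intro T _
    rw [Finset.prod_map]
    rfl

end ConeAmplitude

/-! ### Counting special edges -/

section Weights

variable {U : ℤ → ℤ → ℤ}

/-- Among the odd edges of the pattern `U` to the right of `x` in the rows `y - 1` and `y`, the
closest one lies in row `y - 1`. -/
def ClosestBelow (U : ℤ → ℤ → ℤ) (x y : ℤ) : Prop :=
  ∃ c, x < U (y - 1) c ∧ ∀ d, x < U y d → U (y - 1) c < U y d

open Classical in
/-- `1` if a special horizontal edge with left end `(x, y)` is used when there is a particle in row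
`y` after column `x`, and `0` otherwise. -/
noncomputable def particleExponent (U : ℤ → ℤ → ℤ) (x y : ℤ) : ℤ :=
  if Even (x + y) ∧ ¬ ClosestBelow U x y then 1 else 0

open Classical in
/-- `1` if a special horizontal edge with left end `(x, y)` is used when there is no particle in
row `y` after column `x`, and `0` otherwise. -/
noncomputable def holeExponent (U : ℤ → ℤ → ℤ) (x y : ℤ) : ℤ :=
  if Odd (x + y) ∧ ClosestBelow U x y then 1 else 0

theorem IsPattern.exists_next (hU : IsPattern U) (b x : ℤ) :
    ∃ c, x < U b c ∧ U b (c + 1) ≤ x := by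
  have hanti : Antitone fun c => U b c + c := antitone_int_of_succ_le fun c => by
    have := hU.strictAnti b (lt_add_one c)
    omega
  obtain ⟨c, hc, hmax⟩ := Int.exists_greatest_of_bdd (P := fun c => x < U b c)
    ⟨|U b 0| + |x|, fun c hc => by
      by_contra hcon
      have := hanti (show 0 ≤ c by grind)
      grind⟩
    ⟨-(|U b 0| + |x| + 1), by
      have := hanti (show -(|U b 0| + |x| + 1) ≤ 0 by grind)
      grind⟩
  refine ⟨c, hc, ?_⟩
  by_contra hcon
  have := hmax (c + 1) (by omega)
  omega

/-- By interlacing, $U_{y,c}$ is the only odd edge of row $y$ between $U_{y-1,c+1}$ and $U_{y-1,c}$,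
so everything depends on the side of $x$ on which it lies. -/
theorem IsPattern.closestBelow_iff (hU : IsPattern U) {x y c : ℤ} (h1 : x < U (y - 1) c)
    (h2 : U (y - 1) (c + 1) ≤ x) : ClosestBelow U x y ↔ U y c ≤ x := by
  have h3 : U y c < U (y - 1) c := by simpa using hU.succ_lt (y - 1) c
  constructor
  · rintro ⟨c', h4, h5⟩
    by_contra hcon
    have h6 := (h5 c (by omega)).trans h3
    have h7 := (hU.strictAnti (y - 1)).lt_iff_gt.mp h6
    have := (hU.strictAnti (y - 1)).antitone (show c + 1 ≤ c' by omega)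
    omega
  · intro h4
    refine ⟨c, h1, fun d hd => ?_⟩
    have h5 : d < c := (hU.strictAnti y).lt_iff_gt.mp (by omega)
    have h6 := (hU.strictAnti y).antitone (show d ≤ c - 1 by omega)
    have h7 : U (y - 1) c < U y (c - 1) := by simpa using hU.lt_succ (y - 1) (c - 1)
    omega

/-- The pattern that is obtained from `U` by the reflection `y ↦ 1 - y`. -/
def reflectPattern (U : ℤ → ℤ → ℤ) (b c : ℤ) : ℤ := U (-b) (c + b)

/-- Reversing the rows reverses the interlacing; the index shift $c+b$ in `reflectPattern` restores
it. -/
theorem IsPattern.reflect (hU : IsPattern U) : IsPattern (reflectPattern U) where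
  odd b c := by
    have := hU.odd (-b) (c + b)
    unfold reflectPattern
    grind
  succ_lt b c := by
    have := hU.lt_succ (-b - 1) (c + b)
    rw [sub_add_cancel] at this
    unfold reflectPattern
    rwa [show -(b + 1) = -b - 1 by ring, ← add_assoc]
  lt_succ b c := by
    have := hU.succ_lt (-b - 1) (c + b + 1)
    rw [sub_add_cancel] at this
    unfold reflectPattern
    rwa [show -(b + 1) = -b - 1 by ring, ← add_assoc, add_right_comm]

theorem reflectPattern_shiftPattern (U : ℤ → ℤ → ℤ) (s x c : ℤ) :
    reflectPattern (shiftPattern U s x c) = shiftPattern (reflectPattern U) (-s) x (c + s) := by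
  funext b d
  unfold reflectPattern shiftPattern
  congr 2 <;> ring

/-- The reflection exchanges the two rows that are compared, and parity excludes ties. Thus it
exchanges particles and holes, and the lower half of a pinecone needs no separate count. -/
theorem IsPattern.closestBelow_reflect (hU : IsPattern U) (x y : ℤ) :
    ClosestBelow (reflectPattern U) x y ↔ ¬ ClosestBelow U x (1 - y) := by
  obtain ⟨c, h1, h2⟩ := hU.exists_next (1 - y - 1) x
  rw [hU.closestBelow_iff h1 h2]
  rw [show 1 - y - 1 = -y by ring] at h1 h2
  have h3 : U (1 - y) (c + 1) < U (-y) (c + 1) := by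
    simpa [add_comm, sub_eq_add_neg] using hU.succ_lt (-y) (c + 1)
  have h4 : U (-y) c < U (1 - y) (c - 1) := by
    simpa [add_comm, sub_eq_add_neg] using hU.lt_succ (-y) (c - 1)
  by_cases h : U (1 - y) c ≤ x
  · have h5 : reflectPattern U (y - 1) (c - y) = U (1 - y) (c - 1) := by
      unfold reflectPattern; congr 1 <;> ring
    have h6 : reflectPattern U (y - 1) (c - y + 1) = U (1 - y) c := by
      unfold reflectPattern; congr 1 <;> ring
    have h7 : reflectPattern U y (c - y) = U (-y) c := by
      unfold reflectPattern; congr 1; ring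
    rw [hU.reflect.closestBelow_iff (c := c - y) (by omega) (by omega), h7]
    omega
  · have h5 : reflectPattern U (y - 1) (c - y + 1) = U (1 - y) c := by
      unfold reflectPattern; congr 1 <;> ring
    have h6 : reflectPattern U (y - 1) (c - y + 1 + 1) = U (1 - y) (c + 1) := by
      unfold reflectPattern; congr 1 <;> ring
    have h7 : reflectPattern U y (c - y + 1) = U (-y) (c + 1) := by
      unfold reflectPattern; congr 1; ring
    rw [hU.reflect.closestBelow_iff (c := c - y + 1) (by omega) (by omega), h7]
    omega

theorem IsPattern.holeExponent_reflect (hU : IsPattern U) (x y : ℤ) :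
    holeExponent (reflectPattern U) x y = particleExponent U x (1 - y) := by
  unfold holeExponent particleExponent
  have h : (Odd (x + y) ∧ ClosestBelow (reflectPattern U) x y) ↔
      (Even (x + (1 - y)) ∧ ¬ ClosestBelow U x (1 - y)) :=
    and_congr (by grind) (hU.closestBelow_reflect x y)
  split_ifs with h1 h2 h2
  · rfl
  · exact absurd (h.mp h1) h2
  · exact absurd (h.mpr h2) h1
  · rfl

theorem closestBelow_shift (U : ℤ → ℤ → ℤ) (s x c a b : ℤ) :
    ClosestBelow (shiftPattern U s x c) a b ↔ ClosestBelow U (a + x) (b + s) := by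
  unfold ClosestBelow shiftPattern
  rw [show b - 1 + s = b + s - 1 by ring]
  constructor
  · rintro ⟨d, h1, h2⟩
    refine ⟨d + c, by omega, fun e he => ?_⟩
    have := h2 (e - c) (by rw [sub_add_cancel]; omega)
    rw [sub_add_cancel] at this
    omega
  · rintro ⟨d, h1, h2⟩
    refine ⟨d - c, by rw [sub_add_cancel]; omega, fun e he => ?_⟩
    have := h2 (e + c) (by omega)
    rw [sub_add_cancel]
    omega

theorem holeExponent_shift (U : ℤ → ℤ → ℤ) {s x : ℤ} (hx : Even (x + s)) (c a b : ℤ) :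
    holeExponent (shiftPattern U s x c) a b = holeExponent U (a + x) (b + s) := by
  unfold holeExponent
  rw [closestBelow_shift]
  classical exact if_congr (and_congr (by grind) Iff.rfl) rfl rfl

theorem particleExponent_shift (U : ℤ → ℤ → ℤ) {s x : ℤ} (hx : Even (x + s)) (c a b : ℤ) :
    particleExponent (shiftPattern U s x c) a b = particleExponent U (a + x) (b + s) := by
  unfold particleExponent
  rw [closestBelow_shift]
  classical exact if_congr (and_congr (by grind) Iff.rfl) rfl rfl

/-- The number of special horizontal edges in the upper half of the matching of the pinecone of `U`
that consists of horizontal edges. -/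
noncomputable def upperExponent (U : ℤ → ℤ → ℤ) : ℤ :=
  ∑ᶠ r : ℕ, ∑ x ∈ Finset.Ico (r : ℤ) (U r 0), holeExponent U x (r + 1)

/-- The number of special horizontal edges in the matching of the pinecone of `U` that consists of
horizontal edges. -/
noncomputable def frozenExponent (U : ℤ → ℤ → ℤ) : ℤ :=
  upperExponent U + upperExponent (reflectPattern U)

theorem IsPattern.apply_le (hU : IsPattern U) (r : ℕ) : U r 0 + r ≤ U 0 0 := by
  simpa using hU.add_abs_le 0 0 r

theorem IsPattern.upperExponent_eq (hU : IsPattern U) {R : ℕ} (hR : U 0 0 ≤ R) :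
    upperExponent U =
      ∑ r ∈ Finset.range R, ∑ x ∈ Finset.Ico (r : ℤ) (U r 0), holeExponent U x (r + 1) := by
  refine finsum_eq_sum_of_support_subset _ fun r hr => ?_
  by_contra hcon
  have h1 : R ≤ r := by simpa using hcon
  have h2 := hU.apply_le r
  refine hr ?_
  dsimp only
  rw [Finset.Ico_eq_empty (by omega), Finset.sum_empty]

theorem sum_Ico_shift (f : ℤ → ℤ) (a b x : ℤ) :
    ∑ z ∈ Finset.Ico a (b - x), f (z + x) = ∑ z ∈ Finset.Ico (a + x) b, f z := by
  rw [Finset.sum_Ico_add' f a (b - x) x, sub_add_cancel]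

theorem upperExponent_shift (U : ℤ → ℤ → ℤ) {s x : ℤ} (hx : Even (x + s)) (c : ℤ) :
    upperExponent (shiftPattern U s x c) =
      ∑ᶠ r : ℕ, ∑ z ∈ Finset.Ico (r + x) (U (r + s) c), holeExponent U z (r + s + 1) := by
  unfold upperExponent
  refine finsum_congr fun r => ?_
  rw [← sum_Ico_shift]
  simp only [shiftPattern, zero_add]
  refine Finset.sum_congr rfl fun z _ => ?_
  have := holeExponent_shift U hx c z (r + 1)
  rw [add_right_comm (r : ℤ) 1 s] at this
  exact this

theorem IsPattern.upperExponent_shift_eq (hU : IsPattern U) {s x : ℤ} (hx : Even (x + s)) (c : ℤ)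
    {R : ℕ} (hR : U s c - x ≤ R) :
    upperExponent (shiftPattern U s x c) = ∑ r ∈ Finset.range R,
      ∑ z ∈ Finset.Ico (r + x) (U (r + s) c), holeExponent U z (r + s + 1) := by
  rw [upperExponent_shift U hx]
  refine finsum_eq_sum_of_support_subset _ fun r hr => ?_
  by_contra hcon
  have h1 : R ≤ r := by simpa using hcon
  have h2 := (hU.shift hx c).apply_le r
  simp only [shiftPattern, zero_add] at h2
  refine hr ?_
  dsimp only
  rw [Finset.Ico_eq_empty (by omega), Finset.sum_empty]

theorem holeExponent_of_even {x y : ℤ} (h : Even (x + y)) : holeExponent U x y = 0 :=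
  if_neg fun h' => (Int.not_even_iff_odd.mpr h'.1) h

/-- The mixed difference of the row sums vanishes unless $U_{r,1}\le r<U_{r,0}$; then only the first
edge, at column $r$, survives. It is special exactly when $U_{r+1,0}\le r$, so the defect is a
difference of consecutive indicators. -/
theorem IsPattern.row_exponent (hU : IsPattern U) (r : ℤ) :
    ∑ z ∈ Finset.Ico r (U r 0), holeExponent U z (r + 1) +
        ∑ z ∈ Finset.Ico (r + 2) (U r 1), holeExponent U z (r + 1) =
      ∑ z ∈ Finset.Ico r (U r 1), holeExponent U z (r + 1) +
        ∑ z ∈ Finset.Ico (r + 2) (U r 0), holeExponent U z (r + 1) +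
      ((if r < U r 0 then 1 else 0) - if r + 1 < U (r + 1) 0 then 1 else 0) := by
  have hU0 := hU.odd r 0
  have hU1 := hU.odd r 1
  have hU2 := hU.odd (r + 1) 0
  have h01 : U r 1 < U (r + 1) 0 := hU.lt_succ r 0
  have h10 := hU.succ_lt r 0
  have htwo : ∀ b, r + 1 ≤ b → Odd (b + r) → ∑ z ∈ Finset.Ico r b, holeExponent U z (r + 1) =
      holeExponent U r (r + 1) + ∑ z ∈ Finset.Ico (r + 2) b, holeExponent U z (r + 1) := by
    intro b hb hodd
    have h0 : holeExponent U (r + 1) (r + 1) = 0 := holeExponent_of_even ⟨r + 1, rfl⟩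
    rcases eq_or_lt_of_le hb with rfl | hb'
    · have : Finset.Ico r (r + 1) = {r} := by
        ext z
        simp only [Finset.mem_Ico, Finset.mem_singleton]
        omega
      rw [this, Finset.Ico_eq_empty (by omega)]
      simp
    · have : Finset.Ico r b = insert r (insert (r + 1) (Finset.Ico (r + 2) b)) := by
        ext z
        simp only [Finset.mem_insert, Finset.mem_Ico]
        omega
      rw [this, Finset.sum_insert (by simp), Finset.sum_insert (by simp), h0, zero_add]
  by_cases h1 : r < U r 1
  · rw [htwo _ (by omega) hU0, htwo _ (by omega) hU1, if_pos (by omega), if_pos (by grind)]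
    ring
  · rw [Finset.Ico_eq_empty (show ¬ r + 2 < U r 1 by omega), Finset.Ico_eq_empty h1]
    by_cases h2 : r < U r 0
    · rw [htwo _ (by omega) hU0, if_pos h2]
      have h3 : ClosestBelow U r (r + 1) ↔ U (r + 1) 0 ≤ r :=
        hU.closestBelow_iff (c := 0) (by rwa [add_sub_cancel_right])
          (by rw [add_sub_cancel_right, zero_add]; omega)
      by_cases h4 : r + 1 < U (r + 1) 0
      · rw [if_pos h4, holeExponent, if_neg fun h => by have := h3.mp h.2; omega]
        ring
      · rw [if_neg h4, holeExponent, if_pos ⟨⟨r, by ring⟩, h3.mpr (by grind)⟩]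
        ring
    · rw [Finset.Ico_eq_empty h2, Finset.Ico_eq_empty (by omega), if_neg h2, if_neg (by omega)]
      simp

/-- The defects of `row_exponent` telescope to the indicator of $0<U_{0,0}$. -/
theorem IsPattern.upperExponent_add (hU : IsPattern U) (hpos : 0 < U 0 0) :
    upperExponent U + upperExponent (shiftPattern U 0 2 1) =
      upperExponent (shiftPattern U 0 0 1) + upperExponent (shiftPattern U 0 2 0) + 1 := by
  have h01 := hU.strictAnti 0 (show (0 : ℤ) < 1 by norm_num)
  obtain ⟨R, hR⟩ := Int.eq_ofNat_of_zero_le hpos.le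
  rw [hU.upperExponent_eq hR.le, hU.upperExponent_shift_eq (by decide) 1 (by omega : U 0 1 - 2 ≤ R),
    hU.upperExponent_shift_eq (by decide) 1 (by omega : U 0 1 - 0 ≤ R),
    hU.upperExponent_shift_eq (by decide) 0 (by omega : U 0 0 - 2 ≤ R)]
  rw [← Finset.sum_add_distrib, ← Finset.sum_add_distrib]
  simp only [add_zero]
  have hrow := fun (r : ℕ) (_ : r ∈ Finset.range R) => hU.row_exponent r
  rw [Finset.sum_congr rfl hrow, Finset.sum_add_distrib]
  congr 1
  have := Finset.sum_range_sub' (fun r : ℕ => if (r : ℤ) < U r 0 then (1 : ℤ) else 0) R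
  push_cast at this
  rw [this, if_pos hpos, if_neg]
  · ring
  · have := hU.apply_le R
    omega

/-- The upper half seen from the apex $(1,1)$ is the original upper half without its lowest row. -/
theorem IsPattern.upperExponent_shift_up (hU : IsPattern U) :
    upperExponent (shiftPattern U 1 1 0) + ∑ x ∈ Finset.Ico 0 (U 0 0), holeExponent U x 1 =
      upperExponent U := by
  have h01 := hU.succ_lt 0 0
  rw [zero_add] at h01
  have hR : U 0 0 ≤ ((U 0 0).toNat + 1 : ℕ) := by omega
  rw [hU.upperExponent_eq hR, Finset.sum_range_succ',
    hU.upperExponent_shift_eq (by decide) 0 (by omega : U 1 0 - 1 ≤ (U 0 0).toNat)]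
  simp

/-- Seen from $(1,-1)$, the upper half gains the row of ordinate $0$ below that of the inner
pinecone. -/
theorem IsPattern.upperExponent_shift_down (hU : IsPattern U) :
    upperExponent (shiftPattern U (-1) 1 1) = upperExponent (shiftPattern U 0 2 1) +
      ∑ x ∈ Finset.Ico 0 (U 0 0), holeExponent U x 0 := by
  have h1 : U (-1) 1 < U 0 0 := by simpa using hU.lt_succ (-1) 0
  have h2 : U 0 0 < U (-1) 0 := by simpa using hU.succ_lt (-1) 0
  have h3 := hU.strictAnti 0 (show (0 : ℤ) < 1 by norm_num)
  rw [hU.upperExponent_shift_eq (by decide) 1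
      (by omega : U (-1) 1 - 1 ≤ ((U 0 0).toNat + 1 : ℕ)), Finset.sum_range_succ',
    hU.upperExponent_shift_eq (by decide) 1 (by omega : U 0 1 - 2 ≤ (U 0 0).toNat)]
  congr 1
  · refine Finset.sum_congr rfl fun r _ => ?_
    push_cast
    rw [add_assoc (r : ℤ) 1 1, show (r : ℤ) + 1 + -1 = r + 0 by ring]
    rfl
  · simp only [Nat.cast_zero, zero_add, neg_add_cancel]
    -- The columns added to reach the full range contribute nothing: column $0$ by parity, and
    -- beyond $U_{-1,1}$ the closest odd edge is $U_{0,0}$, in row $0$.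
    refine Finset.sum_subset_zero_on_sdiff ?_ ?_ fun _ _ => rfl
    · intro x hx
      rw [Finset.mem_Ico] at hx ⊢
      omega
    · intro x hx
      simp only [Finset.mem_sdiff, Finset.mem_Ico, not_and, not_lt] at hx
      rcases eq_or_lt_of_le hx.1.1 with rfl | hx0
      · exact holeExponent_of_even (by simp)
      · refine if_neg fun h => ?_
        have := (hU.closestBelow_iff (x := x) (y := 0) (c := 0) (by rw [zero_sub]; omega)
          (by rw [zero_sub, zero_add]; exact hx.2 hx0)).mp h.2
        omega

/-- Each of the two halves contributes one to the constant, which is the source of $u^2$. -/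
theorem IsPattern.frozenExponent_add (hU : IsPattern U) (hpos : 0 < U 0 0) :
    frozenExponent U + frozenExponent (shiftPattern U 0 2 1) =
      2 + (frozenExponent (shiftPattern U 0 0 1) + frozenExponent (shiftPattern U 0 2 0)) := by
  have h1 := hU.upperExponent_add hpos
  have h2 := hU.reflect.upperExponent_add (by simpa [reflectPattern] using hpos)
  simp only [frozenExponent, reflectPattern_shiftPattern, neg_zero, add_zero]
  omega

/-- The change of the number of special horizontal edges, per column, when a hole in row `y` is
replaced by a particle. -/
noncomputable def exponentChange (U : ℤ → ℤ → ℤ) (x y : ℤ) : ℤ :=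
  particleExponent U x y - holeExponent U x y

/-- Moving the vacuum up fills row $1$, and moving it down empties row $0$; the sum is the resulting
change, that is, the $u$-exponent of the apex jump. -/
theorem IsPattern.frozenExponent_add_change (hU : IsPattern U) :
    frozenExponent U + frozenExponent (shiftPattern U 0 2 1) +
        ∑ x ∈ Finset.Ico 0 (U 0 0), (exponentChange U x 1 - exponentChange U x 0) =
      frozenExponent (shiftPattern U 1 1 0) + frozenExponent (shiftPattern U (-1) 1 1) := by
  have h1 := hU.upperExponent_shift_up
  have h2 := hU.reflect.upperExponent_shift_up
  have h3 := hU.upperExponent_shift_down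
  have h4 := hU.reflect.upperExponent_shift_down
  have h5 : reflectPattern U 0 0 = U 0 0 := by simp [reflectPattern]
  simp only [hU.holeExponent_reflect, h5, sub_self, sub_zero] at h2 h4
  simp only [frozenExponent, reflectPattern_shiftPattern, neg_zero, add_zero, neg_neg,
    exponentChange, Finset.sum_sub_distrib]
  norm_num
  omega

/-- The change of the number of special horizontal edges in the columns up to `X` caused by a
jump along the vertical edge with lower end `t`. -/
noncomputable def jumpExponent (U : ℤ → ℤ → ℤ) (X : ℤ) (t : ℤ × ℤ) : ℤ :=
  siteSign t * ∑ x ∈ Finset.Ico t.1 X, (exponentChange U x (t.2 + 1) - exponentChange U x t.2)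

theorem jumpExponent_shift (U : ℤ → ℤ → ℤ) {s x : ℤ} (hx : Even (x + s)) (c X : ℤ) (t : ℤ × ℤ) :
    jumpExponent (shiftPattern U s x c) (X - x) t = jumpExponent U X (t + (x, s)) := by
  have h : Even (t.1 + x + (t.2 + s)) ↔ Even (t.1 + t.2) := by grind
  unfold jumpExponent
  rw [Prod.fst_add, ← sum_Ico_shift]
  simp only [siteSign, Prod.fst_add, Prod.snd_add, h, exponentChange, particleExponent_shift U hx,
    holeExponent_shift U hx, add_right_comm t.2 1 s]

variable {K : Type*} [Field K]

/-- The weight of the jump along the vertical edge with lower end `t`. -/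
noncomputable def jumpWeight (u v : K) (U : ℤ → ℤ → ℤ) (X : ℤ) (t : ℤ × ℤ) : K :=
  v * u ^ jumpExponent U X t

/-- The weighted number of histories of the pinecone of `U`. -/
noncomputable def patternSum (u v : K) (U : ℤ → ℤ → ℤ) (X : ℤ) : K :=
  u ^ frozenExponent U * coneAmplitude (jumpWeight u v U X) U 0 0 0

theorem IsPattern.patternSum_shift (hU : IsPattern U) (u v : K) {s x : ℤ} (hx : Even (x + s))
    (c X : ℤ) : patternSum u v (shiftPattern U s x c) (X - x) =
      u ^ frozenExponent (shiftPattern U s x c) * coneAmplitude (jumpWeight u v U X) U s x c := by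
  rw [patternSum, ← coneAmplitude_shift hU hx]
  congr 2
  funext t
  rw [jumpWeight, jumpWeight, jumpExponent_shift U hx]

/-- The cutoffs of the translated patterns all represent the same column $U_{0,0}$, so the six sums
share one weight function and cone condensation applies; the frozen exponents account for the
prefactors. -/
theorem IsPattern.patternSum_recurrence (hU : IsPattern U) (hpos : 0 < U 0 0) {u : K} (hu : u ≠ 0)
    (v : K) :
    patternSum u v U (U 0 0) * patternSum u v (shiftPattern U 0 2 1) (U 0 0 - 2) =
      u ^ 2 * (patternSum u v (shiftPattern U 0 0 1) (U 0 0 - 0) *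
        patternSum u v (shiftPattern U 0 2 0) (U 0 0 - 2)) +
      v ^ 2 * (patternSum u v (shiftPattern U 1 1 0) (U 0 0 - 1) *
        patternSum u v (shiftPattern U (-1) 1 1) (U 0 0 - 1)) := by
  have h := coneAmplitude_condensation hU hpos (jumpWeight u v U (U 0 0))
  -- The jump at the tip affects no column before the cutoff and has weight just $v$.
  have hω : jumpWeight u v U (U 0 0) (0, 0) * jumpWeight u v U (U 0 0) (U 0 0, 0) =
      v ^ 2 * u ^ ∑ x ∈ Finset.Ico 0 (U 0 0), (exponentChange U x 1 - exponentChange U x 0) := by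
    simp [jumpWeight, jumpExponent, siteSign]
    ring
  rw [hω] at h
  rw [hU.patternSum_shift u v (by decide), hU.patternSum_shift u v (by decide),
    hU.patternSum_shift u v (by decide), hU.patternSum_shift u v (by decide),
    hU.patternSum_shift u v (by decide), patternSum]
  set c1 := coneAmplitude (jumpWeight u v U (U 0 0)) U 0 0 0
  set c2 := coneAmplitude (jumpWeight u v U (U 0 0)) U 0 2 1
  set c3 := coneAmplitude (jumpWeight u v U (U 0 0)) U 0 0 1
  set c4 := coneAmplitude (jumpWeight u v U (U 0 0)) U 0 2 0
  set c5 := coneAmplitude (jumpWeight u v U (U 0 0)) U 1 1 0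
  set c6 := coneAmplitude (jumpWeight u v U (U 0 0)) U (-1) 1 1
  have e1 : u ^ frozenExponent U * u ^ frozenExponent (shiftPattern U 0 2 1) =
      u ^ 2 * (u ^ frozenExponent (shiftPattern U 0 0 1) *
        u ^ frozenExponent (shiftPattern U 0 2 0)) := by
    rw [← zpow_natCast u 2, ← zpow_add₀ hu, ← zpow_add₀ hu, ← zpow_add₀ hu,
      hU.frozenExponent_add hpos]
    norm_num
  have e2 : u ^ frozenExponent U * u ^ frozenExponent (shiftPattern U 0 2 1) *
      u ^ ∑ x ∈ Finset.Ico 0 (U 0 0), (exponentChange U x 1 - exponentChange U x 0) =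
      u ^ frozenExponent (shiftPattern U 1 1 0) *
        u ^ frozenExponent (shiftPattern U (-1) 1 1) := by
    rw [← zpow_add₀ hu, ← zpow_add₀ hu, ← zpow_add₀ hu, hU.frozenExponent_add_change]
  calc _ = u ^ frozenExponent U * u ^ frozenExponent (shiftPattern U 0 2 1) * (c1 * c2) := by ring
    _ = u ^ frozenExponent U * u ^ frozenExponent (shiftPattern U 0 2 1) * (c3 * c4) +
        v ^ 2 * (u ^ frozenExponent U * u ^ frozenExponent (shiftPattern U 0 2 1) *
          u ^ ∑ x ∈ Finset.Ico 0 (U 0 0), (exponentChange U x 1 - exponentChange U x 0)) *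
            (c5 * c6) := by
      rw [h]; ring
    _ = _ := by rw [e2, e1]; ring

end Weights

/-! ### Pinecones of patterns and their black squares -/

section Pinecone

/-- The abscissa of the left end of the horizontal segment of ordinate `y` of a pinecone. -/
def rowStart (y : ℤ) : ℤ := if 1 ≤ y then y - 1 else -y

/-- The abscissa of the right end of the horizontal segment of ordinate `y` of the pinecone of
the pattern `U`. -/
def rowEnd (U : ℤ → ℤ → ℤ) (y : ℤ) : ℤ := if 1 ≤ y then U (y - 1) 0 else U y (-y)

/-- `P` is the pinecone whose odd vertical edges are given by the pattern `U`. -/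
structure IsPinecone (U : ℤ → ℤ → ℤ) (P : squareGrid.Subgraph) : Prop where
  mem_verts : ∀ a, a ∈ P.verts ↔
    rowStart a.2 ≤ a.1 ∧ a.1 ≤ rowEnd U a.2 ∧ rowStart a.2 < rowEnd U a.2
  adj_right : ∀ a : ℤ × ℤ, P.Adj a (a.1 + 1, a.2) ↔ rowStart a.2 ≤ a.1 ∧ a.1 < rowEnd U a.2
  adj_up : ∀ a : ℤ × ℤ, P.Adj a (a.1, a.2 + 1) ↔ a ∈ cone U 0 0 0

variable {U : ℤ → ℤ → ℤ}

theorem rowStart_nonneg (y : ℤ) : 0 ≤ rowStart y := by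
  unfold rowStart; split_ifs <;> omega

theorem IsPattern.odd_row (hU : IsPattern U) (y : ℤ) : Odd (rowEnd U y + rowStart y) := by
  have h1 := hU.odd (y - 1) 0
  have h2 := hU.odd y (-y)
  unfold rowEnd rowStart
  split_ifs <;> grind

theorem IsPattern.rowEnd_add_le (hU : IsPattern U) (y : ℤ) :
    rowEnd U y + rowStart y ≤ U 0 0 := by
  unfold rowEnd rowStart
  split_ifs with h
  · have := hU.add_abs_le 0 0 (y - 1)
    rwa [max_eq_left (by omega), sub_zero, abs_of_nonneg (by omega), add_zero] at this
  · have := hU.add_abs_le 0 0 y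
    rwa [max_eq_right (by omega), sub_zero, abs_of_nonpos (by omega), zero_add, zero_sub] at this

theorem IsPattern.row_of_mem_cone (hU : IsPattern U) {t : ℤ × ℤ} (ht : t ∈ cone U 0 0 0) {y : ℤ}
    (hy : t.2 = y ∨ t.2 = y - 1) : rowStart y ≤ t.1 ∧ t.1 ≤ rowEnd U y := by
  obtain ⟨h1, h2, -⟩ := ht
  rw [zero_add, sub_zero] at h1
  rw [zero_add, zero_sub] at h2
  have h3 := le_abs_self t.2
  have h4 := neg_abs_le t.2
  refine ⟨by unfold rowStart; split_ifs <;> omega, h2.trans ?_⟩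
  unfold rowEnd
  rcases hy with rfl | hy
  · split_ifs with h
    · rw [max_eq_left (by omega)]
      have := hU.succ_lt (t.2 - 1) 0
      rw [sub_add_cancel] at this
      exact this.le
    · rw [max_eq_right (by omega)]
  · rw [hy]
    split_ifs with h
    · rw [max_eq_left (by omega)]
    · rw [max_eq_right (by omega)]
      have := hU.lt_succ (y - 1) (-y)
      rw [sub_add_cancel] at this
      rw [show -(y - 1) = -y + 1 by ring]
      exact this.le

theorem IsPattern.closestAbove_iff (hU : IsPattern U) (x y : ℤ) :
    (∃ c, x < U y c ∧ ∀ d, x < U (y - 1) d → U y c < U (y - 1) d) ↔ ¬ ClosestBelow U x y := by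
  obtain ⟨c, h1, h2⟩ := hU.exists_next (y - 1) x
  rw [hU.closestBelow_iff h1 h2, not_le]
  have h3 : U y c < U (y - 1) c := by simpa using hU.succ_lt (y - 1) c
  have h4 : U (y - 1) c < U y (c - 1) := by simpa using hU.lt_succ (y - 1) (c - 1)
  constructor
  · rintro ⟨c', h5, h6⟩
    by_contra hcon
    have h7 : c' < c := (hU.strictAnti y).lt_iff_gt.mp (by omega)
    have h8 := (hU.strictAnti y).antitone (show c' ≤ c - 1 by omega)
    have := h6 c h1
    omega
  · intro h5
    refine ⟨c, h5, fun d hd => ?_⟩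
    have h6 : d < c + 1 := (hU.strictAnti (y - 1)).lt_iff_gt.mp (by omega)
    have := (hU.strictAnti (y - 1)).antitone (show d ≤ c by omega)
    omega

variable {P : squareGrid.Subgraph}

/-- The lower-left corner is even, so the right side of a black square is an odd edge of the
pattern; conversely the other three sides are then present. -/
theorem IsPinecone.isBlackSquare_iff (hP : IsPinecone U P) (hU : IsPattern U) (a b : ℤ) :
    IsBlackSquare P (a, b) ↔
      |b| ≤ a ∧ a + 1 ≤ U b (max 0 (-b)) ∧ ∃ c, a + 1 = U b c := by
  have hH := fun a b => hP.adj_right (a, b)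
  have hV := fun a b => hP.adj_up (a, b)
  simp only at hH hV
  simp only [IsBlackSquare, hH, hV]
  constructor
  · rintro ⟨h1, -, -, h2, h3⟩
    have h4 := h2.1
    have h5 := h3.2.1
    simp only [zero_add, sub_zero, zero_sub] at h4 h5
    refine ⟨h4, h5, h3.2.2.resolve_left ?_⟩
    simp only
    grind
  · rintro ⟨h1, h2, c, h3⟩
    have heven : Even (a + b) := by
      have := hU.odd b c
      grind
    have h4 : (a, b) ∈ cone U 0 0 0 :=
      ⟨by simpa using h1, by simp only [zero_add, zero_sub]; omega, Or.inl heven⟩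
    have h5 : (a + 1, b) ∈ cone U 0 0 0 :=
      ⟨by simp only [zero_add, sub_zero]; omega, by simpa using h2, Or.inr ⟨c, h3⟩⟩
    have h6 := hU.row_of_mem_cone h4 (y := b) (Or.inl rfl)
    have h7 := hU.row_of_mem_cone h5 (y := b) (Or.inl rfl)
    have h8 := hU.row_of_mem_cone h4 (y := b + 1) (Or.inr (by simp))
    have h9 := hU.row_of_mem_cone h5 (y := b + 1) (Or.inr (by simp))
    exact ⟨heven, ⟨h6.1, by omega⟩, ⟨h8.1, by omega⟩, h4, h5⟩

/-- The pattern has infinitely many odd edges, but those beyond the end of the segment cannot decide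
the comparison: that end is itself an odd edge in one of the two rows. -/
theorem IsPinecone.closestBlackSquareInRow_iff (hP : IsPinecone U P) (hU : IsPattern U)
    {x y s t : ℤ} (hx : rowStart y ≤ x) (hx' : x < rowEnd U y)
    (hst : (s = y - 1 ∧ t = y) ∨ (s = y ∧ t = y - 1)) :
    ClosestBlackSquareInRow P x s t ↔ ∃ c, x < U s c ∧ ∀ d, x < U t d → U s c < U t d := by
  have hblack : ∀ b d, (b = y ∨ b = y - 1) → x < U b d → U b d ≤ rowEnd U y →
      IsBlackSquare P (U b d - 1, b) := by
    intro b d hb h1 h2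
    rw [hP.isBlackSquare_iff hU, sub_add_cancel]
    refine ⟨?_, ?_, d, rfl⟩
    · have := hU.odd b d
      unfold rowStart at hx
      split_ifs at hx <;> grind
    · refine (hU.strictAnti b).antitone ?_
      unfold rowEnd at h2
      split_ifs at h2 with h
      · rw [max_eq_left (by omega)]
        rcases hb with rfl | rfl
        · have h3 : U (b - 1) 0 < U b (-1) := by simpa using hU.lt_succ (b - 1) (-1)
          have := (hU.strictAnti b).lt_iff_gt.mp (h2.trans_lt h3)
          omega
        · exact (hU.strictAnti _).le_iff_ge.mp h2
      · rw [max_eq_right (by omega)]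
        rcases hb with rfl | rfl
        · exact (hU.strictAnti _).le_iff_ge.mp h2
        · have h3 : U y (-y) < U (y - 1) (-y) := by simpa using hU.succ_lt (y - 1) (-y)
          have := (hU.strictAnti _).lt_iff_gt.mp (h2.trans_lt h3)
          omega
  have hof : ∀ b c, (b = y ∨ b = y - 1) → IsBlackSquare P (c, b) →
      (∃ d, c + 1 = U b d) ∧ c + 1 ≤ rowEnd U y := by
    intro b c hb h
    refine ⟨((hP.isBlackSquare_iff hU c b).mp h).2.2, ?_⟩
    have := (hP.adj_up (c + 1, b)).mp h.2.2.2.2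
    exact (hU.row_of_mem_cone this hb).2
  have hs : s = y ∨ s = y - 1 := by omega
  have ht : t = y ∨ t = y - 1 := by omega
  constructor
  · rintro ⟨c, h1, h2, h3⟩
    obtain ⟨⟨e, he⟩, h4⟩ := hof s c hs h2
    refine ⟨e, by omega, fun d hd => ?_⟩
    by_cases h5 : U t d ≤ rowEnd U y
    · have := h3 (U t d - 1) (by omega) (hblack t d ht hd h5)
      omega
    · omega
  · rintro ⟨e, h1, h2⟩
    obtain ⟨e', h3, h4, h5⟩ : ∃ e', x < U s e' ∧ U s e' ≤ rowEnd U y ∧ U s e' ≤ U s e := by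
      by_cases h6 : U s e ≤ rowEnd U y
      · exact ⟨e, h1, h6, le_rfl⟩
      · obtain ⟨b, d, hb, hbd⟩ : ∃ b d, (b = y ∨ b = y - 1) ∧ rowEnd U y = U b d := by
          unfold rowEnd
          split_ifs
          · exact ⟨y - 1, 0, Or.inr rfl, rfl⟩
          · exact ⟨y, -y, Or.inl rfl, rfl⟩
        have hbst : b = s ∨ b = t := by omega
        rcases hbst with rfl | rfl
        · exact ⟨d, by omega, by omega, by omega⟩
        · have := h2 d (by omega)
          omega
    refine ⟨U s e' - 1, by omega, hblack s e' hs h3 h4, fun c hc hc' => ?_⟩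
    obtain ⟨⟨d, hd⟩, -⟩ := hof t c ht hc'
    have := h2 d (by omega)
    omega

theorem IsPinecone.isOrdinary_iff (hP : IsPinecone U P) (hU : IsPattern U) {a : ℤ × ℤ}
    (ha : rowStart a.2 ≤ a.1 ∧ a.1 < rowEnd U a.2) :
    IsOrdinary P a ↔ (Even (a.1 + a.2) ∧ ClosestBelow U a.1 a.2) ∨
      (Odd (a.1 + a.2) ∧ ¬ ClosestBelow U a.1 a.2) := by
  rw [IsOrdinary, hP.closestBlackSquareInRow_iff hU ha.1 ha.2 (Or.inl ⟨rfl, rfl⟩),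
    hP.closestBlackSquareInRow_iff hU ha.1 ha.2 (Or.inr ⟨rfl, rfl⟩), hU.closestAbove_iff]
  rfl

end Pinecone

/-! ### Local form of the matching condition -/

section Matching

theorem subgraph_adj_iff (M : squareGrid.Subgraph) (a w : ℤ × ℤ) :
    M.Adj a w ↔ (w = (a.1 + 1, a.2) ∧ M.Adj a (a.1 + 1, a.2)) ∨
      (w = (a.1 - 1, a.2) ∧ M.Adj (a.1 - 1, a.2) a) ∨
      (w = (a.1, a.2 + 1) ∧ M.Adj a (a.1, a.2 + 1)) ∨
      (w = (a.1, a.2 - 1) ∧ M.Adj (a.1, a.2 - 1) a) := by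
  constructor
  · intro h
    obtain ⟨w1, w2⟩ := w
    rcases M.adj_sub h with ⟨h1, h2 | h2⟩ | ⟨h1, h2 | h2⟩ <;> simp only at h1 h2
    · subst h1 h2
      exact Or.inl ⟨rfl, h⟩
    · have : w1 = a.1 - 1 := by omega
      subst h1 this
      exact Or.inr (Or.inl ⟨rfl, h.symm⟩)
    · subst h1 h2
      exact Or.inr (Or.inr (Or.inl ⟨rfl, h⟩))
    · have : w2 = a.2 - 1 := by omega
      subst h1 this
      exact Or.inr (Or.inr (Or.inr ⟨rfl, h.symm⟩))
  · rintro (⟨rfl, h⟩ | ⟨rfl, h⟩ | ⟨rfl, h⟩ | ⟨rfl, h⟩)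
    exacts [h, h.symm, h, h.symm]

open Classical in
theorem existsUnique_of_four {α : Type*} {r l u d : α} (h1 : r ≠ l) (h2 : r ≠ u) (h3 : r ≠ d)
    (h4 : l ≠ u) (h5 : l ≠ d) (h6 : u ≠ d) (A B C D : Prop) :
    (∃! w, (w = r ∧ A) ∨ (w = l ∧ B) ∨ (w = u ∧ C) ∨ (w = d ∧ D)) ↔
      (if A then 1 else 0) + (if B then 1 else 0) + (if C then 1 else 0) +
        (if D then 1 else 0) = (1 : ℤ) := by
  constructor
  · rintro ⟨w, hw, huniq⟩
    have hr : A → r = w := fun h => huniq r (Or.inl ⟨rfl, h⟩)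
    have hl : B → l = w := fun h => huniq l (Or.inr (Or.inl ⟨rfl, h⟩))
    have hu : C → u = w := fun h => huniq u (Or.inr (Or.inr (Or.inl ⟨rfl, h⟩)))
    have hd : D → d = w := fun h => huniq d (Or.inr (Or.inr (Or.inr ⟨rfl, h⟩)))
    clear huniq
    grind
  · intro h
    have : ∃ w, (w = r ∧ A) ∨ (w = l ∧ B) ∨ (w = u ∧ C) ∨ (w = d ∧ D) := by
      by_cases hA : A
      · exact ⟨r, Or.inl ⟨rfl, hA⟩⟩
      by_cases hB : B
      · exact ⟨l, Or.inr (Or.inl ⟨rfl, hB⟩)⟩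
      by_cases hC : C
      · exact ⟨u, Or.inr (Or.inr (Or.inl ⟨rfl, hC⟩))⟩
      by_cases hD : D
      · exact ⟨d, Or.inr (Or.inr (Or.inr ⟨rfl, hD⟩))⟩
      simp [hA, hB, hC, hD] at h
    obtain ⟨w, hw⟩ := this
    refine ⟨w, hw, fun w' hw' => ?_⟩
    grind

open Classical in
theorem existsUnique_adj_iff (M : squareGrid.Subgraph) (a : ℤ × ℤ) :
    (∃! w, M.Adj a w) ↔
      (if M.Adj a (a.1 + 1, a.2) then 1 else 0) + (if M.Adj (a.1 - 1, a.2) a then 1 else 0) +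
        (if M.Adj a (a.1, a.2 + 1) then 1 else 0) +
        (if M.Adj (a.1, a.2 - 1) a then 1 else 0) = (1 : ℤ) := by
  rw [← existsUnique_of_four (r := ((a.1 + 1, a.2) : ℤ × ℤ)) (l := (a.1 - 1, a.2))
    (u := (a.1, a.2 + 1)) (d := (a.1, a.2 - 1)) (by simp; omega) (by simp) (by simp) (by simp)
    (by simp) (by simp; omega)]
  exact existsUnique_congr (subgraph_adj_iff M a)

end Matching

/-! ### Matchings as histories -/

section MatchingHistory

variable {U : ℤ → ℤ → ℤ} {P : squareGrid.Subgraph}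

theorem jump_eq_zero {t : ℤ × ℤ} {y : ℤ} (h1 : t.2 ≠ y) (h2 : t.2 ≠ y - 1) : jump t y = 0 := by
  rw [jump, if_neg (by omega), if_neg (by omega)]
  simp

theorem siteSign_sub_one (x y : ℤ) : siteSign (x, y - 1) = -siteSign (x, y) := by
  have : Even (x + (y - 1)) ↔ ¬ Even (x + y) := by grind
  simp only [siteSign, this]
  split_ifs <;> simp_all

theorem occupation_step (T : Finset (ℤ × ℤ)) (f : ℤ → ℤ) (x y : ℤ) :
    occupation T f x y = occupation T f (x - 1) y -
      siteSign (x, y) * ((if (x, y) ∈ T then 1 else 0) + (if (x, y - 1) ∈ T then 1 else 0)) := by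
  have h : ∀ t ∈ T, (if t.1 ≤ x then jump t y else 0) =
      (if t.1 ≤ x - 1 then jump t y else 0) -
        ((if t = (x, y) then siteSign (x, y) else 0) +
          (if t = (x, y - 1) then siteSign (x, y) else 0)) := by
    intro t _
    rcases lt_trichotomy t.1 x with hx | hx | hx
    · have h1 : t ≠ (x, y) := fun h => by simp [h] at hx
      have h2 : t ≠ (x, y - 1) := fun h => by simp [h] at hx
      rw [if_pos hx.le, if_pos (by omega), if_neg h1, if_neg h2]
      simp
    · rw [if_pos hx.le, if_neg (by omega)]
      obtain ⟨a, b⟩ := t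
      simp only at hx
      subst hx
      simp only [Prod.mk.injEq, true_and]
      by_cases h1 : b = y
      · subst h1
        have : b ≠ b - 1 := by omega
        simp [jump, this]
      · by_cases h2 : b = y - 1
        · subst h2
          have : y ≠ y - 1 := by omega
          simp [jump, siteSign_sub_one, this]
        · rw [jump_eq_zero h1 h2, if_neg h1, if_neg h2]
          simp
    · have h1 : t ≠ (x, y) := fun h => by simp [h] at hx
      have h2 : t ≠ (x, y - 1) := fun h => by simp [h] at hx
      rw [if_neg (by omega), if_neg (by omega), if_neg h1, if_neg h2]
      simp
  unfold occupation
  rw [Finset.sum_filter, Finset.sum_filter, Finset.sum_congr rfl h, Finset.sum_sub_distrib,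
    Finset.sum_add_distrib, Finset.sum_ite_eq', Finset.sum_ite_eq', mul_add]
  simp only [mul_ite, mul_one, mul_zero]
  ring

theorem occupation_of_lt_rowStart (hU : IsPattern U) {T : Finset (ℤ × ℤ)}
    (hT : (T : Set (ℤ × ℤ)) ⊆ cone U 0 0 0) (f : ℤ → ℤ) {x y : ℤ} (hx : x < rowStart y) :
    occupation T f x y = f y := by
  rw [occupation, Finset.sum_eq_zero, add_zero]
  intro t ht
  rw [Finset.mem_filter] at ht
  by_contra hcon
  have : t.2 = y ∨ t.2 = y - 1 := by
    by_contra h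
    push Not at h
    exact hcon (jump_eq_zero h.1 h.2)
  have := (hU.row_of_mem_cone (hT ht.1) this).1
  omega

theorem occupation_of_rowEnd_le (hU : IsPattern U) {T : Finset (ℤ × ℤ)}
    (hT : (T : Set (ℤ × ℤ)) ⊆ cone U 0 0 0) {f g : ℤ → ℤ} (h : IsHistory T f g) {x y : ℤ}
    (hx : rowEnd U y ≤ x) : occupation T f x y = g y := by
  rw [h.2 y, occupation]
  congr 1
  refine Finset.sum_subset (Finset.filter_subset _ _) fun t ht ht' => ?_
  by_contra hcon
  have : t.2 = y ∨ t.2 = y - 1 := by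
    by_contra h
    push Not at h
    exact hcon (jump_eq_zero h.1 h.2)
  have := (hU.row_of_mem_cone (hT ht) this).2
  exact ht' (Finset.mem_filter.mpr ⟨ht, by omega⟩)

theorem vacuum_zero_eq (y : ℤ) : vacuum 0 y = if 1 ≤ y then 0 else 1 := by
  unfold vacuum
  split_ifs <;> omega

open Classical in
/-- The occupation of row `y` after column `x` that encodes the use of the horizontal edge with left
end `(x, y)`. -/
noncomputable def edgeOccupation (M : squareGrid.Subgraph) (x y : ℤ) : ℤ :=
  if Even (x + y) then (if M.Adj (x, y) (x + 1, y) then 1 else 0)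
  else 1 - (if M.Adj (x, y) (x + 1, y) then 1 else 0)

theorem edgeOccupation_mem (M : squareGrid.Subgraph) (x y : ℤ) :
    0 ≤ edgeOccupation M x y ∧ edgeOccupation M x y ≤ 1 := by
  unfold edgeOccupation
  split_ifs <;> norm_num

/-- In a subgraph of a pinecone, the occupation that encodes the horizontal edges next to the ends
of a row is that of the vacuum. -/
theorem IsPinecone.edgeOccupation_eq_vacuum (hP : IsPinecone U P) (hU : IsPattern U)
    {M : squareGrid.Subgraph} (hM : M ≤ P) {x y : ℤ} (hx : x = rowEnd U y ∨ x = rowStart y - 1) :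
    edgeOccupation M x y = vacuum 0 y := by
  have h : ¬ M.Adj (x, y) (x + 1, y) := by
    intro h
    have := (hP.adj_right (x, y)).mp (hM.2 h)
    simp only at this
    omega
  have hodd := hU.odd_row y
  -- The unused edge just outside a row encodes a hole for $x+y$ even and a particle otherwise;
  -- parity makes this agree with the vacuum at both ends.
  have hpar : Even (x + y) ↔ 1 ≤ y := by
    unfold rowStart at hx hodd
    rcases hx with rfl | rfl <;> split_ifs at * <;> grind
  unfold edgeOccupation
  rw [if_neg h, vacuum_zero_eq]
  simp only [hpar]
  split_ifs <;> simp

/-- With the parity-dependent encoding of horizontal edges, being covered exactly once is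
conservation of particles at the vertex. -/
theorem edgeOccupation_step {M : squareGrid.Subgraph} {T : Finset (ℤ × ℤ)}
    (hT : ∀ t : ℤ × ℤ, t ∈ T ↔ M.Adj t (t.1, t.2 + 1)) (x y : ℤ) :
    (∃! w, M.Adj (x, y) w) ↔ edgeOccupation M x y = edgeOccupation M (x - 1) y -
      siteSign (x, y) * ((if (x, y) ∈ T then 1 else 0) + (if (x, y - 1) ∈ T then 1 else 0)) := by
  rw [existsUnique_adj_iff]
  have h1 := hT (x, y)
  have h2 := hT (x, y - 1)
  simp only [sub_add_cancel] at h1 h2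
  have hpar : Even (x - 1 + y) ↔ ¬ Even (x + y) := by grind
  unfold edgeOccupation siteSign
  by_cases h : Even (x + y) <;> by_cases a1 : M.Adj (x, y) (x + 1, y) <;>
    by_cases a2 : M.Adj (x - 1, y) (x, y) <;> by_cases a3 : M.Adj (x, y) (x, y + 1) <;>
    by_cases a4 : M.Adj (x, y - 1) (x, y) <;> simp [h1, h2, hpar, h, a1, a2, a3, a4]

/-- The occupation that encodes the horizontal edges of a matching of a pinecone. -/
theorem IsPinecone.occupation_eq (hP : IsPinecone U P) (hU : IsPattern U)
    {M : squareGrid.Subgraph} (hM : M ∈ perfectMatchings P) {T : Finset (ℤ × ℤ)}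
    (hT : ∀ t : ℤ × ℤ, t ∈ T ↔ M.Adj t (t.1, t.2 + 1)) (x y : ℤ) :
    occupation T (vacuum 0) x y =
      if rowStart y ≤ x ∧ x < rowEnd U y then edgeOccupation M x y else vacuum 0 y := by
  have hcone : (T : Set (ℤ × ℤ)) ⊆ cone U 0 0 0 := fun t ht =>
    (hP.adj_up t).mp (hM.1.2 ((hT t).mp ht))
  rcases lt_or_ge x (rowStart y) with hx | hx
  · rw [occupation_of_lt_rowStart hU hcone _ hx, if_neg (by omega)]
  have hbase : occupation T (vacuum 0) (rowStart y - 1) y = vacuum 0 y :=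
    occupation_of_lt_rowStart hU hcone _ (by omega)
  have key : ∀ z, rowStart y - 1 ≤ z → occupation T (vacuum 0) z y =
      if rowStart y ≤ z ∧ z < rowEnd U y then edgeOccupation M z y else vacuum 0 y := by
    intro z hz
    induction z, hz using Int.leInduction with
    | base => rw [hbase, if_neg (by omega)]
    | succ z hz ih =>
      rw [occupation_step, add_sub_cancel_right, ih]
      by_cases hvert : ((z + 1, y) : ℤ × ℤ) ∈ P.verts
      · have h1 := (hP.mem_verts _).mp hvert
        simp only at h1
        have h2 := (edgeOccupation_step hT (z + 1) y).mp (hM.2.2 (hM.2.1 ▸ hvert))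
        rw [add_sub_cancel_right] at h2
        have h3 : (if rowStart y ≤ z ∧ z < rowEnd U y then edgeOccupation M z y
            else vacuum 0 y) = edgeOccupation M z y := by
          split_ifs
          · rfl
          · exact (hP.edgeOccupation_eq_vacuum hU hM.1 (by omega)).symm
        have h4 : (if rowStart y ≤ z + 1 ∧ z + 1 < rowEnd U y then edgeOccupation M (z + 1) y
            else vacuum 0 y) = edgeOccupation M (z + 1) y := by
          split_ifs
          · rfl
          · exact (hP.edgeOccupation_eq_vacuum hU hM.1 (by omega)).symm
        rw [h3, h4, h2]
      · have h1 : ∀ w, ¬ M.Adj (z + 1, y) w := fun w h => hvert (P.edge_vert (hM.1.2 h))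
        have h2 : ((z + 1, y) : ℤ × ℤ) ∉ T := fun h => h1 _ ((hT _).mp h)
        have h3 : ((z + 1, y - 1) : ℤ × ℤ) ∉ T := fun h => by
          have := ((hT _).mp h).symm
          simp only [sub_add_cancel] at this
          exact h1 _ this
        rw [hP.mem_verts] at hvert
        simp only at hvert
        rw [if_neg h2, if_neg h3, if_neg (by omega), if_neg (by omega)]
        simp
  exact key x (by omega)

theorem IsPinecone.isHistory (hP : IsPinecone U P) (hU : IsPattern U)
    {M : squareGrid.Subgraph} (hM : M ∈ perfectMatchings P) {T : Finset (ℤ × ℤ)}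
    (hT : ∀ t : ℤ × ℤ, t ∈ T ↔ M.Adj t (t.1, t.2 + 1)) :
    IsHistory T (vacuum 0) (vacuum 0) := by
  refine ⟨fun x y => ?_, fun y => ?_⟩
  · rw [hP.occupation_eq hU hM hT]
    split_ifs
    · exact edgeOccupation_mem M x y
    · exact vacuum_mem 0 y
  · obtain ⟨X, hX⟩ := exists_forall_le T
    rw [← occupation_of_forall_le (vacuum 0) (x := max X (rowEnd U y)) y
      fun t ht => (hX t ht).trans (le_max_left _ _), hP.occupation_eq hU hM hT,
      if_neg fun h => absurd h.2 (not_lt.mpr (le_max_right _ _))]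

/-- The vertical edges determine all occupations, hence all horizontal edges. -/
theorem IsPinecone.matching_ext (hP : IsPinecone U P) (hU : IsPattern U)
    {M M' : squareGrid.Subgraph} (hM : M ∈ perfectMatchings P) (hM' : M' ∈ perfectMatchings P)
    {T : Finset (ℤ × ℤ)} (hT : ∀ t : ℤ × ℤ, t ∈ T ↔ M.Adj t (t.1, t.2 + 1))
    (hT' : ∀ t : ℤ × ℤ, t ∈ T ↔ M'.Adj t (t.1, t.2 + 1)) : M = M' := by
  have hright : ∀ x y, M.Adj (x, y) (x + 1, y) ↔ M'.Adj (x, y) (x + 1, y) := by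
    intro x y
    by_cases h : rowStart y ≤ x ∧ x < rowEnd U y
    · have h1 := hP.occupation_eq hU hM hT x y
      rw [hP.occupation_eq hU hM' hT' x y, if_pos h, if_pos h] at h1
      unfold edgeOccupation at h1
      split_ifs at h1 <;> simp_all
    · have : ¬ P.Adj (x, y) (x + 1, y) := fun h' => h ((hP.adj_right (x, y)).mp h')
      exact ⟨fun h' => absurd (hM.1.2 h') this, fun h' => absurd (hM'.1.2 h') this⟩
  have hup : ∀ x y, M.Adj (x, y) (x, y + 1) ↔ M'.Adj (x, y) (x, y + 1) := fun x y =>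
    (hT (x, y)).symm.trans (hT' (x, y))
  refine SimpleGraph.Subgraph.ext (hM.2.1.trans hM'.2.1.symm) ?_
  funext a w
  apply propext
  have h1 := hright (a.1 - 1) a.2
  have h2 := hup a.1 (a.2 - 1)
  rw [sub_add_cancel] at h1 h2
  rw [subgraph_adj_iff M, subgraph_adj_iff M', hright a.1 a.2, h1, hup a.1 a.2, h2]

theorem IsPinecone.exists_matching (hP : IsPinecone U P) (hU : IsPattern U) {T : Finset (ℤ × ℤ)}
    (hT : (T : Set (ℤ × ℤ)) ⊆ cone U 0 0 0) (h : IsHistory T (vacuum 0) (vacuum 0)) :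
    ∃ M ∈ perfectMatchings P, ∀ t : ℤ × ℤ, t ∈ T ↔ M.Adj t (t.1, t.2 + 1) := by
  -- The horizontal edges are decoded from the occupation: used for a particle at even sites and for
  -- a hole at odd ones.
  let H : ℤ × ℤ → Prop := fun a => (rowStart a.2 ≤ a.1 ∧ a.1 < rowEnd U a.2) ∧
    occupation T (vacuum 0) a.1 a.2 = if Even (a.1 + a.2) then 1 else 0
  have hHP : ∀ a, H a → P.Adj a (a.1 + 1, a.2) := fun a ha => (hP.adj_right a).mpr ha.1
  have hTP : ∀ a ∈ T, P.Adj a (a.1, a.2 + 1) := fun a ha => (hP.adj_up a).mpr (hT ha)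
  let M : squareGrid.Subgraph :=
    { verts := P.verts
      Adj := fun p q => (q = (p.1 + 1, p.2) ∧ H p) ∨ (p = (q.1 + 1, q.2) ∧ H q) ∨
        (q = (p.1, p.2 + 1) ∧ p ∈ T) ∨ (p = (q.1, q.2 + 1) ∧ q ∈ T)
      adj_sub := by
        rintro p q (⟨rfl, -⟩ | ⟨rfl, -⟩ | ⟨rfl, -⟩ | ⟨rfl, -⟩) <;> simp [squareGrid]
      edge_vert := by
        rintro p q (⟨rfl, h⟩ | ⟨rfl, h⟩ | ⟨rfl, h⟩ | ⟨rfl, h⟩)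
        · exact P.edge_vert (hHP _ h)
        · exact P.edge_vert (hHP _ h).symm
        · exact P.edge_vert (hTP _ h)
        · exact P.edge_vert (hTP _ h).symm
      symm := ⟨by rintro p q (h | h | h | h) <;> simp [h]⟩ }
  have hMP : M ≤ P := by
    refine ⟨le_rfl, ?_⟩
    rintro p q (⟨rfl, h⟩ | ⟨rfl, h⟩ | ⟨rfl, h⟩ | ⟨rfl, h⟩)
    · exact hHP _ h
    · exact (hHP _ h).symm
    · exact hTP _ h
    · exact (hTP _ h).symm
  have hMT : ∀ t : ℤ × ℤ, t ∈ T ↔ M.Adj t (t.1, t.2 + 1) := by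
    intro t
    refine ⟨fun h => Or.inr (Or.inr (Or.inl ⟨rfl, h⟩)), ?_⟩
    rintro (⟨h, -⟩ | ⟨h, -⟩ | ⟨-, h⟩ | ⟨h, -⟩)
    · simp at h
    · have := congrArg Prod.snd h
      simp at this
    · exact h
    · have := congrArg Prod.snd h
      simp at this
      omega
  have hMH : ∀ a : ℤ × ℤ, M.Adj a (a.1 + 1, a.2) ↔ H a := by
    intro a
    refine ⟨?_, fun h => Or.inl ⟨rfl, h⟩⟩
    rintro (⟨-, h⟩ | ⟨h, -⟩ | ⟨h, -⟩ | ⟨h, -⟩)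
    · exact h
    · have := congrArg Prod.fst h
      simp at this
      omega
    · simp at h
    · have := congrArg Prod.fst h
      simp at this
  have hocc : ∀ x y, rowStart y ≤ x ∧ x < rowEnd U y →
      edgeOccupation M x y = occupation T (vacuum 0) x y := by
    intro x y hxy
    have h1 : M.Adj (x, y) (x + 1, y) ↔
        occupation T (vacuum 0) x y = if Even (x + y) then 1 else 0 :=
      (hMH (x, y)).trans (and_iff_right hxy)
    have h2 := h.1 x y
    unfold edgeOccupation
    by_cases hadj : M.Adj (x, y) (x + 1, y)
    · rw [h1.mp hadj, if_pos hadj]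
      simp
    · rw [if_neg hadj]
      rw [h1] at hadj
      split_ifs at hadj ⊢ <;> omega
  refine ⟨M, ⟨hMP, rfl, ?_⟩, hMT⟩
  intro a ha
  have hv := (hP.mem_verts a).mp ha
  refine (edgeOccupation_step hMT a.1 a.2).mpr ?_
  have h1 : edgeOccupation M a.1 a.2 = occupation T (vacuum 0) a.1 a.2 := by
    by_cases hr : a.1 < rowEnd U a.2
    · exact hocc _ _ ⟨hv.1, hr⟩
    · rw [hP.edgeOccupation_eq_vacuum hU hMP (by omega),
        occupation_of_rowEnd_le hU hT h (by omega)]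
  have h2 : edgeOccupation M (a.1 - 1) a.2 = occupation T (vacuum 0) (a.1 - 1) a.2 := by
    by_cases hr : rowStart a.2 ≤ a.1 - 1
    · exact hocc _ _ ⟨hr, by omega⟩
    · rw [hP.edgeOccupation_eq_vacuum hU hMP (by omega),
        occupation_of_lt_rowStart hU hT _ (by omega)]
  rw [h1, h2]
  exact occupation_step T (vacuum 0) a.1 a.2

end MatchingHistory

/-! ### The weighted count of matchings -/

section Count

variable {U : ℤ → ℤ → ℤ} {P : squareGrid.Subgraph}

theorem sum_Ioc_neg_eq (g : ℤ → ℤ) (B : ℕ) :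
    ∑ y ∈ Finset.Ioc (-(B : ℤ)) B, g y =
      ∑ r ∈ Finset.range B, g (r + 1) + ∑ r ∈ Finset.range B, g (-r) := by
  induction B with
  | zero => simp
  | succ B ih =>
    have : Finset.Ioc (-((B + 1 : ℕ) : ℤ)) ((B + 1 : ℕ) : ℤ) =
        insert ((B : ℤ) + 1) (insert (-(B : ℤ)) (Finset.Ioc (-(B : ℤ)) B)) := by
      ext y
      simp only [Finset.mem_Ioc, Finset.mem_insert]
      push_cast
      omega
    rw [this, Finset.sum_insert (by simp), Finset.sum_insert (by simp), ih,
      Finset.sum_range_succ, Finset.sum_range_succ]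
    ring

-- Without jumps, rows $y\ge1$ hold holes and rows $y\le0$ hold particles; the latter are the
-- reflected upper half.
open Classical in
theorem IsPattern.sum_frozen_eq (hU : IsPattern U) {X : ℤ} (hX : U 0 0 ≤ X) {B : ℕ}
    (hB : U 0 0 ≤ B) :
    ∑ y ∈ Finset.Ioc (-(B : ℤ)) B, ∑ x ∈ Finset.Ico 0 X,
      (if rowStart y ≤ x ∧ x < rowEnd U y then
        (if 1 ≤ y then holeExponent U x y else particleExponent U x y) else 0) =
      frozenExponent U := by
  have hrow : ∀ y, ∑ x ∈ Finset.Ico 0 X, (if rowStart y ≤ x ∧ x < rowEnd U y then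
        (if 1 ≤ y then holeExponent U x y else particleExponent U x y) else 0) =
      ∑ x ∈ Finset.Ico (rowStart y) (rowEnd U y),
        (if 1 ≤ y then holeExponent U x y else particleExponent U x y) := by
    intro y
    rw [← Finset.sum_filter]
    congr 1
    ext x
    have h1 := rowStart_nonneg y
    have h2 := hU.rowEnd_add_le y
    simp only [Finset.mem_filter, Finset.mem_Ico]
    omega
  simp only [hrow]
  rw [sum_Ioc_neg_eq, frozenExponent, hU.upperExponent_eq hB,
    hU.reflect.upperExponent_eq (R := B) (by simpa [reflectPattern] using hB)]
  congr 1
  · refine Finset.sum_congr rfl fun r _ => ?_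
    have h : (1 : ℤ) ≤ r + 1 := by omega
    simp only [rowStart, rowEnd, if_pos h, add_sub_cancel_right]
  · refine Finset.sum_congr rfl fun r _ => ?_
    have h : ¬ (1 : ℤ) ≤ -r := by omega
    simp only [rowStart, rowEnd, if_neg h, neg_neg, hU.holeExponent_reflect, reflectPattern,
      zero_add]
    refine Finset.sum_congr rfl fun x _ => ?_
    congr 1
    ring

/-- The deviation from the vacuum is a sum over past jumps; exchanging summations gives each jump
its effect on all later columns. -/
theorem sum_occupation_mul_eq {T : Finset (ℤ × ℤ)} {X : ℤ} {B : ℕ}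
    (hT : ∀ t ∈ T, 0 ≤ t.1 ∧ -(B : ℤ) < t.2 ∧ t.2 < B) :
    ∑ y ∈ Finset.Ioc (-(B : ℤ)) B, ∑ x ∈ Finset.Ico 0 X,
      (occupation T (vacuum 0) x y - vacuum 0 y) * exponentChange U x y =
      ∑ t ∈ T, jumpExponent U X t := by
  have h1 : ∀ x y, (occupation T (vacuum 0) x y - vacuum 0 y) * exponentChange U x y =
      ∑ t ∈ T, if t.1 ≤ x then jump t y * exponentChange U x y else 0 := by
    intro x y
    rw [occupation, add_sub_cancel_left, Finset.sum_filter, Finset.sum_mul]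
    exact Finset.sum_congr rfl fun t _ => by rw [ite_mul, zero_mul]
  have h2 : ∀ t ∈ T, ∀ x, ∑ y ∈ Finset.Ioc (-(B : ℤ)) B, jump t y * exponentChange U x y =
      siteSign t * (exponentChange U x (t.2 + 1) - exponentChange U x t.2) := by
    intro t ht x
    have h3 := hT t ht
    simp only [jump, mul_sub, sub_mul, Finset.sum_sub_distrib, mul_ite, mul_one, mul_zero, ite_mul,
      zero_mul, Finset.sum_ite_eq']
    rw [if_pos (by rw [Finset.mem_Ioc]; omega), if_pos (by rw [Finset.mem_Ioc]; omega)]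
  simp only [h1]
  rw [Finset.sum_comm]
  have h4 : ∀ x, ∑ y ∈ Finset.Ioc (-(B : ℤ)) B,
      (∑ t ∈ T, if t.1 ≤ x then jump t y * exponentChange U x y else 0) =
      ∑ t ∈ T, if t.1 ≤ x then
        siteSign t * (exponentChange U x (t.2 + 1) - exponentChange U x t.2) else 0 := by
    intro x
    rw [Finset.sum_comm]
    refine Finset.sum_congr rfl fun t ht => ?_
    split_ifs
    · exact h2 t ht x
    · simp
  simp only [h4]
  rw [Finset.sum_comm]
  refine Finset.sum_congr rfl fun t ht => ?_
  rw [jumpExponent, Finset.mul_sum, ← Finset.sum_filter]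
  refine Finset.sum_congr ?_ fun _ _ => rfl
  ext x
  have := hT t ht
  simp only [Finset.mem_filter, Finset.mem_Ico]
  omega

/-- The count is affine in the occupations: the value for the vacuum plus `exponentChange` times the
deviation. Any cutoff beyond the pinecone works, because the final deviation is zero. -/
theorem IsPinecone.specialCount_eq (hP : IsPinecone U P) (hU : IsPattern U) {X : ℤ}
    (hX : U 0 0 ≤ X) {M : squareGrid.Subgraph} (hM : M ∈ perfectMatchings P) {T : Finset (ℤ × ℤ)}
    (hT : ∀ t : ℤ × ℤ, t ∈ T ↔ M.Adj t (t.1, t.2 + 1)) :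
    (specialCount P M : ℤ) = frozenExponent U + ∑ t ∈ T, jumpExponent U X t := by
  classical
  set B : ℕ := (U 0 0).toNat + 1 with hB
  have hTB : ∀ t ∈ T, 0 ≤ t.1 ∧ -(B : ℤ) < t.2 ∧ t.2 < B := by
    intro t ht
    obtain ⟨h1, h2, -⟩ := (hP.adj_up t).mp (hM.1.2 ((hT t).mp ht))
    have h3 := hU.add_abs_le 0 0 t.2
    have h4 := le_abs_self t.2
    have h5 := neg_abs_le t.2
    have h6 := abs_nonneg t.2
    rw [zero_add, sub_zero] at h1
    rw [sub_zero] at h3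
    omega
  rw [← hU.sum_frozen_eq hX (show U 0 0 ≤ B by omega), ← sum_occupation_mul_eq hTB,
    ← Finset.sum_add_distrib]
  have hright : ∀ a : ℤ × ℤ, M.Adj a (a.1 + 1, a.2) → rowStart a.2 ≤ a.1 ∧ a.1 < rowEnd U a.2 :=
    fun a h => (hP.adj_right a).mp (hM.1.2 h)
  have hset : {a : ℤ × ℤ | M.Adj a (a.1 + 1, a.2) ∧ ¬ IsOrdinary P a} =
      ((Finset.Ico 0 X ×ˢ Finset.Ioc (-(B : ℤ)) B).filter
        fun a : ℤ × ℤ => M.Adj a (a.1 + 1, a.2) ∧ ¬ IsOrdinary P a : Finset (ℤ × ℤ)) := by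
    ext a
    simp only [Set.mem_ofPred_eq, Finset.coe_filter, Finset.mem_product, Finset.mem_Ico,
      Finset.mem_Ioc, iff_and_self]
    rintro ⟨h, -⟩
    have h1 := hright a h
    have h2 := hU.rowEnd_add_le a.2
    have h3 := rowStart_nonneg a.2
    refine ⟨⟨by omega, by omega⟩, ?_⟩
    unfold rowStart at h1 h2
    split_ifs at h1 h2 <;> omega
  rw [specialCount, hset, Set.ncard_coe_finset, Finset.card_filter, Nat.cast_sum,
    Finset.sum_product_right]
  refine Finset.sum_congr rfl fun y _ => ?_
  rw [← Finset.sum_add_distrib]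
  refine Finset.sum_congr rfl fun x _ => ?_
  have hocc := hP.occupation_eq hU hM hT x y
  by_cases h : rowStart y ≤ x ∧ x < rowEnd U y
  · rw [hocc, if_pos h, if_pos h, hP.isOrdinary_iff hU (a := (x, y)) h, vacuum_zero_eq]
    unfold edgeOccupation exponentChange particleExponent holeExponent
    rcases Int.even_or_odd (x + y) with h1 | h1
    · have h1' : ¬ Odd (x + y) := Int.not_odd_iff_even.mpr h1
      by_cases h2 : ClosestBelow U x y <;> by_cases h3 : M.Adj (x, y) (x + 1, y) <;>
        by_cases h4 : 1 ≤ y <;> simp [h1, h1', h2, h3, h4]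
    · have h1' : ¬ Even (x + y) := Int.not_even_iff_odd.mpr h1
      by_cases h2 : ClosestBelow U x y <;> by_cases h3 : M.Adj (x, y) (x + 1, y) <;>
        by_cases h4 : 1 ≤ y <;> simp [h1, h1', h2, h3, h4]
  · rw [hocc, if_neg h, if_neg h, if_neg fun h' => h (hright (x, y) h'.1)]
    simp

variable {K : Type*} [Field K]

/-- Matchings biject with histories through their vertical edges. A single jump may carry a negative
power of $u$, which is why the count is made in a field with $u\ne0$. -/
theorem IsPinecone.finsum_matchings_eq (hP : IsPinecone U P) (hU : IsPattern U) {X : ℤ}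
    (hX : U 0 0 ≤ X) {u : K} (hu : u ≠ 0) (v : K) :
    ∑ᶠ M ∈ perfectMatchings P, u ^ specialCount P M * v ^ verticalCount M =
      patternSum u v U X := by
  classical
  set E := (hU.cone_finite 0 0 0).toFinset with hE
  have hTM : ∀ M ∈ perfectMatchings P, ∀ t : ℤ × ℤ,
      t ∈ E.filter (fun t : ℤ × ℤ => M.Adj t (t.1, t.2 + 1)) ↔ M.Adj t (t.1, t.2 + 1) := by
    intro M hM t
    rw [Finset.mem_filter, hE, Set.Finite.mem_toFinset]
    exact and_iff_right_of_imp fun h => (hP.adj_up t).mp (hM.1.2 h)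
  have hmem : ∀ T : Finset (ℤ × ℤ),
      T ∈ (E.powerset.filter fun T => IsHistory T (vacuum 0) (vacuum 0)) ↔
      (T : Set (ℤ × ℤ)) ⊆ cone U 0 0 0 ∧ IsHistory T (vacuum 0) (vacuum 0) := by
    intro T
    rw [Finset.mem_filter, Finset.mem_powerset, hE, Set.Finite.subset_toFinset]
  have hbij : Set.BijOn
      (fun M : squareGrid.Subgraph => E.filter fun t : ℤ × ℤ => M.Adj t (t.1, t.2 + 1))
      (perfectMatchings P) (E.powerset.filter fun T => IsHistory T (vacuum 0) (vacuum 0) :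
        Finset (Finset (ℤ × ℤ))) := by
    refine ⟨fun M hM => ?_, fun M hM M' hM' h => ?_, fun T hT => ?_⟩
    · rw [Finset.mem_coe, Finset.mem_filter, Finset.mem_powerset]
      exact ⟨Finset.filter_subset _ _, hP.isHistory hU hM (hTM M hM)⟩
    · refine hP.matching_ext hU hM hM' (hTM M hM) fun t => ?_
      dsimp only at h
      rw [h]
      exact hTM M' hM' t
    · obtain ⟨h1, h2⟩ := (hmem T).mp hT
      obtain ⟨M, hM, h3⟩ := hP.exists_matching hU h1 h2
      refine ⟨M, hM, ?_⟩
      ext t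
      exact (hTM M hM t).trans (h3 t).symm
  rw [finsum_mem_eq_of_bijOn (g := fun T : Finset (ℤ × ℤ) =>
    u ^ (frozenExponent U + ∑ t ∈ T, jumpExponent U X t) * v ^ T.card) _ hbij,
    finsum_mem_coe_finset, patternSum, coneAmplitude, dif_pos (hU.cone_finite 0 0 0), amplitude,
    Finset.mul_sum]
  · refine Finset.sum_congr rfl fun T hT => ?_
    clear hT
    simp only [jumpWeight]
    rw [Finset.prod_mul_distrib, Finset.prod_const, zpow_add₀ hu]
    have : ∏ t ∈ T, u ^ jumpExponent U X t = u ^ ∑ t ∈ T, jumpExponent U X t := by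
      induction T using Finset.induction_on with
      | empty => simp
      | insert t T ht ih => rw [Finset.prod_insert ht, Finset.sum_insert ht, ih, zpow_add₀ hu]
    rw [this]
    ring
  · intro M hM
    rw [← hP.specialCount_eq hU hX hM (hTM M hM), zpow_natCast, verticalCount]
    congr 2
    rw [← Set.ncard_coe_finset]
    congr 1
    ext t
    exact (hTM M hM t).symm

end Count

/-! ### The Gale–Robinson pattern and the recurrence -/

section GaleRobinsonPattern

variable {i j k l n : ℕ}

/-- The pattern of the pinecone `P(n;i,j,k,l)`. -/
def galeRobinsonPattern (i j k n : ℕ) (b c : ℤ) : ℤ :=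
  2 * c + b - 3 - 2 * ((((i : ℤ) + j) * c + k * b + i - n - 1) / (j : ℤ))

theorem ediv_add_one_le {a b d : ℤ} (hd : 0 < d) (h : a + d ≤ b) : a / d + 1 ≤ b / d := by
  have := Int.ediv_le_ediv hd h
  rwa [Int.add_ediv_of_dvd_right (dvd_refl d), Int.ediv_self hd.ne'] at this

/-- The two interlacing steps raise the numerator by $k$ and by $m-k=\ell$; both are at least $j$,
so the floor grows by at least one. -/
theorem isPattern_galeRobinsonPattern (hj : 0 < j) (hkl : k + l = i + j) (hjk : j ≤ k)
    (hjl : j ≤ l) : IsPattern (galeRobinsonPattern i j k n) := by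
  have hj' : (0 : ℤ) < j := by exact_mod_cast hj
  have hkl' : (k : ℤ) + l = i + j := by exact_mod_cast hkl
  refine ⟨fun b c => ?_, fun b c => ?_, fun b c => ?_⟩
  · exact ⟨c + b - 2 - ((((i : ℤ) + j) * c + k * b + i - n - 1) / (j : ℤ)), by
      unfold galeRobinsonPattern; ring⟩
  · unfold galeRobinsonPattern
    have := ediv_add_one_le hj' (a := ((i : ℤ) + j) * c + k * b + i - n - 1)
      (b := ((i : ℤ) + j) * c + k * (b + 1) + i - n - 1) (by rw [mul_add]; omega)
    omega
  · unfold galeRobinsonPattern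
    have := ediv_add_one_le hj' (a := ((i : ℤ) + j) * c + k * (b + 1) + i - n - 1)
      (b := ((i : ℤ) + j) * (c + 1) + k * b + i - n - 1) (by rw [mul_add, mul_add]; omega)
    omega

theorem oddAbscissa_eq (i j k n r c : ℕ) :
    oddAbscissa i j k n r c = galeRobinsonPattern i j k n r c := rfl

/-- Since $m-k=\ell$, the lower function is the upper one continued to negative rows, so both halves
belong to one pattern. -/
theorem oddAbscissa_eq_neg (hkl : k + l = i + j) (r c : ℕ) :
    oddAbscissa i j l n r c = galeRobinsonPattern i j k n (-r) (c + r) := by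
  have hkl' : (i : ℤ) + j = k + l := by exact_mod_cast hkl.symm
  unfold oddAbscissa galeRobinsonPattern
  rw [show ((i : ℤ) + j) * (c + r) + k * -r + i - n - 1 =
    ((i : ℤ) + j) * c + l * r + i - n - 1 by rw [hkl']; ring]
  ring

theorem isHorizontalEdge_iff (hkl : k + l = i + j) (a : ℤ × ℤ) :
    IsHorizontalEdge i j k l n a ↔
      rowStart a.2 ≤ a.1 ∧ a.1 < rowEnd (galeRobinsonPattern i j k n) a.2 := by
  have h : ∀ r : ℕ, oddAbscissa i j l n r 0 = galeRobinsonPattern i j k n (-r) r := fun r => by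
    simpa using oddAbscissa_eq_neg (n := n) hkl r 0
  unfold IsHorizontalEdge rowStart rowEnd
  simp only [h, oddAbscissa_eq, Nat.cast_zero]
  constructor
  · rintro ⟨r, h1, ⟨h2, h3⟩ | ⟨h2, h3⟩⟩
    · rw [h2, if_pos (by omega), if_pos (by omega), add_sub_cancel_right]
      omega
    · rw [h2, if_neg (by omega), if_neg (by omega), neg_neg]
      omega
  · split_ifs with h1
    · rintro ⟨h2, h3⟩
      refine ⟨(a.2 - 1).toNat, by omega, Or.inl ?_⟩
      rw [Int.toNat_of_nonneg (by omega)]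
      omega
    · rintro ⟨h2, h3⟩
      refine ⟨(-a.2).toNat, by omega, Or.inr ?_⟩
      rw [Int.toNat_of_nonneg (by omega), neg_neg]
      omega

theorem isVertex_iff (hkl : k + l = i + j) (a : ℤ × ℤ) :
    IsVertex i j k l n a ↔
      rowStart a.2 ≤ a.1 ∧ a.1 ≤ rowEnd (galeRobinsonPattern i j k n) a.2 ∧
        rowStart a.2 < rowEnd (galeRobinsonPattern i j k n) a.2 := by
  unfold IsVertex
  rw [isHorizontalEdge_iff hkl, isHorizontalEdge_iff hkl]
  simp only
  omega

theorem isVerticalEdge_iff (hj : 0 < j) (hkl : k + l = i + j) (hjk : j ≤ k) (hjl : j ≤ l)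
    (a : ℤ × ℤ) :
    IsVerticalEdge i j k l n a ↔ a ∈ cone (galeRobinsonPattern i j k n) 0 0 0 := by
  have hU := isPattern_galeRobinsonPattern (n := n) hj hkl hjk hjl
  unfold IsVerticalEdge
  rw [isVertex_iff hkl, isVertex_iff hkl]
  simp only
  constructor
  · rintro ⟨⟨h1, h2, -⟩, ⟨h3, h4, -⟩, h5⟩
    unfold rowStart at h1 h3
    unfold rowEnd at h2 h4
    refine ⟨?_, ?_, h5.imp_right ?_⟩
    · rw [zero_add, sub_zero, abs_le]
      split_ifs at h1 h3 <;> omega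
    · rcases le_or_gt 0 a.2 with h | h
      · rw [if_pos (by omega), add_sub_cancel_right] at h4
        rwa [max_eq_left (by omega), add_zero]
      · rw [if_neg (by omega)] at h2
        rwa [max_eq_right (by omega), zero_add, zero_sub]
    · rintro ⟨r, c, -, ⟨h6, h7⟩ | ⟨h6, h7⟩⟩
      · exact ⟨c, by rw [h7, h6]; rfl⟩
      · exact ⟨c + r, by rw [h7, h6, oddAbscissa_eq_neg hkl]⟩
  · intro h
    have h1 := hU.row_of_mem_cone h (y := a.2) (Or.inl rfl)
    have h2 := hU.row_of_mem_cone h (y := a.2 + 1) (Or.inr (by simp))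
    have h3 : ∀ y, rowStart y ≠ rowEnd (galeRobinsonPattern i j k n) y := by
      intro y h
      have := hU.odd_row y
      rw [h] at this
      grind
    refine ⟨⟨h1.1, h1.2, lt_of_le_of_ne (h1.1.trans h1.2) (h3 _)⟩,
      ⟨h2.1, h2.2, lt_of_le_of_ne (h2.1.trans h2.2) (h3 _)⟩, h.2.2.imp_right ?_⟩
    rintro ⟨c, hc⟩
    have h4 := h.1
    have h5 := h.2.1
    rw [zero_add, sub_zero] at h4
    rw [zero_add, zero_sub, hc] at h5
    have h6 := (hU.strictAnti a.2).le_iff_ge.mp h5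
    have h7 := hU.odd a.2 c
    rw [← hc] at h7
    -- The cone only gives a weak inequality, while prescribed odd edges need a strict one; equality
    -- would make the site even.
    have h8 : |a.2| < a.1 := by
      refine lt_of_le_of_ne h4 fun h => ?_
      rw [← h] at h7
      grind
    rcases le_total 0 a.2 with h9 | h9
    · refine ⟨a.2.toNat, c.toNat, ?_, Or.inl ⟨?_, ?_⟩⟩
      · grind
      · omega
      · rw [oddAbscissa_eq, Int.toNat_of_nonneg h9, Int.toNat_of_nonneg (by omega), hc]
    · refine ⟨(-a.2).toNat, (c + a.2).toNat, ?_, Or.inr ⟨?_, ?_⟩⟩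
      · grind
      · omega
      · rw [oddAbscissa_eq_neg hkl, Int.toNat_of_nonneg (by omega),
          Int.toNat_of_nonneg (by omega), neg_neg, add_neg_cancel_right, hc]

theorem isPinecone_pinecone (hj : 0 < j) (hkl : k + l = i + j) (hjk : j ≤ k) (hjl : j ≤ l) :
    IsPinecone (galeRobinsonPattern i j k n) (pinecone i j k l n) := by
  refine ⟨isVertex_iff hkl, fun a => ?_, fun a => ?_⟩
  · rw [← isHorizontalEdge_iff hkl]
    refine ⟨?_, fun h => Or.inl ⟨rfl, h⟩⟩
    rintro (⟨-, h⟩ | ⟨h, -⟩ | ⟨h, -⟩ | ⟨h, -⟩)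
    · exact h
    · have := congrArg Prod.fst h
      simp at this
      omega
    · simp at h
    · have := congrArg Prod.fst h
      simp at this
  · rw [← isVerticalEdge_iff hj hkl hjk hjl]
    refine ⟨?_, fun h => Or.inr (Or.inr (Or.inl ⟨rfl, h⟩))⟩
    rintro (⟨h, -⟩ | ⟨h, -⟩ | ⟨-, h⟩ | ⟨h, -⟩)
    · simp at h
    · have := congrArg Prod.snd h
      simp at this
    · exact h
    · have := congrArg Prod.snd h
      simp at this
      omega

/-- The embedding of the polynomials with natural coefficients into the rational functions. -/
noncomputable def toRationalFunctions : MvPolynomial (Fin 2) ℕ →+* RationalFunctions :=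
  (algebraMap (MvPolynomial (Fin 2) ℤ) RationalFunctions).comp
    (MvPolynomial.map (Nat.castRingHom ℤ))

theorem toRationalFunctions_injective : Function.Injective toRationalFunctions :=
  (IsFractionRing.injective (MvPolynomial (Fin 2) ℤ) RationalFunctions).comp
    (MvPolynomial.map_injective _ Nat.cast_injective)

theorem toRationalFunctions_X_ne_zero (s : Fin 2) :
    toRationalFunctions (MvPolynomial.X s) ≠ 0 := by
  rw [← map_zero toRationalFunctions]
  exact toRationalFunctions_injective.ne (MvPolynomial.X_ne_zero s)

theorem toRationalFunctions_q (hj : 0 < j) (hkl : k + l = i + j) (hjk : j ≤ k) (hjl : j ≤ l)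
    {X : ℤ} (hX : galeRobinsonPattern i j k n 0 0 ≤ X) :
    toRationalFunctions (q i j k l n) =
      patternSum (toRationalFunctions (MvPolynomial.X 0)) (toRationalFunctions (MvPolynomial.X 1))
        (galeRobinsonPattern i j k n) X := by
  rw [← (isPinecone_pinecone hj hkl hjk hjl).finsum_matchings_eq
    (isPattern_galeRobinsonPattern hj hkl hjk hjl) hX (toRationalFunctions_X_ne_zero 0), q]
  refine (AddMonoidHom.map_finsum_mem _
    (toRationalFunctions : MvPolynomial (Fin 2) ℕ →+ RationalFunctions)
    (perfectMatchings_finite (pinecone_verts_finite n hj hjk hjl))).trans ?_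
  simp

/-- The cone is empty, so the empty history is the only one, and no horizontal edge is counted. -/
theorem IsPattern.patternSum_eq_one {U : ℤ → ℤ → ℤ} (hU : IsPattern U) (h : U 0 0 < 0)
    {K : Type*} [Field K] (u v : K) (X : ℤ) : patternSum u v U X = 1 := by
  classical
  have hcone : cone U 0 0 0 = ∅ := by
    ext t
    simp only [Set.mem_empty_iff_false, iff_false]
    rintro ⟨h1, h2, -⟩
    have := hU.add_abs_le 0 0 t.2
    have := abs_nonneg (t.2 - 0)
    omega
  have h0 : frozenExponent U = 0 := by
    rw [frozenExponent, hU.upperExponent_eq (R := 0) (by simpa using h.le),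
      hU.reflect.upperExponent_eq (R := 0) (by simpa [reflectPattern] using h.le)]
    simp
  have h1 : IsHistory ∅ (vacuum 0) (vacuum 0) :=
    ⟨fun x y => by simpa [occupation] using vacuum_mem 0 y, fun y => by simp⟩
  have h2 : coneAmplitude (jumpWeight u v U X) U 0 0 0 = 1 := by
    rw [coneAmplitude, dif_pos (hU.cone_finite 0 0 0)]
    simp only [hcone, Set.Finite.toFinset_empty]
    rw [amplitude, Finset.powerset_empty, Finset.filter_singleton, if_pos h1]
    simp
  rw [patternSum, h0, h2]
  simp

theorem q_eq_one (hj : 0 < j) (hkl : k + l = i + j) (hjk : j ≤ k) (hjl : j ≤ l) (hn : n < i + j) :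
    q i j k l n = 1 := by
  apply toRationalFunctions_injective
  rw [toRationalFunctions_q hj hkl hjk hjl le_rfl, map_one]
  refine (isPattern_galeRobinsonPattern hj hkl hjk hjl).patternSum_eq_one ?_ _ _ _
  have hj' : (0 : ℤ) < j := by exact_mod_cast hj
  have : -1 ≤ ((i : ℤ) - n - 1) / j := by
    rw [Int.le_ediv_iff_mul_le hj']
    omega
  simp only [galeRobinsonPattern, mul_zero, zero_add]
  omega

/-- Lowering $n$ by $m$, $i$, $j$, $k$ or $\ell$ changes the numerator in the floor as a translation
of $(b,c)$ does, up to a multiple of $j$; the five smaller pinecones are thus the translated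
patterns of `patternSum_recurrence`. -/
theorem q_recurrence (hj : 0 < j) (hkl : k + l = i + j) (hji : j ≤ i) (hjk : j ≤ k) (hjl : j ≤ l)
    (hn : i + j ≤ n) :
    q i j k l n * q i j k l (n - (i + j)) =
      MvPolynomial.X 0 ^ 2 * (q i j k l (n - i) * q i j k l (n - j)) +
        MvPolynomial.X 1 ^ 2 * (q i j k l (n - k) * q i j k l (n - l)) := by
  have hj' : (0 : ℤ) < j := by exact_mod_cast hj
  have hkl' : (k : ℤ) + l = i + j := by exact_mod_cast hkl
  set U := galeRobinsonPattern i j k n with hUdef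
  have hU : IsPattern U := isPattern_galeRobinsonPattern hj hkl hjk hjl
  have hpos : 0 < U 0 0 := by
    have : ((i : ℤ) - n - 1) / j < -1 := by
      rw [Int.ediv_lt_iff_lt_mul hj']
      omega
    simp only [hUdef, galeRobinsonPattern, mul_zero, zero_add]
    omega
  have h01 : U 0 1 < U 0 0 := hU.strictAnti 0 (by norm_num)
  have h10 : U 1 0 < U 0 0 := by simpa using hU.succ_lt 0 0
  have hm1 : U (-1) 1 < U 0 0 := by simpa using hU.lt_succ (-1) 0
  have hdiv : ∀ a : ℤ, (a + j) / j = a / j + 1 := fun a => Int.add_ediv_of_dvd_right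
    (dvd_refl _) |>.trans (by rw [Int.ediv_self hj'.ne'])
  have em : galeRobinsonPattern i j k (n - (i + j)) = shiftPattern U 0 2 1 := by
    funext b c
    simp only [hUdef, galeRobinsonPattern, shiftPattern, add_zero]
    rw [Nat.cast_sub hn, show ((i : ℤ) + j) * (c + 1) + k * b + i - n - 1 =
      ((i : ℤ) + j) * c + k * b + i - (n - (i + j : ℕ)) - 1 by push_cast; ring]
    ring
  have ei : galeRobinsonPattern i j k (n - i) = shiftPattern U 0 0 1 := by
    funext b c
    simp only [hUdef, galeRobinsonPattern, shiftPattern, add_zero]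
    rw [Nat.cast_sub (by omega), show ((i : ℤ) + j) * (c + 1) + k * b + i - n - 1 =
      ((i : ℤ) + j) * c + k * b + i - (n - i) - 1 + j by ring, hdiv]
    ring
  have ej : galeRobinsonPattern i j k (n - j) = shiftPattern U 0 2 0 := by
    funext b c
    simp only [hUdef, galeRobinsonPattern, shiftPattern, add_zero]
    rw [Nat.cast_sub (by omega), show ((i : ℤ) + j) * c + k * b + i - (n - j) - 1 =
      ((i : ℤ) + j) * c + k * b + i - n - 1 + j by ring, hdiv]
    ring
  have ek : galeRobinsonPattern i j k (n - k) = shiftPattern U 1 1 0 := by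
    funext b c
    simp only [hUdef, galeRobinsonPattern, shiftPattern, add_zero]
    rw [Nat.cast_sub (by omega), show ((i : ℤ) + j) * c + k * (b + 1) + i - n - 1 =
      ((i : ℤ) + j) * c + k * b + i - (n - k) - 1 by ring]
    ring
  have el : galeRobinsonPattern i j k (n - l) = shiftPattern U (-1) 1 1 := by
    funext b c
    simp only [hUdef, galeRobinsonPattern, shiftPattern]
    rw [Nat.cast_sub (by omega), show ((i : ℤ) + j) * (c + 1) + k * (b + -1) + i - n - 1 =
      ((i : ℤ) + j) * c + k * b + i - (n - l) - 1 by linear_combination -hkl']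
    ring
  apply toRationalFunctions_injective
  have h := hU.patternSum_recurrence hpos (toRationalFunctions_X_ne_zero 0)
    (toRationalFunctions (MvPolynomial.X 1))
  rw [← em, ← ei, ← ej, ← ek, ← el, ← toRationalFunctions_q hj hkl hjk hjl le_rfl,
    ← toRationalFunctions_q hj hkl hjk hjl (by rw [em]; simp only [shiftPattern]; norm_num; omega),
    ← toRationalFunctions_q hj hkl hjk hjl (by rw [ei]; simp only [shiftPattern]; norm_num; omega),
    ← toRationalFunctions_q hj hkl hjk hjl (by rw [ej]; simp only [shiftPattern]; norm_num),
    ← toRationalFunctions_q hj hkl hjk hjl (by rw [ek]; simp only [shiftPattern]; norm_num; omega),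
    ← toRationalFunctions_q hj hkl hjk hjl (by rw [el]; simp only [shiftPattern]; norm_num; omega)]
    at h
  simpa only [map_add, map_mul, map_pow] using h

end GaleRobinsonPattern

/-! ### Polynomials in the squares of the variables -/

section EvenPolynomials

open MvPolynomial

variable {σ : Type*} [DecidableEq σ]

/-- The automorphism of a polynomial ring that changes the sign of one variable. -/
noncomputable def negateVariable (s : σ) : MvPolynomial σ ℤ →ₐ[ℤ] MvPolynomial σ ℤ :=
  aeval fun i => C (if i = s then -1 else 1) * X i

theorem negateVariable_expand (s : σ) (F : MvPolynomial σ ℤ) :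
    negateVariable s (expand 2 F) = expand 2 F := by
  rw [negateVariable, aeval_expand, expand, bind₁]
  congr 2
  funext i
  simp only [Pi.pow_apply, mul_pow, ← C_pow]
  split_ifs <;> simp

theorem negateVariable_monomial (s : σ) (d : σ →₀ ℕ) (r : ℤ) :
    negateVariable s (monomial d r) = C ((-1) ^ d s) * monomial d r := by
  have h : d.prod (fun i e => (C (if i = s then (-1 : ℤ) else 1) : MvPolynomial σ ℤ) ^ e) =
      C ((-1) ^ d s) := by
    rw [Finsupp.prod, Finset.prod_eq_single s]
    · simp
    · intro b _ hb
      simp [hb]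
    · intro hs
      simp [Finsupp.notMem_support_iff.1 hs]
  rw [negateVariable, aeval_monomial, monomial_eq]
  simp only [mul_pow, Finsupp.prod_mul, h, algebraMap_eq]
  ring

theorem coeff_negateVariable (s : σ) (P : MvPolynomial σ ℤ) (d : σ →₀ ℕ) :
    coeff d (negateVariable s P) = (-1) ^ d s * coeff d P := by
  induction P using MvPolynomial.induction_on' with
  | monomial e r =>
    rw [negateVariable_monomial, coeff_C_mul, coeff_monomial]
    split_ifs with h
    · rw [h]
    · simp
  | add p q hp hq => rw [map_add, coeff_add, hp, hq, coeff_add, mul_add]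

/-- Over $\mathbb Z$, changing the sign of a variable fixes both polynomials in the squares;
cancelling the nonzero factor shows that it fixes `Q`, so all exponents of `Q` are even. -/
theorem exists_expand_two_eq_of_mul_eq {Q F G : MvPolynomial σ ℕ} (hF : F ≠ 0)
    (h : Q * expand 2 F = expand 2 G) : ∃ f : MvPolynomial σ ℕ, Q = expand 2 f := by
  have hinj : Function.Injective (map (Nat.castRingHom ℤ) : MvPolynomial σ ℕ → _) :=
    map_injective _ Nat.cast_injective
  have heven : ∀ d ∈ Q.support, ∀ s, Even (d s) := by
    intro d hd s
    have h1 : map (Nat.castRingHom ℤ) Q * expand 2 (map (Nat.castRingHom ℤ) F) =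
        expand 2 (map (Nat.castRingHom ℤ) G) := by
      rw [← map_expand, ← map_expand, ← h, map_mul]
    have h2 := congrArg (negateVariable s) h1
    rw [map_mul, negateVariable_expand, negateVariable_expand, ← h1] at h2
    have h3 : expand 2 (map (Nat.castRingHom ℤ) F) ≠ 0 := by
      rw [← map_zero (expand 2 : MvPolynomial σ ℤ →ₐ[ℤ] _), ← map_zero (map (Nat.castRingHom ℤ))]
      exact (expand_injective two_pos).ne (hinj.ne hF)
    have h4 := congrArg (coeff d) (mul_right_cancel₀ h3 h2)
    rw [coeff_negateVariable, coeff_map] at h4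
    have h5 : Nat.castRingHom ℤ (coeff d Q) ≠ 0 := by
      simpa using mem_support_iff.1 hd
    by_contra hodd
    rw [Nat.not_even_iff_odd] at hodd
    rw [hodd.neg_one_pow] at h4
    have : (0 : ℤ) ≤ Nat.castRingHom ℤ (coeff d Q) := by simp
    omega
  refine ⟨∑ d ∈ Q.support, monomial (d.mapRange (· / 2) rfl) (coeff d Q), ?_⟩
  rw [map_sum]
  conv_lhs => rw [Q.as_sum]
  refine Finset.sum_congr rfl fun d hd => ?_
  rw [expand_monomial]
  refine congrArg (fun e => monomial e (coeff d Q)) (Finsupp.ext fun s => ?_)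
  simpa using (Nat.two_mul_div_two_of_even (heven d hd s)).symm

end EvenPolynomials

/-! ### From matching polynomials to the rational sequence -/

section Sequence

open MvPolynomial

variable {i j k l n : ℕ}

/-- At $u=v=1$ the right side of the recurrence is a sum of natural numbers whose first term is
nonzero by induction. -/
theorem q_ne_zero (hj : 0 < j) (hkl : k + l = i + j) (hji : j ≤ i) (hjk : j ≤ k) (hjl : j ≤ l)
    (n : ℕ) : q i j k l n ≠ 0 := by
  suffices h : eval (fun _ => 1) (q i j k l n) ≠ 0 from fun h0 => h (by rw [h0, map_zero])
  induction n using Nat.strong_induction_on with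
  | _ n ih =>
    rcases lt_or_ge n (i + j) with hn | hn
    · rw [q_eq_one hj hkl hjk hjl hn, map_one]
      exact one_ne_zero
    · have h := congrArg (eval fun _ => 1) (q_recurrence hj hkl hji hjk hjl hn)
      simp only [map_mul, map_add, map_pow, eval_X, one_pow, one_mul] at h
      have h1 := mul_ne_zero (ih (n - i) (by omega)) (ih (n - j) (by omega))
      intro h0
      rw [h0, zero_mul] at h
      omega

theorem exists_q_eq_expand (hj : 0 < j) (hkl : k + l = i + j) (hji : j ≤ i) (hjk : j ≤ k)
    (hjl : j ≤ l) (n : ℕ) : ∃ f : MvPolynomial (Fin 2) ℕ, q i j k l n = expand 2 f := by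
  induction n using Nat.strong_induction_on with
  | _ n ih =>
    rcases lt_or_ge n (i + j) with hn | hn
    · exact ⟨1, by rw [q_eq_one hj hkl hjk hjl hn, map_one]⟩
    · obtain ⟨F, hF⟩ := ih (n - (i + j)) (by omega)
      obtain ⟨a, ha⟩ := ih (n - i) (by omega)
      obtain ⟨b, hb⟩ := ih (n - j) (by omega)
      obtain ⟨c, hc⟩ := ih (n - k) (by omega)
      obtain ⟨d, hd⟩ := ih (n - l) (by omega)
      have h0 := q_ne_zero hj hkl hji hjk hjl (n - (i + j))
      refine exists_expand_two_eq_of_mul_eq (F := F) (G := X 0 * (a * b) + X 1 * (c * d)) ?_ ?_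
      · rintro rfl
        exact h0 (by rw [hF, map_zero])
      · rw [← hF, q_recurrence hj hkl hji hjk hjl hn, ha, hb, hc, hd]
        simp only [map_add, map_mul, expand_X]

theorem isGaleRobinsonSequence_of_q_eq_expand (hj : 0 < j) (hkl : k + l = i + j) (hji : j ≤ i)
    (hjk : j ≤ k) (hjl : j ≤ l) {f : ℕ → MvPolynomial (Fin 2) ℕ}
    (hf : ∀ n, q i j k l n = expand 2 (f n)) :
    IsGaleRobinsonSequence i j k l (i + j) (X 0) (X 1) f := by
  refine ⟨fun n hn => expand_injective two_pos ?_, fun n hn => expand_injective two_pos ?_⟩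
  · rw [← hf, q_eq_one hj hkl hjk hjl hn, map_one]
  · simp only [map_add, map_mul, expand_X, ← hf]
    exact q_recurrence hj hkl hji hjk hjl hn

theorem IsGaleRobinsonSequence.map {R S : Type*} [CommSemiring R] [CommSemiring S] {m : ℕ}
    {w z : R} {p : ℕ → R} (h : IsGaleRobinsonSequence i j k l m w z p) (φ : R →+* S) :
    IsGaleRobinsonSequence i j k l m (φ w) (φ z) fun n => φ (p n) := by
  refine ⟨fun n hn => by simp only [h.1 n hn, map_one], fun n hn => ?_⟩
  simpa only [map_add, map_mul] using congrArg φ (h.2 n hn)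

/-- One solution without zeros suffices: then $p(n-m)$ can be cancelled and the recurrence
determines $p(n)$. -/
theorem IsGaleRobinsonSequence.eq_of_ne_zero {R : Type*} [CommRing R] [IsDomain R] {w z : R}
    {p p' : ℕ → R} (hi : 0 < i) (hj : 0 < j) (hk : 0 < k) (hl : 0 < l)
    (h : IsGaleRobinsonSequence i j k l (i + j) w z p)
    (h' : IsGaleRobinsonSequence i j k l (i + j) w z p') (h0 : ∀ n, p n ≠ 0) : p' = p := by
  funext n
  induction n using Nat.strong_induction_on with
  | _ n ih =>
    rcases lt_or_ge n (i + j) with hn | hn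
    · rw [h.1 n hn, h'.1 n hn]
    · have e := h'.2 n hn
      rw [ih (n - (i + j)) (by omega), ih (n - i) (by omega), ih (n - j) (by omega),
        ih (n - k) (by omega), ih (n - l) (by omega), ← h.2 n hn] at e
      exact mul_right_cancel₀ (h0 _) e

end Sequence

end GaleRobinson

theorem mainTheorem4 (i j k l m : ℕ) (hi : 0 < i) (hj : 0 < j) (hk : 0 < k) (hl : 0 < l)
    (hij : i + j = m) (hkl : k + l = m) (hji : j ≤ i) (hjk : j ≤ k) (hjl : j ≤ l) :
    (∀ n, n < m → GaleRobinson.q i j k l n = 1) ∧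
    (∀ n, m ≤ n →
      GaleRobinson.q i j k l n * GaleRobinson.q i j k l (n - m) =
        MvPolynomial.X 0 ^ 2 * (GaleRobinson.q i j k l (n - i) * GaleRobinson.q i j k l (n - j)) +
        MvPolynomial.X 1 ^ 2 *
          (GaleRobinson.q i j k l (n - k) * GaleRobinson.q i j k l (n - l))) ∧
    ∃ p : ℕ → GaleRobinson.RationalFunctions,
      GaleRobinson.IsGaleRobinsonSequence i j k l m
        (algebraMap (MvPolynomial (Fin 2) ℤ) GaleRobinson.RationalFunctions (MvPolynomial.X 0))
        (algebraMap (MvPolynomial (Fin 2) ℤ) GaleRobinson.RationalFunctions (MvPolynomial.X 1)) p ∧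
      (∀ p' : ℕ → GaleRobinson.RationalFunctions,
        GaleRobinson.IsGaleRobinsonSequence i j k l m
          (algebraMap (MvPolynomial (Fin 2) ℤ) GaleRobinson.RationalFunctions (MvPolynomial.X 0))
          (algebraMap (MvPolynomial (Fin 2) ℤ) GaleRobinson.RationalFunctions (MvPolynomial.X 1))
          p' → p' = p) ∧
      ∀ n, ∃ f : MvPolynomial (Fin 2) ℕ,
        p n = algebraMap (MvPolynomial (Fin 2) ℤ) GaleRobinson.RationalFunctions
          (MvPolynomial.map (Nat.castRingHom ℤ) f) ∧
        GaleRobinson.q i j k l n =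
          MvPolynomial.bind₁ ![MvPolynomial.X 0 ^ 2, MvPolynomial.X 1 ^ 2] f := by
  subst hij
  refine ⟨fun n hn => GaleRobinson.q_eq_one hj hkl hjk hjl hn,
    fun n hn => GaleRobinson.q_recurrence hj hkl hji hjk hjl hn, ?_⟩
  choose f hf using GaleRobinson.exists_q_eq_expand hj hkl hji hjk hjl
  have hX : ∀ s, GaleRobinson.toRationalFunctions (MvPolynomial.X s) =
      algebraMap (MvPolynomial (Fin 2) ℤ) GaleRobinson.RationalFunctions (MvPolynomial.X s) := by
    intro s
    rw [GaleRobinson.toRationalFunctions, RingHom.comp_apply, MvPolynomial.map_X]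
  have hp := (GaleRobinson.isGaleRobinsonSequence_of_q_eq_expand hj hkl hji hjk hjl hf).map
    GaleRobinson.toRationalFunctions
  rw [hX, hX] at hp
  have h0 : ∀ n, GaleRobinson.toRationalFunctions (f n) ≠ 0 := by
    intro n
    rw [← map_zero GaleRobinson.toRationalFunctions]
    refine GaleRobinson.toRationalFunctions_injective.ne fun h => ?_
    exact GaleRobinson.q_ne_zero hj hkl hji hjk hjl n (by rw [hf, h, map_zero])
  refine ⟨_, hp, fun p' hp' => hp.eq_of_ne_zero hi hj hk hl hp' h0, fun n => ⟨f n, rfl, ?_⟩⟩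
  rw [hf, MvPolynomial.expand]
  congr 2
  funext s
  fin_cases s <;> rfl
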